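/- Let $D\subset\mathbb R^2$ be the closed unit disk. For a planar convex body $\Omega$ (non-empty, compact, convex) let $|\Omega|$ be its area and $\operatorname{Per}(\Omega)$ its perimeter, i.e. the supremum of the lengths of the convex polygons with vertices in $\Omega$; a segment of length $\ell$ is a degenerate convex polygon with two sides, so its perimeter is $2\ell$. For $\lambda>0$ consider the problem $$\min\{\lambda|\Omega|-\operatorname{Per}(\Omega)\;:\;\Omega\subset D \text{ a convex body}\}.\tag{1}$$ Call $(m,\theta)$ admissible if $m\ge 3$ is an integer and $0<\theta\le \frac{2\pi}{m}$. A polygon of type $(m,\theta)$ is a convex $m$-gon inscribed in $\partial D$ one of whose sides subtends the central angle $\theta$ while each of the $m-1$ other sides subtends the central angle $\frac{2\pi-\theta}{m-1}$. Put $$F_\lambda(m,\theta)=\frac{\lambda}{2}\Big(\sin\theta+(m-1)\sin\frac{2\pi-\theta}{m-1}\Big)-2\Big(\sin\frac{\theta}{2}+(m-1)\sin\frac{2\pi-\theta}{2(m-1)}\Big).$$ **Theorem.** For every $\lambda>0$: 1. Problem (1) has a solution. 2. Every solution $\Omega$ of (1) is the disk $D$, or a diameter of $D$, or a polygon of type $(m,\theta)$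 for some admissible $(m,\theta)$ such that $$(m-1)\sin\frac{2\pi}{m-1}<2|\Omega|\le m\sin\frac{2\pi}{m},\qquad \sin\theta+(m-1)\sin\frac{2\pi-\theta}{m-1}=2|\Omega|,$$ and either $\theta=\frac{2\pi}{m}$ (regular polygon) or $\lambda=\Big(\cos\frac{\theta}{2}+\cos\frac{2\pi-\theta}{2(m-1)}\Big)^{-1}$. 3. The polygonal solutions are characterised by $\lambda$: if $(m,\theta)$ is admissible, a polygon of type $(m,\theta)$ solves (1) if and only if $F_\lambda(m,\theta)\le F_\lambda(k,s)$ for all admissible $(k,s)$. Moreover, there is a countable set $E\subset\mathbb R$ such that for every $\lambda>0$ with $\lambda\notin E$ the solution of (1) is unique up to a rotation about the centre of $D$. -/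

import Mathlib

open Real

noncomputable section

namespace ReverseIsoperimetric

/-- Twice the signed area of the triangle `a b c` in the plane `ℂ`; it is positive exactly when
`a, b, c` is a non-degenerate triangle listed counterclockwise. -/
def cross (a b c : ℂ) : ℝ := ((starRingEnd ℂ) (b - a) * (c - a)).im

/-- The points `p 0, …, p n` are the vertices of a (strictly) convex polygon, listed
counterclockwise. For one or two points the condition is void: a point and a twice covered
segment are the degenerate polygons with one and two vertices. -/
def IsConvexPolygon {n : ℕ} (p : Fin (n + 1) → ℂ) : Prop :=
  ∀ i j k : Fin (n + 1), i < j → j < k → 0 < cross (p i) (p j) (p k)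

/-- The length of the closed polygonal line `p 0, p 1, …, p n, p 0`
(the addition in `Fin (n + 1)` is cyclic). -/
def polygonLength {n : ℕ} (p : Fin (n + 1) → ℂ) : ℝ :=
  ∑ i, dist (p i) (p (i + 1))

/-- The perimeter of a planar convex body: the least upper bound of the lengths of the convex
polygons with vertices in the body. The perimeter of a segment is twice its length. -/
def perimeter (K : ConvexBody ℂ) : ℝ :=
  sSup {l : ℝ | ∃ (n : ℕ) (p : Fin (n + 1) → ℂ),
    (∀ i, p i ∈ K) ∧ IsConvexPolygon p ∧ l = polygonLength p}

/-- The area of a planar convex body. -/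
def area (K : ConvexBody ℂ) : ℝ := (MeasureTheory.volume (K : Set ℂ)).toReal

/-- The (closed) unit disk. -/
def unitDisk : Set ℂ := Metric.closedBall 0 1

/-- The functional `lam * |K| - Per K`. -/
def energy (lam : ℝ) (K : ConvexBody ℂ) : ℝ := lam * area K - perimeter K

/-- `K` minimises `lam * |K| - Per K` among the convex bodies contained in the unit disk. -/
def IsSolution (lam : ℝ) (K : ConvexBody ℂ) : Prop :=
  (K : Set ℂ) ⊆ unitDisk ∧
    ∀ L : ConvexBody ℂ, (L : Set ℂ) ⊆ unitDisk → energy lam K ≤ energy lam L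

/-- `K` is a diameter of the unit disk. -/
def IsDiameter (K : Set ℂ) : Prop := ∃ u : ℂ, ‖u‖ = 1 ∧ K = segment ℝ (-u) u

/-- `K` is a convex polygon with `m` sides inscribed in the unit circle, whose consecutive sides,
in counterclockwise order, subtend the central angles `θ 0, …, θ (m - 1)`. -/
def IsInscribedPolygon (K : Set ℂ) (m : ℕ) (θ : Fin m → ℝ) : Prop :=
  3 ≤ m ∧ (∀ i, 0 < θ i) ∧ ∑ i, θ i = 2 * π ∧
    ∃ α : ℝ, K = convexHull ℝ (Set.range fun i : Fin m =>
      Complex.exp (((α + ∑ j ∈ Finset.univ.filter (fun j => j < i), θ j : ℝ) : ℂ) * Complex.I))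

/-- The pairs `(m, t)`: a number of sides `m ≥ 3` and a smallest central angle
`t ∈ (0, 2π/m]`. -/
def Admissible (m : ℕ) (t : ℝ) : Prop := 3 ≤ m ∧ 0 < t ∧ t ≤ 2 * π / m

/-- `K` is an inscribed polygon with `m` sides, one of which subtends the central angle `t`, while
all the other ones subtend the same central angle `(2π - t)/(m - 1)`. -/
def IsPolygonOfType (K : Set ℂ) (m : ℕ) (t : ℝ) : Prop :=
  ∃ θ : Fin m → ℝ, IsInscribedPolygon K m θ ∧
    ∃ i₀ : Fin m, θ i₀ = t ∧ ∀ i, i ≠ i₀ → θ i = (2 * π - t) / (m - 1)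

/-- The explicit function of `(m, t)` to which `lam * |K| - Per K` reduces on polygons of type
`(m, t)`. -/
def reducedEnergy (lam : ℝ) (m : ℕ) (t : ℝ) : ℝ :=
  lam * (1 / 2 * (sin t + (m - 1) * sin ((2 * π - t) / (m - 1))))
    - 2 * (sin (t / 2) + (m - 1) * sin ((2 * π - t) / (2 * (m - 1))))

end ReverseIsoperimetric

end

open ReverseIsoperimetric

noncomputable section

namespace ReverseIsoperimetric

open MeasureTheory Set

/-! ### Support function and Cauchy perimeter -/

/-- The component of `z` in the direction `(cos φ, sin φ)`. -/
def comp (φ : ℝ) (z : ℂ) : ℝ := z.re * cos φ + z.im * sin φ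

lemma comp_add (φ : ℝ) (z w : ℂ) : comp φ (z + w) = comp φ z + comp φ w := by
  simp only [comp, Complex.add_re, Complex.add_im]; ring

lemma comp_sub (φ : ℝ) (z w : ℂ) : comp φ (z - w) = comp φ z - comp φ w := by
  simp only [comp, Complex.sub_re, Complex.sub_im]; ring

lemma comp_smul (φ r : ℝ) (z : ℂ) : comp φ (r • z) = r * comp φ z := by
  simp only [comp, Complex.smul_re, Complex.smul_im, smul_eq_mul]; ring

lemma comp_add_pi (φ : ℝ) (z : ℂ) : comp (φ + π) z = -comp φ z := by
  simp only [comp, cos_add_pi, sin_add_pi]; ring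

lemma continuous_comp : Continuous fun x : ℝ × ℂ => comp x.1 x.2 := by
  unfold comp
  have h1 := Complex.continuous_re.comp (continuous_snd (X := ℝ) (Y := ℂ))
  have h2 := Complex.continuous_im.comp (continuous_snd (X := ℝ) (Y := ℂ))
  exact (h1.mul (continuous_cos.comp continuous_fst)).add
    (h2.mul (continuous_sin.comp continuous_fst))

@[fun_prop]
lemma continuous_comp_left (z : ℂ) : Continuous fun φ => comp φ z := by
  unfold comp; fun_prop

@[fun_prop]
lemma continuous_comp_right (φ : ℝ) : Continuous (comp φ) := by
  unfold comp
  exact (Complex.continuous_re.mul continuous_const).add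
    (Complex.continuous_im.mul continuous_const)

lemma comp_eq_norm_mul_cos (φ : ℝ) (z : ℂ) : comp φ z = ‖z‖ * cos (φ - z.arg) := by
  rw [comp, cos_sub]
  nth_rewrite 1 [← Complex.norm_mul_cos_arg z]
  nth_rewrite 1 [← Complex.norm_mul_sin_arg z]
  ring

lemma comp_le_norm (φ : ℝ) (z : ℂ) : comp φ z ≤ ‖z‖ := by
  rw [comp_eq_norm_mul_cos]
  exact mul_le_of_le_one_right (norm_nonneg _) (cos_le_one _)

lemma integral_abs_cos : ∫ x in (0 : ℝ)..(2 * π), |cos x| = 4 := by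
  have hper : Function.Periodic (fun x : ℝ => |cos x|) (2 * π) := fun x => by
    simp [cos_add_two_pi]
  have h0 := hper.intervalIntegral_add_eq 0 (-(π / 2))
  rw [zero_add] at h0
  rw [h0]
  have hi : ∀ a b : ℝ, IntervalIntegrable (fun x : ℝ => |cos x|) volume a b := fun a b =>
    (continuous_cos.abs).intervalIntegrable a b
  rw [← intervalIntegral.integral_add_adjacent_intervals (hi _ (π / 2)) (hi _ _)]
  have h1 : ∫ x in (-(π / 2))..(π / 2), |cos x| = ∫ x in (-(π / 2))..(π / 2), cos x := by
    apply intervalIntegral.integral_congr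
    intro x hx
    rw [uIcc_of_le (by linarith [pi_pos])] at hx
    exact abs_of_nonneg (cos_nonneg_of_mem_Icc hx)
  have h2 : ∫ x in (π / 2)..(-(π / 2) + 2 * π), |cos x|
      = ∫ x in (π / 2)..(-(π / 2) + 2 * π), -cos x := by
    apply intervalIntegral.integral_congr
    intro x hx
    rw [uIcc_of_le (by linarith [pi_pos])] at hx
    exact abs_of_nonpos (cos_nonpos_of_pi_div_two_le_of_le hx.1 (by linarith [hx.2]))
  rw [h1, h2, integral_cos, intervalIntegral.integral_neg, integral_cos,
    sin_add_two_pi, sin_neg, sin_pi_div_two]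
  norm_num

lemma integral_abs_comp (z : ℂ) : ∫ φ in (0 : ℝ)..(2 * π), |comp φ z| = 4 * ‖z‖ := by
  have h : ∀ φ, |comp φ z| = ‖z‖ * |cos (φ - z.arg)| := fun φ => by
    rw [comp_eq_norm_mul_cos, abs_mul, abs_norm]
  simp only [h, intervalIntegral.integral_const_mul]
  have hper : Function.Periodic (fun x : ℝ => |cos x|) (2 * π) := fun x => by
    simp [cos_add_two_pi]
  have h0 := hper.intervalIntegral_add_eq 0 (0 - z.arg)
  rw [intervalIntegral.integral_comp_sub_right (fun x => |cos x|) z.arg,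
    show 2 * π - z.arg = 0 - z.arg + 2 * π by ring, ← h0, zero_add, integral_abs_cos]
  ring

/-- The support function of a planar set. -/
def supp (S : Set ℂ) (φ : ℝ) : ℝ := sSup (comp φ '' S)

/-- The perimeter of a planar convex body by Cauchy's formula. -/
def cauchyPer (S : Set ℂ) : ℝ := ∫ φ in (0 : ℝ)..(2 * π), supp S φ

lemma le_supp {S : Set ℂ} (hS : IsCompact S) {z : ℂ} (hz : z ∈ S) (φ : ℝ) :
    comp φ z ≤ supp S φ :=
  le_csSup (hS.image (continuous_comp_right φ)).bddAbove (mem_image_of_mem _ hz)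

lemma supp_le {S : Set ℂ} (hS : S.Nonempty) {φ a : ℝ} (h : ∀ z ∈ S, comp φ z ≤ a) :
    supp S φ ≤ a :=
  csSup_le (hS.image _) (by rintro _ ⟨z, hz, rfl⟩; exact h z hz)

lemma exists_supp_eq {S : Set ℂ} (hS : IsCompact S) (hn : S.Nonempty) (φ : ℝ) :
    ∃ z ∈ S, supp S φ = comp φ z := by
  obtain ⟨z, hz, h⟩ := hS.exists_isMaxOn hn (continuous_comp_right φ).continuousOn
  exact ⟨z, hz, le_antisymm (supp_le hn fun w hw => h hw) (le_supp hS hz φ)⟩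

lemma continuous_supp {S : Set ℂ} (hS : IsCompact S) : Continuous (supp S) :=
  hS.continuous_sSup (f := comp) continuous_comp

lemma supp_intervalIntegrable {S : Set ℂ} (hS : IsCompact S) (a b : ℝ) :
    IntervalIntegrable (supp S) volume a b :=
  (continuous_supp hS).intervalIntegrable a b

lemma supp_mono {S T : Set ℂ} (hn : S.Nonempty) (hT : IsCompact T) (h : S ⊆ T) (φ : ℝ) :
    supp S φ ≤ supp T φ :=
  supp_le hn fun _ hz => le_supp hT (h hz) φ

lemma cauchyPer_mono {S T : Set ℂ} (hn : S.Nonempty) (hS : IsCompact S) (hT : IsCompact T)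
    (h : S ⊆ T) : cauchyPer S ≤ cauchyPer T :=
  intervalIntegral.integral_mono_on (by positivity) (supp_intervalIntegrable hS _ _)
    (supp_intervalIntegrable hT _ _) fun φ _ => supp_mono hn hT h φ

/-- Moving every point by at most `δ` changes each support value by at most `δ`. This serves both
the semicontinuity of the energy and the approximation of a minimiser by polygons. -/
lemma cauchyPer_le_of_near {S T : Set ℂ} (hn : S.Nonempty) (hS : IsCompact S) (hT : IsCompact T)
    {δ : ℝ} (h : ∀ z ∈ S, ∃ w ∈ T, ‖z - w‖ ≤ δ) : cauchyPer S ≤ cauchyPer T + 2 * π * δ := by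
  have h1 : cauchyPer T + 2 * π * δ = ∫ φ in (0 : ℝ)..(2 * π), (supp T φ + δ) := by
    rw [intervalIntegral.integral_add (supp_intervalIntegrable hT _ _) (by simp)]
    simp [cauchyPer]
  rw [h1]
  refine intervalIntegral.integral_mono_on (by positivity) (supp_intervalIntegrable hS _ _)
    ((supp_intervalIntegrable hT _ _).add (by simp)) fun φ _ => supp_le hn fun z hz => ?_
  obtain ⟨w, hw, hd⟩ := h z hz
  have := comp_le_norm φ (z - w)
  rw [comp_sub] at this
  linarith [le_supp hT hw φ]

lemma comp_convexHull_le {S : Set ℂ} {φ a : ℝ} (h : ∀ z ∈ S, comp φ z ≤ a) {z : ℂ}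
    (hz : z ∈ convexHull ℝ S) : comp φ z ≤ a := by
  have hc : Convex ℝ {z : ℂ | comp φ z ≤ a} := by
    intro x hx y hy s t hs ht hst
    simp only [mem_ofPred_eq, comp_add, comp_smul] at *
    obtain rfl : t = 1 - s := by linarith
    nlinarith
  exact convexHull_min (fun z hz => h z hz) hc hz

/-- The support function is a valuation on convex bodies. -/
lemma supp_union_add_inter {K L : Set ℂ} (hK : IsCompact K) (hL : IsCompact L)
    (hKn : K.Nonempty) (hLn : L.Nonempty) (hc : Convex ℝ (K ∪ L)) (φ : ℝ) :
    supp (K ∪ L) φ + supp (K ∩ L) φ = supp K φ + supp L φ := by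
  obtain ⟨x, hx, hxs⟩ := exists_supp_eq hK hKn φ
  obtain ⟨y, hy, hys⟩ := exists_supp_eq hL hLn φ
  have hU : supp (K ∪ L) φ = max (supp K φ) (supp L φ) := by
    apply le_antisymm
    · refine supp_le (hKn.mono subset_union_left) ?_
      rintro z (hz | hz)
      · exact le_max_of_le_left (le_supp hK hz φ)
      · exact le_max_of_le_right (le_supp hL hz φ)
    · exact max_le (supp_mono hKn (hK.union hL) subset_union_left φ)
        (supp_mono hLn (hK.union hL) subset_union_right φ)
  have hseg : segment ℝ x y ⊆ K ∪ L := hc.segment_subset (Or.inl hx) (Or.inr hy)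
  -- The segment joining the two maximisers is connected and covered by two closed sets, so it meets
  -- `K ∩ L`; there the component is at least the smaller of the two maxima.
  obtain ⟨w, hw, hwK, hwL⟩ := (isPreconnected_closed_iff.1 (convex_segment (𝕜 := ℝ) x y).isPreconnected)
    K L hK.isClosed hL.isClosed hseg ⟨x, left_mem_segment ℝ x y, hx⟩
    ⟨y, right_mem_segment ℝ x y, hy⟩
  have hwI : w ∈ K ∩ L := ⟨hwK, hwL⟩
  have hI : supp (K ∩ L) φ = min (supp K φ) (supp L φ) := by
    apply le_antisymm
    · exact le_min (supp_mono ⟨w, hwI⟩ hK inter_subset_left φ)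
        (supp_mono ⟨w, hwI⟩ hL inter_subset_right φ)
    · refine le_trans ?_ (le_supp (hK.inter hL) hwI φ)
      obtain ⟨a, b, ha, hb, hab, rfl⟩ := hw
      rw [comp_add, comp_smul, comp_smul, ← hxs, ← hys]
      have h1 := min_le_left (supp K φ) (supp L φ)
      have h2 := min_le_right (supp K φ) (supp L φ)
      obtain rfl : b = 1 - a := by linarith
      nlinarith
  rw [hU, hI, max_add_min]

lemma cauchyPer_union_add_inter {K L : Set ℂ} (hK : IsCompact K) (hL : IsCompact L)
    (hKn : K.Nonempty) (hLn : L.Nonempty) (hc : Convex ℝ (K ∪ L)) :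
    cauchyPer (K ∪ L) + cauchyPer (K ∩ L) = cauchyPer K + cauchyPer L := by
  unfold cauchyPer
  rw [← intervalIntegral.integral_add (supp_intervalIntegrable (hK.union hL) _ _)
    (supp_intervalIntegrable (hK.inter hL) _ _),
    ← intervalIntegral.integral_add (supp_intervalIntegrable hK _ _)
    (supp_intervalIntegrable hL _ _)]
  exact intervalIntegral.integral_congr fun φ _ => supp_union_add_inter hK hL hKn hLn hc φ

lemma supp_periodic (S : Set ℂ) : Function.Periodic (supp S) (2 * π) := fun φ => by
  have : comp (φ + 2 * π) = comp φ := by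
    ext z; simp [comp]
  simp [supp, this]

/-- The Cauchy perimeter is half the integral of the width. -/
lemma two_mul_cauchyPer {S : Set ℂ} (hS : IsCompact S) :
    2 * cauchyPer S = ∫ φ in (0 : ℝ)..(2 * π), (supp S φ + supp S (φ + π)) := by
  have h2 : ∫ φ in (0 : ℝ)..(2 * π), supp S (φ + π) = cauchyPer S := by
    rw [intervalIntegral.integral_comp_add_right (supp S)]
    have := (supp_periodic S).intervalIntegral_add_eq π 0
    rw [zero_add, add_comm π] at this
    rw [zero_add, this, cauchyPer]
  have hi : IntervalIntegrable (fun φ => supp S (φ + π)) volume 0 (2 * π) :=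
    Continuous.intervalIntegrable ((continuous_supp hS).comp (continuous_add_const π)) _ _
  rw [intervalIntegral.integral_add (supp_intervalIntegrable hS _ _) hi, h2, ← cauchyPer]
  ring

lemma supp_convexHull_eq {S : Set ℂ} (hS : S.Finite) (hn : S.Nonempty) (φ : ℝ) :
    supp (convexHull ℝ S) φ = supp S φ := by
  apply le_antisymm
  · exact supp_le (hn.mono (subset_convexHull ℝ S)) fun z hz =>
      comp_convexHull_le (fun w hw => le_supp hS.isCompact hw φ) hz
  · exact supp_mono hn (hS.isCompact_convexHull ℝ) (subset_convexHull ℝ S) φ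

lemma cauchyPer_convexHull_pair (p q : ℂ) :
    cauchyPer (convexHull ℝ {p, q}) = 2 * dist p q := by
  have hf : ({p, q} : Set ℂ).Finite := by simp
  have hs : ∀ φ, supp (convexHull ℝ {p, q}) φ = max (comp φ p) (comp φ q) := fun φ => by
    rw [supp_convexHull_eq hf (by simp), supp, image_pair, csSup_pair]
  have h := two_mul_cauchyPer (hf.isCompact_convexHull ℝ)
  have h3 : ∀ φ, supp (convexHull ℝ {p, q}) φ + supp (convexHull ℝ {p, q}) (φ + π)
      = |comp φ (p - q)| := fun φ => by
    rw [hs, hs, comp_add_pi, comp_add_pi, comp_sub]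
    rcases le_total (comp φ p) (comp φ q) with h | h
    · rw [max_eq_right h, max_eq_left (by linarith), abs_of_nonpos (by linarith)]; ring
    · rw [max_eq_left h, max_eq_right (by linarith), abs_of_nonneg (by linarith)]; ring
  simp only [h3, integral_abs_comp] at h
  rw [dist_eq_norm]; linarith

lemma cauchyPer_segment (p q : ℂ) : cauchyPer (segment ℝ p q) = 2 * dist p q := by
  rw [← convexHull_pair, cauchyPer_convexHull_pair]

/-- In each direction the longest projection of a side equals the sum of the other two, so the width
of the triangle is half the sum of the projected sides; integrate with `integral_abs_comp`. -/
lemma cauchyPer_triangle (c p q : ℂ) :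
    cauchyPer (convexHull ℝ {c, p, q}) = dist c p + dist p q + dist c q := by
  have hf : ({c, p, q} : Set ℂ).Finite := by simp
  have hs : ∀ φ, supp (convexHull ℝ {c, p, q}) φ
      = max (comp φ c) (max (comp φ p) (comp φ q)) := fun φ => by
    rw [supp_convexHull_eq hf (by simp), supp, image_insert_eq, image_pair,
      csSup_insert (by simp) (by simp), csSup_pair]
  have h := two_mul_cauchyPer (hf.isCompact_convexHull ℝ)
  have h3 : ∀ φ, supp (convexHull ℝ {c, p, q}) φ + supp (convexHull ℝ {c, p, q}) (φ + π)
      = 1 / 2 * |comp φ (c - p)| + 1 / 2 * |comp φ (p - q)| + 1 / 2 * |comp φ (c - q)| := fun φ => by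
    rw [hs, hs, comp_add_pi, comp_add_pi, comp_add_pi, comp_sub, comp_sub, comp_sub]
    grind
  have hi : ∀ z : ℂ, IntervalIntegrable (fun φ => 1 / 2 * |comp φ z|) volume 0 (2 * π) := fun z =>
    (by fun_prop : Continuous fun φ => 1 / 2 * |comp φ z|).intervalIntegrable _ _
  simp only [h3] at h
  rw [intervalIntegral.integral_add ((hi _).add (hi _)) (hi _),
    intervalIntegral.integral_add (hi _) (hi _)] at h
  simp only [intervalIntegral.integral_const_mul, integral_abs_comp] at h
  simp only [dist_eq_norm]; linarith

lemma cauchyPer_unitDisk : cauchyPer unitDisk = 2 * π := by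
  have hs : ∀ φ, supp unitDisk φ = 1 := fun φ => by
    have hc : IsCompact unitDisk := isCompact_closedBall 0 1
    apply le_antisymm
    · refine supp_le ⟨0, by simp [unitDisk]⟩ fun z hz => (comp_le_norm φ z).trans ?_
      simpa [unitDisk] using hz
    · have h1 : Complex.exp (φ * Complex.I) ∈ unitDisk := by simp [unitDisk]
      have := le_supp hc h1 φ
      rwa [comp, Complex.exp_ofReal_mul_I_re, Complex.exp_ofReal_mul_I_im, ← sq, ← sq,
        cos_sq_add_sin_sq] at this
  simp [cauchyPer, hs]

lemma exists_comp_separation {S : Set ℂ} (hSc : Convex ℝ S) (hS : IsClosed S)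
    (hn : S.Nonempty) {z : ℂ} (hz : z ∉ S) :
    ∃ φ a, (∀ s ∈ S, comp φ s < a) ∧ a < comp φ z := by
  obtain ⟨f, u, hf, hu⟩ := geometric_hahn_banach_closed_point hSc hS hz
  set w : ℂ := ⟨f 1, f Complex.I⟩ with hw
  have hfz : ∀ z : ℂ, f z = ‖w‖ * comp w.arg z := fun z => by
    have e1 : z = z.re • (1 : ℂ) + z.im • Complex.I := by
      apply Complex.ext <;> simp
    have a : ‖w‖ * cos w.arg = f 1 := Complex.norm_mul_cos_arg w
    have b : ‖w‖ * sin w.arg = f Complex.I := Complex.norm_mul_sin_arg w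
    conv_lhs => rw [e1, map_add, map_smul, map_smul, smul_eq_mul, smul_eq_mul, ← a, ← b]
    rw [comp]; ring
  have hw0 : 0 < ‖w‖ := by
    rcases (norm_nonneg w).lt_or_eq with h | h
    · exact h
    · obtain ⟨s, hs⟩ := hn
      have h1 := hf s hs
      rw [hfz, ← h, zero_mul] at h1 hu
      linarith
  refine ⟨w.arg, u / ‖w‖, fun s hs => ?_, ?_⟩
  · rw [lt_div_iff₀ hw0, mul_comm, ← hfz]; exact hf s hs
  · rw [div_lt_iff₀ hw0, mul_comm, ← hfz]; exact hu

/-- A convex body is determined inside a larger one by its Cauchy perimeter. -/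
lemma subset_of_cauchyPer_le {S T : Set ℂ} (hS : IsCompact S) (hSc : Convex ℝ S)
    (hn : S.Nonempty) (hT : IsCompact T) (h : S ⊆ T) (hp : cauchyPer T ≤ cauchyPer S) :
    T ⊆ S := by
  -- Ordered continuous functions with the same integral coincide, and a compact convex set is
  -- recovered from its support function by separation.
  have heq : ∀ φ ∈ Icc 0 (2 * π), supp T φ = supp S φ := by
    by_contra! hne
    obtain ⟨φ, hφ, hne⟩ := hne
    have : cauchyPer S < cauchyPer T :=
      intervalIntegral.integral_lt_integral_of_continuousOn_of_le_of_exists_lt (by positivity)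
        (continuous_supp hS).continuousOn (continuous_supp hT).continuousOn
        (fun ψ _ => supp_mono hn hT h ψ)
        ⟨φ, hφ, lt_of_le_of_ne (supp_mono hn hT h φ) (Ne.symm hne)⟩
    linarith
  have heq' : ∀ φ, supp T φ = supp S φ := fun φ => by
    have h2 : (0 : ℝ) < 2 * π := by positivity
    obtain ⟨ψ, hψ, e⟩ := ((supp_periodic T).sub (supp_periodic S)).exists_mem_Ico₀ h2 φ
    have := heq ψ ⟨hψ.1, hψ.2.le⟩
    simp only [Pi.sub_apply] at e
    linarith
  intro z hz
  by_contra hzS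
  obtain ⟨φ, a, h1, h2⟩ := exists_comp_separation hSc hS.isClosed hn hzS
  obtain ⟨s, hs, hss⟩ := exists_supp_eq hS hn φ
  have h3 := le_supp hT hz φ
  rw [heq', hss] at h3
  linarith [h1 s hs]

/-! ### Triangles -/

lemma cross_def (a b c : ℂ) :
    cross a b c = (b.re - a.re) * (c.im - a.im) - (b.im - a.im) * (c.re - a.re) := by
  simp [cross]; ring

lemma cross_rotate (a b c : ℂ) : cross b c a = cross a b c := by
  simp only [cross_def]; ring

lemma cross_swap (a b c : ℂ) : cross a c b = -cross a b c := by
  simp only [cross_def]; ring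

lemma cross_add_cross_add_cross (c p q z : ℂ) :
    cross z p q + cross c z q + cross c p z = cross c p q := by
  simp only [cross_def]; ring

/-- Barycentric coordinates. -/
lemma cross_smul_eq (c p q z : ℂ) :
    cross c p q • z = cross z p q • c + cross c z q • p + cross c p z • q := by
  apply Complex.ext <;> simp [cross_def] <;> ring

lemma cross_combo_left (p q x y : ℂ) {a b : ℝ} (h : a + b = 1) :
    cross (a • x + b • y) p q = a * cross x p q + b * cross y p q := by
  obtain rfl : b = 1 - a := by linarith
  simp [cross_def]; ring

lemma cross_combo_mid (c q x y : ℂ) {a b : ℝ} (h : a + b = 1) :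
    cross c (a • x + b • y) q = a * cross c x q + b * cross c y q := by
  obtain rfl : b = 1 - a := by linarith
  simp [cross_def]; ring

lemma cross_combo_right (c p x y : ℂ) {a b : ℝ} (h : a + b = 1) :
    cross c p (a • x + b • y) = a * cross c p x + b * cross c p y := by
  obtain rfl : b = 1 - a := by linarith
  simp [cross_def]; ring

@[simp] lemma cross_self_left (a b : ℂ) : cross a a b = 0 := by simp [cross_def]
@[simp] lemma cross_self_right (a b : ℂ) : cross a b b = 0 := by simp [cross_def]; ring
@[simp] lemma cross_self_outer (a b : ℂ) : cross a b a = 0 := by simp [cross_def]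

@[fun_prop]
lemma continuous_cross_left (p q : ℂ) : Continuous fun z => cross z p q := by
  simp only [cross_def]; fun_prop

@[fun_prop]
lemma continuous_cross_mid (p q : ℂ) : Continuous fun z => cross p z q := by
  simp only [cross_def]; fun_prop

@[fun_prop]
lemma continuous_cross_right (p q : ℂ) : Continuous fun z => cross p q z := by
  simp only [cross_def]; fun_prop

lemma combo_mem {S : Set ℂ} (hS : Convex ℝ S) {c p q : ℂ} (hc : c ∈ S) (hp : p ∈ S)
    (hq : q ∈ S) {a b d : ℝ} (ha : 0 ≤ a) (hb : 0 ≤ b) (hd : 0 ≤ d) (h : a + b + d = 1) :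
    a • c + b • p + d • q ∈ S := by
  have := hS.sum_mem (t := Finset.univ) (w := ![a, b, d]) (z := ![c, p, q])
    (by intro i _; fin_cases i <;> simpa) (by simpa [Fin.sum_univ_three] using h)
    (by intro i _; fin_cases i <;> simpa)
  simpa [Fin.sum_univ_three] using this

lemma mem_triangle {c p q : ℂ} (hC : 0 < cross c p q) (z : ℂ) :
    z ∈ convexHull ℝ {c, p, q} ↔ 0 ≤ cross c z q ∧ 0 ≤ cross c p z ∧ 0 ≤ cross z p q := by
  constructor
  · intro hz
    have hcv : Convex ℝ {z | 0 ≤ cross c z q ∧ 0 ≤ cross c p z ∧ 0 ≤ cross z p q} := by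
      rintro x ⟨h1, h2, h3⟩ y ⟨h4, h5, h6⟩ a b ha hb hab
      refine ⟨?_, ?_, ?_⟩
      · rw [cross_combo_mid _ _ _ _ hab]; positivity
      · rw [cross_combo_right _ _ _ _ hab]; positivity
      · rw [cross_combo_left _ _ _ _ hab]; positivity
    refine convexHull_min ?_ hcv hz
    rintro w (rfl | rfl | rfl)
    · simp [hC.le]
    · simp [hC.le]
    · simp [hC.le]
  · rintro ⟨h1, h2, h3⟩
    have e : z = (cross z p q / cross c p q) • c + (cross c z q / cross c p q) • p
        + (cross c p z / cross c p q) • q := by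
      have := congrArg (fun w => (cross c p q)⁻¹ • w) (cross_smul_eq c p q z)
      simp only [smul_add, smul_smul, inv_mul_cancel₀ hC.ne', one_smul] at this
      simpa only [div_eq_inv_mul] using this
    rw [e]
    refine combo_mem (convex_convexHull ℝ _) (subset_convexHull ℝ _ (by simp))
      (subset_convexHull ℝ _ (by simp)) (subset_convexHull ℝ _ (by simp))
      (div_nonneg h3 hC.le) (div_nonneg h1 hC.le) (div_nonneg h2 hC.le) ?_
    rw [← add_div, ← add_div, cross_add_cross_add_cross, div_self hC.ne']

lemma mem_segment_of_cross {c p q z : ℂ} (hC : 0 < cross c p q) (h1 : 0 ≤ cross c z q)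
    (h2 : 0 ≤ cross c p z) (h3 : cross z p q = 0) : z ∈ segment ℝ p q := by
  have h4 := cross_add_cross_add_cross c p q z
  refine ⟨cross c z q / cross c p q, cross c p z / cross c p q, div_nonneg h1 hC.le,
    div_nonneg h2 hC.le, ?_, ?_⟩
  · rw [← add_div, div_eq_one_iff_eq hC.ne']; linarith
  · have := congrArg (fun w => (cross c p q)⁻¹ • w) (cross_smul_eq c p q z)
    simp only [smul_add, smul_smul, inv_mul_cancel₀ hC.ne', one_smul, h3, zero_smul,
      zero_add] at this
    simpa only [div_eq_inv_mul] using this.symm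

lemma volume_line {p q : ℂ} (h : p ≠ q) : volume {z : ℂ | cross z p q = 0} = 0 := by
  set ℓ : ℂ →ₗ[ℝ] ℝ :=
    (q.re - p.re) • Complex.imLm - (q.im - p.im) • Complex.reLm with hℓ
  have hℓz : ∀ z, ℓ z = (q.re - p.re) * z.im - (q.im - p.im) * z.re := fun z => by simp [hℓ]
  have hne : AffineSubspace.mk' p (LinearMap.ker ℓ) ≠ ⊤ := by
    intro htop
    have hm : p + Complex.I * (q - p) ∈ AffineSubspace.mk' p (LinearMap.ker ℓ) := by
      rw [htop]; trivial
    rw [AffineSubspace.mem_mk', LinearMap.mem_ker, hℓz] at hm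
    simp at hm
    apply h
    have : (q.re - p.re) ^ 2 + (q.im - p.im) ^ 2 = 0 := by nlinarith
    apply Complex.ext <;> nlinarith [sq_nonneg (q.re - p.re), sq_nonneg (q.im - p.im)]
  refine measure_mono_null ?_ (Measure.addHaar_affineSubspace volume _ hne)
  intro z hz
  rw [SetLike.mem_coe, AffineSubspace.mem_mk', LinearMap.mem_ker, hℓz]
  have hz : cross z p q = 0 := hz
  rw [cross_def] at hz
  simp only [vsub_eq_sub, Complex.sub_re, Complex.sub_im]
  linear_combination hz

lemma volume_standard_triangle :
    volume {w : ℂ | 0 ≤ w.re ∧ 0 ≤ w.im ∧ w.re + w.im ≤ 1} = ENNReal.ofReal (1 / 2) := by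
  have hm : MeasurableSet {w : ℝ × ℝ | 0 ≤ w.1 ∧ 0 ≤ w.2 ∧ w.1 + w.2 ≤ 1} := by
    apply IsClosed.measurableSet
    exact (isClosed_le continuous_const continuous_fst).inter
      ((isClosed_le continuous_const continuous_snd).inter
      (isClosed_le (continuous_fst.add continuous_snd) continuous_const))
  have h1 := Complex.volume_preserving_equiv_real_prod.measure_preimage hm.nullMeasurableSet
  have h2 : (Complex.measurableEquivRealProd ⁻¹' {w : ℝ × ℝ | 0 ≤ w.1 ∧ 0 ≤ w.2 ∧ w.1 + w.2 ≤ 1})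
      = {w : ℂ | 0 ≤ w.re ∧ 0 ≤ w.im ∧ w.re + w.im ≤ 1} := rfl
  rw [← h2, h1, Measure.volume_eq_prod, Measure.prod_apply hm]
  have h3 : ∀ x : ℝ, volume (Prod.mk x ⁻¹' {w : ℝ × ℝ | 0 ≤ w.1 ∧ 0 ≤ w.2 ∧ w.1 + w.2 ≤ 1})
      = (Icc 0 1).indicator (fun x => ENNReal.ofReal (1 - x)) x := fun x => by
    by_cases hx : 0 ≤ x
    · have : (Prod.mk x ⁻¹' {w : ℝ × ℝ | 0 ≤ w.1 ∧ 0 ≤ w.2 ∧ w.1 + w.2 ≤ 1}) = Icc 0 (1 - x) := by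
        ext y
        simp only [mem_preimage, mem_ofPred_eq, mem_Icc]
        constructor
        · rintro ⟨_, h, h'⟩; exact ⟨h, by linarith⟩
        · rintro ⟨h, h'⟩; exact ⟨hx, h, by linarith⟩
      rw [this, Real.volume_Icc, sub_zero]
      by_cases hx1 : x ≤ 1
      · rw [indicator_of_mem (show x ∈ Icc (0 : ℝ) 1 from ⟨hx, hx1⟩)]
      · rw [indicator_of_notMem (fun h => hx1 h.2), ENNReal.ofReal_of_nonpos (by linarith)]
    · have : (Prod.mk x ⁻¹' {w : ℝ × ℝ | 0 ≤ w.1 ∧ 0 ≤ w.2 ∧ w.1 + w.2 ≤ 1}) = ∅ := by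
        ext y
        simp [hx]
      rw [this, measure_empty, indicator_of_notMem (fun h => hx h.1)]
  simp only [h3]
  rw [lintegral_indicator measurableSet_Icc, ← ofReal_integral_eq_lintegral_ofReal]
  · congr 1
    rw [integral_Icc_eq_integral_Ioc, ← intervalIntegral.integral_of_le (by norm_num)]
    rw [intervalIntegral.integral_sub (by simp) (by simp)]
    simp; norm_num
  · exact (by fun_prop : Continuous fun x : ℝ => 1 - x).continuousOn.integrableOn_Icc
  · exact (ae_restrict_iff' measurableSet_Icc).2 (ae_of_all _ fun x hx => by
      simpa using hx.2)

lemma volume_triangle {c p q : ℂ} (hC : 0 < cross c p q) :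
    volume.real (convexHull ℝ {c, p, q}) = cross c p q / 2 := by
  set M : Matrix (Fin 2) (Fin 2) ℝ :=
    !![(p - c).re, (q - c).re; (p - c).im, (q - c).im] with hM
  set L : ℂ →ₗ[ℝ] ℂ := Matrix.toLin Complex.basisOneI Complex.basisOneI M with hL
  have hdet : LinearMap.det L = cross c p q := by
    rw [hL, LinearMap.det_toLin, Matrix.det_fin_two, hM, cross_def]
    simp; ring
  have hLapp : ∀ w : ℂ, L w = w.re • (p - c) + w.im • (q - c) := fun w => by
    have e : w = w.re • (1 : ℂ) + w.im • Complex.I := by apply Complex.ext <;> simp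
    have h0 : L 1 = p - c := by
      have := Matrix.toLin_self Complex.basisOneI Complex.basisOneI M 0
      rw [Fin.sum_univ_two] at this
      simp only [Complex.coe_basisOneI, hM, Matrix.of_apply, Matrix.cons_val_zero,
        Matrix.cons_val_one] at this
      rw [hL, hM, this]; apply Complex.ext <;> simp
    have h1 : L Complex.I = q - c := by
      have := Matrix.toLin_self Complex.basisOneI Complex.basisOneI M 1
      rw [Fin.sum_univ_two] at this
      simp only [Complex.coe_basisOneI, hM, Matrix.of_apply, Matrix.cons_val_zero,
        Matrix.cons_val_one] at this
      rw [hL, hM, this]; apply Complex.ext <;> simp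
    conv_lhs => rw [e, map_add, map_smul, map_smul, h0, h1]
  have himg : convexHull ℝ {c, p, q}
      = (fun w => c + w) '' (L '' {w : ℂ | 0 ≤ w.re ∧ 0 ≤ w.im ∧ w.re + w.im ≤ 1}) := by
    ext z
    rw [mem_triangle hC, image_image]
    constructor
    · rintro ⟨h1, h2, h3⟩
      refine ⟨⟨cross c z q / cross c p q, cross c p z / cross c p q⟩,
        ⟨div_nonneg h1 hC.le, div_nonneg h2 hC.le, ?_⟩, ?_⟩
      · show cross c z q / cross c p q + cross c p z / cross c p q ≤ 1
        rw [← add_div, div_le_one hC]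
        linarith [cross_add_cross_add_cross c p q z]
      · simp only [hLapp]
        apply Complex.ext
        · simp; field_simp; simp only [cross_def]; ring
        · simp; field_simp; simp only [cross_def]; ring
    · rintro ⟨w, ⟨h1, h2, h3⟩, rfl⟩
      simp only [hLapp]
      have e1 : cross c (c + (w.re • (p - c) + w.im • (q - c))) q = w.re * cross c p q := by
        simp [cross_def]; ring
      have e2 : cross c p (c + (w.re • (p - c) + w.im • (q - c))) = w.im * cross c p q := by
        simp [cross_def]; ring
      have e3 := cross_add_cross_add_cross c p q (c + (w.re • (p - c) + w.im • (q - c)))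
      rw [e1, e2] at *
      refine ⟨by positivity, by positivity, ?_⟩
      nlinarith
  rw [himg, measureReal_def, image_add_left, measure_preimage_add,
    Measure.addHaar_image_linearMap, hdet, volume_standard_triangle,
    ← ENNReal.ofReal_mul (abs_nonneg _), ENNReal.toReal_ofReal (by positivity), abs_of_pos hC]
  ring

/-! ### Adding an ear to a convex body -/

/-- Nonempty compact convex sets. -/
structure IsBody (K : Set ℂ) : Prop where
  convex : Convex ℝ K
  compact : IsCompact K
  nonempty : K.Nonempty

lemma IsBody.hull {S : Set ℂ} (hS : S.Finite) (hn : S.Nonempty) : IsBody (convexHull ℝ S) :=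
  ⟨convex_convexHull ℝ S, hS.isCompact_convexHull ℝ, hn.mono (subset_convexHull ℝ S)⟩

lemma IsBody.insert_hull {K : Set ℂ} (hK : IsBody K) (c : ℂ) :
    IsBody (convexHull ℝ (insert c K)) := by
  refine ⟨convex_convexHull ℝ _, ?_, (insert_nonempty c K).mono (subset_convexHull ℝ _)⟩
  have h : convexHull ℝ (insert c K)
      = (fun x : ℝ × ℂ => (1 - x.1) • c + x.1 • x.2) '' (Icc 0 1 ×ˢ K) := by
    rw [convexHull_insert hK.nonempty, hK.convex.convexHull_eq]
    ext z
    rw [mem_convexJoin]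
    constructor
    · rintro ⟨_, rfl, k, hk, a, b, ha, hb, hab, rfl⟩
      exact ⟨(b, k), ⟨⟨hb, by simp only; linarith⟩, hk⟩, by simp [← hab]⟩
    · rintro ⟨⟨b, k⟩, ⟨⟨hb, hb1⟩, hk⟩, rfl⟩
      exact ⟨c, rfl, k, hk, 1 - b, b, sub_nonneg.2 hb1, hb, by ring, rfl⟩
  rw [h]
  exact (isCompact_Icc.prod hK.compact).image (by fun_prop)

lemma IsBody.volume_ne_top {K : Set ℂ} (hK : IsBody K) : volume K ≠ ⊤ :=
  hK.compact.measure_lt_top.ne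

lemma volume_real_union {K L : Set ℂ} (hK : IsCompact K) (hL : IsCompact L) {p q : ℂ}
    (hpq : p ≠ q) (h : ∀ z ∈ K, z ∈ L → cross z p q = 0) :
    volume.real (K ∪ L) = volume.real K + volume.real L := by
  have hd : AEDisjoint volume K L := measure_mono_null (fun z hz => h z hz.1 hz.2) (volume_line hpq)
  exact measureReal_union₀ hL.measurableSet.nullMeasurableSet hd
    hK.measure_lt_top.ne hL.measure_lt_top.ne

lemma volume_real_mono {K L : Set ℂ} (hL : IsCompact L) (h : K ⊆ L) :
    volume.real K ≤ volume.real L :=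
  measureReal_mono h hL.measure_lt_top.ne

lemma ne_of_cross_pos {c p q : ℂ} (hC : 0 < cross c p q) : p ≠ q := by
  rintro rfl; simp at hC

section Ear

variable {K : Set ℂ} {c p q : ℂ}

/-- The hypothesis `h` puts `K` in the cone with apex `c` spanned by `p` and `q`, on the far side of
the chord `p q`. Every segment from `c` to `K` therefore crosses that chord. -/
lemma convexHull_insert_ear (hK : IsBody K) (hp : p ∈ K) (hq : q ∈ K) (hC : 0 < cross c p q)
    (h : ∀ z ∈ K, 0 ≤ cross c z q ∧ 0 ≤ cross c p z ∧ cross z p q ≤ 0) :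
    convexHull ℝ (insert c K) = K ∪ convexHull ℝ {c, p, q} := by
  apply Subset.antisymm
  · rw [convexHull_insert hK.nonempty, hK.convex.convexHull_eq]
    intro z hz
    rw [mem_convexJoin] at hz
    obtain ⟨c', hc', k, hk, a, b, ha, hb, hab, rfl⟩ := hz
    obtain rfl : c = c' := hc'.symm
    obtain ⟨h1, h2, h3⟩ := h k hk
    rcases le_or_gt 0 (cross (a • c + b • k) p q) with h0 | h0
    · right
      rw [mem_triangle hC]
      rw [cross_combo_mid _ _ _ _ hab, cross_combo_right _ _ _ _ hab]
      simp only [cross_self_left, cross_self_outer, mul_zero, zero_add]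
      exact ⟨by positivity, by positivity, h0⟩
    · left
      rw [cross_combo_left _ _ _ _ hab] at h0
      have hb' : b = 1 - a := by linarith
      have hg : cross k p q < 0 := by
        by_contra hg
        have : cross k p q = 0 := le_antisymm h3 (not_lt.1 hg)
        rw [this] at h0
        nlinarith [mul_nonneg ha hC.le]
      set g := cross k p q with hgd
      set C := cross c p q with hCd
      have hCg : 0 < C - g := by linarith
      -- The weight of `c` at which the segment from `k` to `c` meets the line `p q`: the solution
      -- of `τ * C + (1 - τ) * g = 0`. Smaller weights stay between that point and `k`, inside `K`.
      set τ := -g / (C - g) with hτ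
      have hτ0 : 0 < τ := div_pos (by linarith) hCg
      have hτ1 : τ < 1 := by rw [hτ, div_lt_one hCg]; linarith
      have hτC : τ * (C - g) = -g := by rw [hτ]; field_simp
      have haτ : a ≤ τ := by
        rw [hτ, le_div_iff₀ hCg]; subst hb'; nlinarith
      have hy : τ • c + (1 - τ) • k ∈ segment ℝ p q := by
        refine mem_segment_of_cross hC ?_ ?_ ?_
        · rw [cross_combo_mid _ _ _ _ (by ring)]
          simp only [cross_self_left, mul_zero, zero_add]
          exact mul_nonneg (by linarith) h1
        · rw [cross_combo_right _ _ _ _ (by ring)]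
          simp only [cross_self_outer, mul_zero, zero_add]
          exact mul_nonneg (by linarith) h2
        · rw [cross_combo_left _ _ _ _ (by ring), ← hgd, ← hCd]; linarith
      have hyK := hK.convex.segment_subset hp hq hy
      have := hK.convex hyK hk (div_nonneg ha hτ0.le) (sub_nonneg.2 ((div_le_one hτ0).2 haτ))
        (by ring)
      convert this using 1
      rw [smul_add, smul_smul, smul_smul, add_assoc, ← add_smul, div_mul_cancel₀ _ hτ0.ne', hb']
      congr 2
      field_simp
      ring
  · apply union_subset
    · exact (subset_insert c K).trans (subset_convexHull ℝ _)
    · apply convexHull_mono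
      rintro w (rfl | rfl | rfl)
      · exact mem_insert _ _
      · exact mem_insert_of_mem _ hp
      · exact mem_insert_of_mem _ hq

lemma isBody_triangle (c p q : ℂ) : IsBody (convexHull ℝ {c, p, q}) :=
  IsBody.hull (by simp) (insert_nonempty _ _)

lemma volume_insert_ear (hK : IsBody K) (hp : p ∈ K) (hq : q ∈ K) (hC : 0 < cross c p q)
    (h : ∀ z ∈ K, 0 ≤ cross c z q ∧ 0 ≤ cross c p z ∧ cross z p q ≤ 0) :
    volume.real (convexHull ℝ (insert c K)) = volume.real K + cross c p q / 2 := by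
  rw [convexHull_insert_ear hK hp hq hC h, volume_real_union hK.compact (isBody_triangle c p q).compact
    (ne_of_cross_pos hC), volume_triangle hC]
  intro z hz hz'
  exact le_antisymm (h z hz).2.2 ((mem_triangle hC z).1 hz').2.2

/-- By the valuation property, since body and triangle meet exactly in the segment `p q`, whose
perimeter is twice its length. -/
lemma cauchyPer_insert_ear (hK : IsBody K) (hp : p ∈ K) (hq : q ∈ K) (hC : 0 < cross c p q)
    (h : ∀ z ∈ K, 0 ≤ cross c z q ∧ 0 ≤ cross c p z ∧ cross z p q ≤ 0) :
    cauchyPer (convexHull ℝ (insert c K))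
      = cauchyPer K + (dist c p + dist c q - dist p q) := by
  have e := convexHull_insert_ear hK hp hq hC h
  have hb := isBody_triangle c p q
  have hi : K ∩ convexHull ℝ {c, p, q} = segment ℝ p q := by
    apply Subset.antisymm
    · rintro z ⟨hz, hz'⟩
      obtain ⟨h1, h2, h3⟩ := (mem_triangle hC z).1 hz'
      exact mem_segment_of_cross hC h1 h2 (le_antisymm (h z hz).2.2 h3)
    · refine subset_inter (hK.convex.segment_subset hp hq) (hb.convex.segment_subset ?_ ?_)
      · exact subset_convexHull ℝ _ (by simp)
      · exact subset_convexHull ℝ _ (by simp)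
  have := cauchyPer_union_add_inter hK.compact hb.compact hK.nonempty hb.nonempty
    (by rw [← e]; exact convex_convexHull ℝ _)
  rw [hi, cauchyPer_segment, cauchyPer_triangle] at this
  rw [e]; linarith

end Ear

/-! ### Convex polygons -/

lemma sum_cyclic {n : ℕ} (G : ℂ → ℂ → ℝ) (p : Fin (n + 1) → ℂ) :
    ∑ i, G (p i) (p (i + 1))
      = ∑ i : Fin n, G (p i.castSucc) (p i.succ) + G (p (Fin.last n)) (p 0) := by
  rw [Fin.sum_univ_castSucc]
  simp

/-- Appending a vertex replaces the closing edge by two edges. Applied to lengths and to shoelace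
terms in the induction of `convexPolygon_formulas`. -/
lemma sum_cyclic_succ {n : ℕ} (G : ℂ → ℂ → ℝ) (p : Fin (n + 2) → ℂ) :
    ∑ i, G (p i) (p (i + 1))
      = ∑ i : Fin (n + 1), G (p i.castSucc) (p (i + 1).castSucc)
        - G (p (Fin.last n).castSucc) (p 0)
        + G (p (Fin.last n).castSucc) (p (Fin.last (n + 1))) + G (p (Fin.last (n + 1))) (p 0) := by
  rw [sum_cyclic, sum_cyclic G (fun i : Fin (n + 1) => p i.castSucc), Fin.sum_univ_castSucc]
  simp only [Fin.succ_last, Fin.castSucc_zero, Fin.succ_castSucc]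
  ring

lemma cauchyPer_singleton (z : ℂ) : cauchyPer {z} = 0 := by
  have := cauchyPer_segment z z
  rwa [segment_same, dist_self, mul_zero] at this

lemma volume_real_segment (p q : ℂ) : volume.real (segment ℝ p q) = 0 := by
  rcases eq_or_ne p q with rfl | h
  · simp [segment_same, measureReal_def]
  · rw [measureReal_def]
    have : volume (segment ℝ p q) = 0 := by
      refine measure_mono_null ?_ (volume_line h)
      rintro z ⟨a, b, -, -, hab, rfl⟩
      show cross _ p q = 0
      rw [cross_combo_left _ _ _ _ hab]
      simp
    rw [this]; rfl

/-- Cauchy's formula and the shoelace formula for convex polygons. -/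
theorem convexPolygon_formulas {n : ℕ} (p : Fin (n + 1) → ℂ) (hp : IsConvexPolygon p) :
    cauchyPer (convexHull ℝ (range p)) = polygonLength p ∧
    volume.real (convexHull ℝ (range p))
      = 1 / 2 * ∑ i, ((starRingEnd ℂ) (p i) * p (i + 1)).im := by
  induction n with
  | zero =>
    have : range p = {p 0} := by
      ext z; simp [Fin.exists_fin_one, eq_comm]
    rw [this, convexHull_singleton, cauchyPer_singleton]
    simp [polygonLength, measureReal_def]
    ring
  | succ n ih =>
    rcases Nat.eq_zero_or_pos n with rfl | hn
    -- Two points are treated apart because the ear over them would rest on a degenerate triangle;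
    -- from three points on, the last vertex is an ear over the chord from `p 0` to its predecessor.
    · have : range p = {p 0, p 1} := by
        ext z; simp [Fin.exists_fin_two, eq_comm]
      rw [this, convexHull_pair, cauchyPer_segment, volume_real_segment]
      simp [polygonLength, dist_comm (p 1)]
      constructor <;> ring
    · have ih := ih (fun i => p i.castSucc) fun i j k hij hjk =>
        hp _ _ _ (Fin.castSucc_lt_castSucc_iff.2 hij) (Fin.castSucc_lt_castSucc_iff.2 hjk)
      set p' : Fin (n + 1) → ℂ := fun i => p i.castSucc with hp'
      set K := convexHull ℝ (range p') with hKd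
      have hr : range p = insert (p (Fin.last _)) (range p') := by
        ext z
        simp only [mem_range, mem_insert_iff, hp']
        constructor
        · rintro ⟨i, rfl⟩
          induction i using Fin.lastCases with
          | last => left; rfl
          | cast i => right; exact ⟨i, rfl⟩
        · rintro (rfl | ⟨i, rfl⟩)
          · exact ⟨_, rfl⟩
          · exact ⟨_, rfl⟩
      have hhull : convexHull ℝ (range p) = convexHull ℝ (insert (p (Fin.last _)) K) := by
        rw [hr]
        apply Subset.antisymm
        · exact convexHull_mono (insert_subset_insert (subset_convexHull ℝ _))
        · refine convexHull_min (insert_subset (subset_convexHull ℝ _ (mem_insert _ _)) ?_)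
            (convex_convexHull ℝ _)
          exact convexHull_mono (subset_insert _ _)
      have hK : IsBody K := IsBody.hull (finite_range _) (range_nonempty _)
      have h0 : p 0 ∈ K := subset_convexHull ℝ _ ⟨0, by simp [hp']⟩
      have hl : p (Fin.last n).castSucc ∈ K := subset_convexHull ℝ _ ⟨Fin.last n, rfl⟩
      have hlt0 : (0 : Fin (n + 2)) < (Fin.last n).castSucc := by
        rw [Fin.lt_def]; simpa using hn
      have hlt1 : (Fin.last n).castSucc < Fin.last (n + 1) := Fin.castSucc_lt_last _
      have hC : 0 < cross (p (Fin.last (n + 1))) (p 0) (p (Fin.last n).castSucc) := by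
        have := hp _ _ _ hlt0 hlt1
        rwa [← cross_rotate, ← cross_rotate] at this
      have hw : ∀ z ∈ K, 0 ≤ cross (p (Fin.last (n + 1))) z (p (Fin.last n).castSucc) ∧
          0 ≤ cross (p (Fin.last (n + 1))) (p 0) z ∧
          cross z (p 0) (p (Fin.last n).castSucc) ≤ 0 := by
        intro z hz
        have hcv : Convex ℝ {z | 0 ≤ cross (p (Fin.last (n + 1))) z (p (Fin.last n).castSucc) ∧
            0 ≤ cross (p (Fin.last (n + 1))) (p 0) z ∧
            cross z (p 0) (p (Fin.last n).castSucc) ≤ 0} := by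
          rintro x ⟨h1, h2, h3⟩ y ⟨h4, h5, h6⟩ a b ha hb hab
          refine ⟨?_, ?_, ?_⟩
          · rw [cross_combo_mid _ _ _ _ hab]; positivity
          · rw [cross_combo_right _ _ _ _ hab]; positivity
          · rw [cross_combo_left _ _ _ _ hab]
            nlinarith [mul_nonneg ha (neg_nonneg.2 h3), mul_nonneg hb (neg_nonneg.2 h6)]
        refine convexHull_min ?_ hcv hz
        rintro _ ⟨i, rfl⟩
        have hi0 : i.castSucc = 0 ∨ 0 < i.castSucc := (Fin.zero_le i.castSucc).eq_or_lt.imp_left Eq.symm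
        have hin : i.castSucc = (Fin.last n).castSucc ∨ i.castSucc < (Fin.last n).castSucc := by
          rw [Fin.castSucc_inj, Fin.castSucc_lt_castSucc_iff]
          exact (Fin.le_last i).eq_or_lt
        simp only [hp']
        refine ⟨?_, ?_, ?_⟩
        · rcases hin with h | h
          · rw [h]; simp
          · rw [← cross_rotate]; exact (hp _ _ _ h hlt1).le
        · rcases hi0 with h | h
          · rw [h]; simp
          · rw [← cross_rotate]; exact (hp _ _ _ h (Fin.castSucc_lt_last i)).le
        · rcases hi0 with h0 | h0
          · rw [h0]; simp
          rcases hin with h | h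
          · rw [h]; simp
          · have := hp _ _ _ h0 h
            rw [← cross_rotate, cross_swap]; linarith
      rw [hhull, cauchyPer_insert_ear hK h0 hl hC hw, volume_insert_ear hK h0 hl hC hw, ih.1, ih.2]
      constructor
      · unfold polygonLength
        rw [sum_cyclic_succ dist p, dist_comm (p (Fin.last _)) (p (Fin.last n).castSucc),
          dist_comm (p 0)]
        ring
      · rw [sum_cyclic_succ (fun a b => ((starRingEnd ℂ) a * b).im) p]
        have : cross (p (Fin.last (n + 1))) (p 0) (p (Fin.last n).castSucc)
          = - ((starRingEnd ℂ) (p (Fin.last n).castSucc) * p 0).im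
          + ((starRingEnd ℂ) (p (Fin.last n).castSucc) * p (Fin.last (n + 1))).im
          + ((starRingEnd ℂ) (p (Fin.last (n + 1))) * p 0).im := by
          simp [cross_def]; ring
        rw [this]; ring

/-! ### Minimisers of the energy with the Cauchy perimeter -/

/-- The energy in which the perimeter is given by Cauchy's formula. -/
def cauchyEnergy (lam : ℝ) (K : Set ℂ) : ℝ := lam * volume.real K - cauchyPer K

/-- Minimisers of `cauchyEnergy` among the convex bodies in the unit disk. -/
structure IsMin (lam : ℝ) (K : Set ℂ) : Prop where
  body : IsBody K
  subset : K ⊆ unitDisk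
  le : ∀ L, IsBody L → L ⊆ unitDisk → cauchyEnergy lam K ≤ cauchyEnergy lam L

lemma convex_unitDisk : Convex ℝ unitDisk := convex_closedBall 0 1

lemma cauchyEnergy_insert_ear {lam : ℝ} {K : Set ℂ} {c p q : ℂ} (hK : IsBody K) (hp : p ∈ K)
    (hq : q ∈ K) (hC : 0 < cross c p q)
    (h : ∀ z ∈ K, 0 ≤ cross c z q ∧ 0 ≤ cross c p z ∧ cross z p q ≤ 0) :
    cauchyEnergy lam (convexHull ℝ (insert c K)) = cauchyEnergy lam K
      + (lam * (cross c p q / 2) - (dist c p + dist c q - dist p q)) := by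
  rw [cauchyEnergy, cauchyPer_insert_ear hK hp hq hC h, volume_insert_ear hK hp hq hC h,
    cauchyEnergy]
  ring

/-- The part of the triangle `c p q` within a given distance of the side `p q`. -/
lemma trapezoid_formulas {c p q : ℂ} (hC : 0 < cross c p q) {κ : ℝ} (h0 : 0 < κ) (h1 : κ < 1) :
    cauchyPer (convexHull ℝ {c, p, q} ∩ {z | cross z p q ≤ κ * cross c p q})
      = 2 * dist p q + κ * (dist c p + dist c q - dist p q) ∧
    volume.real (convexHull ℝ {c, p, q} ∩ {z | cross z p q ≤ κ * cross c p q})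
      = κ * (2 - κ) * (cross c p q / 2) := by
  set T := convexHull ℝ {c, p, q} with hT
  set C := cross c p q with hCd
  -- The line at relative height `κ` cuts off the triangle `c p' q'`, a copy of `c p q` scaled by `1
  -- - κ` about `c`. The trapezoid is the difference, so both formulas follow by additivity.
  set p' := κ • c + (1 - κ) • p with hp'
  set q' := κ • c + (1 - κ) • q with hq'
  have hTb := isBody_triangle c p q
  have hC' : cross c p' q' = (1 - κ) ^ 2 * C := by
    rw [hp', hq', cross_combo_mid _ _ _ _ (by ring), cross_combo_right _ _ _ _ (by ring),
      cross_combo_right _ _ _ _ (by ring)]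
    simp only [cross_self_left, cross_self_outer]; ring
  have hC'0 : 0 < cross c p' q' := by
    rw [hC']; have : 0 < 1 - κ := by linarith
    positivity
  have e1 : ∀ z, cross c z q' = (1 - κ) * cross c z q := fun z => by
    rw [hq', cross_combo_right _ _ _ _ (by ring)]; simp
  have e2 : ∀ z, cross c p' z = (1 - κ) * cross c p z := fun z => by
    rw [hp', cross_combo_mid _ _ _ _ (by ring)]; simp
  have e3 : ∀ z, cross z p' q' = (1 - κ) * (cross z p q - κ * C) := fun z => by
    have h := cross_add_cross_add_cross c p' q' z
    have h' := cross_add_cross_add_cross c p q z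
    rw [e1, e2, hC'] at h
    rw [← hCd] at h'
    linear_combination h - (1 - κ) * h'
  have h1κ : 0 < 1 - κ := by linarith
  set A := T ∩ {z | cross z p q ≤ κ * C} with hA
  set B := convexHull ℝ {c, p', q'} with hB
  have hBb := isBody_triangle c p' q'
  have hBmem : ∀ z, z ∈ B ↔ z ∈ T ∧ κ * C ≤ cross z p q := fun z => by
    rw [hB, hT, mem_triangle hC'0, mem_triangle hC, e1, e2, e3, mul_nonneg_iff_of_pos_left h1κ,
      mul_nonneg_iff_of_pos_left h1κ, mul_nonneg_iff_of_pos_left h1κ]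
    constructor
    · rintro ⟨h1, h2, h3⟩; exact ⟨⟨h1, h2, by nlinarith⟩, by linarith⟩
    · rintro ⟨⟨h1, h2, h3⟩, h4⟩; exact ⟨h1, h2, by linarith⟩
  have hAB : A ∪ B = T := by
    ext z
    simp only [mem_union, hBmem, hA, mem_inter_iff, mem_ofPred_eq]
    have := le_total (cross z p q) (κ * C)
    tauto
  have hAc : IsCompact A :=
    hTb.compact.inter_right (isClosed_le (by fun_prop) continuous_const)
  have hAn : A.Nonempty := by
    refine ⟨p, subset_convexHull ℝ _ (by simp), ?_⟩
    simp only [mem_ofPred_eq, cross_self_left]; positivity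
  have hz0 : ∀ z ∈ A, z ∈ B → cross z p' q' = 0 := fun z hzA hzB => by
    rw [e3, le_antisymm hzA.2 ((hBmem z).1 hzB).2]; ring
  have hI : A ∩ B = segment ℝ p' q' := by
    apply Subset.antisymm
    · rintro z ⟨hzA, hzB⟩
      obtain ⟨a, b, -⟩ := (mem_triangle hC'0 z).1 hzB
      exact mem_segment_of_cross hC'0 a b (hz0 z hzA hzB)
    · intro z hz
      have hzB : z ∈ B := hBb.convex.segment_subset (subset_convexHull ℝ _ (by simp))
        (subset_convexHull ℝ _ (by simp)) hz
      refine ⟨⟨((hBmem z).1 hzB).1, ?_⟩, hzB⟩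
      obtain ⟨a, b, -, -, hab, rfl⟩ := hz
      have : cross (a • p' + b • q') p' q' = 0 := by
        rw [cross_combo_left _ _ _ _ hab]; simp
      rw [e3] at this
      rcases mul_eq_zero.1 this with h | h
      · linarith
      · exact (sub_eq_zero.1 h).le
  have hd1 : dist c p' = (1 - κ) * dist c p := by
    rw [dist_eq_norm, dist_eq_norm, show c - p' = (1 - κ) • (c - p) by
      rw [hp']; module, norm_smul, Real.norm_of_nonneg h1κ.le]
  have hd2 : dist c q' = (1 - κ) * dist c q := by
    rw [dist_eq_norm, dist_eq_norm, show c - q' = (1 - κ) • (c - q) by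
      rw [hq']; module, norm_smul, Real.norm_of_nonneg h1κ.le]
  have hd3 : dist p' q' = (1 - κ) * dist p q := by
    rw [dist_eq_norm, dist_eq_norm, show p' - q' = (1 - κ) • (p - q) by
      rw [hp', hq']; module, norm_smul, Real.norm_of_nonneg h1κ.le]
  constructor
  · have := cauchyPer_union_add_inter hAc hBb.compact hAn hBb.nonempty
      (by rw [hAB]; exact hTb.convex)
    rw [hAB, hI, hT, cauchyPer_triangle, cauchyPer_triangle, cauchyPer_segment, hd1, hd2,
      hd3] at this
    linarith
  · have := volume_real_union hAc hBb.compact (ne_of_cross_pos hC'0) hz0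
    rw [hAB, volume_triangle hC'0, hT, volume_triangle hC, hC', ← hCd] at this
    linarith

/-- If `p` and `q` are the points of contact of the tangents from `c` to a minimiser,
then the minimiser lies behind the chord `p q`. -/
lemma IsMin.cap {lam : ℝ} (hlam : 0 < lam) {K : Set ℂ} (hK : IsMin lam K) {c p q : ℂ}
    (hp : p ∈ K) (hq : q ∈ K) (hcD : c ∈ unitDisk) (hcK : c ∉ K) (hC : 0 < cross c p q)
    (hw : ∀ z ∈ K, 0 ≤ cross c z q ∧ 0 ≤ cross c p z) : ∀ z ∈ K, cross z p q ≤ 0 := by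
  by_contra! hne
  obtain ⟨z₀, hz₀, hz₀g⟩ := hne
  have hb := hK.body
  obtain ⟨m, hm, hmax⟩ := hb.compact.exists_isMaxOn hb.nonempty
    (continuous_cross_left p q).continuousOn
  have hmax : ∀ z ∈ K, cross z p q ≤ cross m p q := fun z hz => hmax hz
  have hM0 : 0 < cross m p q := hz₀g.trans_le (hmax _ hz₀)
  set M := cross m p q with hM
  set C := cross c p q with hCd
  have hMC : M < C := by
    have h := cross_add_cross_add_cross c p q m
    obtain ⟨h1, h2⟩ := hw m hm
    rcases lt_or_ge M C with h' | h'
    · exact h'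
    · exfalso
      have a1 : cross c m q = 0 := by linarith
      have a2 : cross c p m = 0 := by linarith
      have e := cross_smul_eq c p q m
      rw [a1, a2, zero_smul, zero_smul, add_zero, add_zero,
        show cross m p q = cross c p q by linarith] at e
      have := smul_right_injective ℂ hC.ne' e
      exact hcK (this ▸ hm)
  set κ := M / C with hκ
  have hκ0 : 0 < κ := div_pos hM0 hC
  have hκ1 : κ < 1 := (div_lt_one hC).2 hMC
  have hκC : κ * C = M := div_mul_cancel₀ _ hC.ne'
  have hpq := ne_of_cross_pos hC
  set K₁ := K ∩ {z | cross z p q ≤ 0} with hK₁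
  set K₂ := K ∩ {z | 0 ≤ cross z p q} with hK₂
  have hp₁ : p ∈ K₁ := ⟨hp, by simp⟩
  have hq₁ : q ∈ K₁ := ⟨hq, by simp⟩
  have hp₂ : p ∈ K₂ := ⟨hp, by simp⟩
  have hq₂ : q ∈ K₂ := ⟨hq, by simp⟩
  have hb₁ : IsBody K₁ := by
    refine ⟨hb.convex.inter ?_,
      hb.compact.inter_right (isClosed_le (by fun_prop) continuous_const), ⟨p, hp₁⟩⟩
    intro x hx y hy a b ha hb' hab
    have hx : cross x p q ≤ 0 := hx
    have hy : cross y p q ≤ 0 := hy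
    show cross _ p q ≤ 0
    rw [cross_combo_left _ _ _ _ hab]
    nlinarith [mul_nonneg ha (neg_nonneg.2 hx), mul_nonneg hb' (neg_nonneg.2 hy)]
  have hb₂ : IsBody K₂ := by
    refine ⟨hb.convex.inter ?_,
      hb.compact.inter_right (isClosed_le continuous_const (by fun_prop)), ⟨p, hp₂⟩⟩
    intro x hx y hy a b ha hb' hab
    have hx : 0 ≤ cross x p q := hx
    have hy : 0 ≤ cross y p q := hy
    show 0 ≤ cross _ p q
    rw [cross_combo_left _ _ _ _ hab]
    positivity
  have hU : K₁ ∪ K₂ = K := by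
    ext z
    simp only [hK₁, hK₂, mem_union, mem_inter_iff, mem_ofPred_eq]
    have := le_total (cross z p q) 0
    tauto
  have hz0 : ∀ z ∈ K₁, z ∈ K₂ → cross z p q = 0 := fun z h1 h2 => le_antisymm h1.2 h2.2
  have hI : K₁ ∩ K₂ = segment ℝ p q := by
    apply Subset.antisymm
    · rintro z ⟨h1, h2⟩
      exact mem_segment_of_cross hC (hw z h1.1).1 (hw z h1.1).2 (hz0 z h1 h2)
    · exact subset_inter (hb₁.convex.segment_subset hp₁ hq₁) (hb₂.convex.segment_subset hp₂ hq₂)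
  have hvol : volume.real K = volume.real K₁ + volume.real K₂ := by
    rw [← volume_real_union hb₁.compact hb₂.compact hpq hz0, hU]
  have hper : cauchyPer K + 2 * dist p q = cauchyPer K₁ + cauchyPer K₂ := by
    rw [← cauchyPer_union_add_inter hb₁.compact hb₂.compact hb₁.nonempty hb₂.nonempty
      (by rw [hU]; exact hb.convex), hU, hI, cauchyPer_segment]
  have hw₁ : ∀ z ∈ K₁, 0 ≤ cross c z q ∧ 0 ≤ cross c p z ∧ cross z p q ≤ 0 :=
    fun z hz => ⟨(hw z hz.1).1, (hw z hz.1).2, hz.2⟩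
  -- Two competitors: `K₁`, with the cap `K₂` cut off, and `K₁` with the whole triangle `c p q`
  -- added.
  have hcut := hK.le K₁ hb₁ (inter_subset_left.trans hK.subset)
  have hext := hK.le _ (hb₁.insert_hull c) (convexHull_min
    (insert_subset hcD (inter_subset_left.trans hK.subset)) convex_unitDisk)
  rw [cauchyEnergy_insert_ear hb₁ hp₁ hq₁ hC hw₁] at hext
  simp only [cauchyEnergy] at hcut hext
  rw [hvol] at hcut hext
  obtain ⟨htP, htV⟩ := trapezoid_formulas hC hκ0 hκ1
  set A := convexHull ℝ {c, p, q} ∩ {z | cross z p q ≤ κ * C} with hA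
  have hAc : IsCompact A :=
    (isBody_triangle c p q).compact.inter_right (isClosed_le (by fun_prop) continuous_const)
  have hK₂A : K₂ ⊆ A := fun z hz =>
    ⟨(mem_triangle hC z).2 ⟨(hw z hz.1).1, (hw z hz.1).2, hz.2⟩, by
      show cross z p q ≤ κ * C
      rw [hκC]; exact hmax z hz.1⟩
  have hP₂ := cauchyPer_mono hb₂.nonempty hb₂.compact hAc hK₂A
  have hV₂ : M / 2 ≤ volume.real K₂ := by
    rw [hM, ← volume_triangle hM0]
    refine volume_real_mono hb₂.compact (convexHull_min ?_ hb₂.convex)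
    rintro z (rfl | rfl | rfl)
    · exact ⟨hm, hM0.le⟩
    · exact hp₂
    · exact hq₂
  set G := dist c p + dist c q - dist p q with hG
  set V := volume.real K₂
  set P := cauchyPer K₂
  -- The cap contains the triangle `m p q` and is contained in the trapezoid of height `κ`, so its
  -- area is at least `κ * C / 2` and its perimeter excess at most `κ * G`. With the two competitors
  -- this forces `G = lam * C / 2`.
  have i1 : lam * V ≤ P - 2 * dist p q := by nlinarith
  have i2 : P - 2 * dist p q ≤ κ * G := by linarith
  have i3 : lam * V - (P - 2 * dist p q) ≤ lam * (C / 2) - G := by nlinarith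
  have i4 : lam * (κ * C / 2) ≤ lam * V := by
    apply mul_le_mul_of_nonneg_left _ hlam.le; rw [hκC]; exact hV₂
  have i5 : lam * (C / 2) ≤ G := by
    have : κ * (lam * (C / 2)) ≤ κ * G := by linarith
    exact le_of_mul_le_mul_left this hκ0
  have i6 : G ≤ lam * (C / 2) := by
    have : (1 - κ) * G ≤ (1 - κ) * (lam * (C / 2)) := by linarith
    exact le_of_mul_le_mul_left this (by linarith)
  have hG' : G = lam * (C / 2) := le_antisymm i6 i5
  -- All inequalities are now equalities, so the cap has the perimeter of the trapezoid and fills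
  -- it. But the trapezoid has area `κ * (2 - κ) * C / 2`, more than the value `κ * C / 2` allowed
  -- by `i1` and `i2`.
  have hAK := subset_of_cauchyPer_le hb₂.compact hb₂.convex hb₂.nonempty hAc hK₂A
    (by rw [htP, hG']; linarith)
  have hVA := volume_real_mono hb₂.compact hAK
  rw [htV] at hVA
  have i7 : lam * (κ * (2 - κ) * (C / 2)) ≤ lam * (κ * (C / 2)) := by
    have := mul_le_mul_of_nonneg_left hVA hlam.le
    rw [hG'] at i2
    linarith
  have i8 := le_of_mul_le_mul_left i7 hlam
  have : 0 < κ * (1 - κ) * (C / 2) := by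
    have : 0 < 1 - κ := by linarith
    positivity
  nlinarith

/-! ### Extreme points of minimisers lie on the unit circle -/

/-- In a frame at `c` adapted to a separating line, `n` is positive on `K` and `b / n` is the slope
of the ray from `c`. The points `p` and `q` have extreme slope, and `cross c z w` has the sign of
the slope difference. -/
lemma exists_tangents {K : Set ℂ} (hK : IsBody K) {c : ℂ} (hc : c ∉ K) :
    ∃ p ∈ K, ∃ q ∈ K, (∀ z ∈ K, 0 ≤ cross c z q ∧ 0 ≤ cross c p z) ∧
      ∀ z ∈ K, 0 < cross c z q → 0 < cross c p z → 0 < cross c p q := by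
  obtain ⟨f, u, hf, hu⟩ := geometric_hahn_banach_closed_point hK.convex hK.compact.isClosed hc
  set α := -f 1 with hα
  set β := -f Complex.I with hβ
  set n : ℂ → ℝ := fun z => α * (z.re - c.re) + β * (z.im - c.im) with hn
  set b : ℂ → ℝ := fun z => α * (z.im - c.im) - β * (z.re - c.re) with hb
  have hnf : ∀ z, n z = f c - f z := fun z => by
    have e : ∀ z : ℂ, f z = z.re * f 1 + z.im * f Complex.I := fun z => by
      have e1 : z = z.re • (1 : ℂ) + z.im • Complex.I := by apply Complex.ext <;> simp
      conv_lhs => rw [e1, map_add, map_smul, map_smul, smul_eq_mul, smul_eq_mul]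
    rw [e c, e z, hn, hα, hβ]; ring
  have hn0 : ∀ z ∈ K, 0 < n z := fun z hz => by rw [hnf]; linarith [hf z hz]
  have hcont : ContinuousOn (fun z => b z / n z) K :=
    ContinuousOn.div (by fun_prop) (by fun_prop) fun z hz => (hn0 z hz).ne'
  obtain ⟨p, hp, hpm⟩ := hK.compact.exists_isMinOn hK.nonempty hcont
  obtain ⟨q, hq, hqm⟩ := hK.compact.exists_isMaxOn hK.nonempty hcont
  have hαβ : 0 < α ^ 2 + β ^ 2 := by
    rcases lt_or_eq_of_le (by positivity : 0 ≤ α ^ 2 + β ^ 2) with h | h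
    · exact h
    · have h1 : α = 0 := by nlinarith [sq_nonneg α, sq_nonneg β]
      have h2 : β = 0 := by nlinarith [sq_nonneg α, sq_nonneg β]
      have := hn0 p hp
      simp [hn, h1, h2] at this
  have key : ∀ z w, (α ^ 2 + β ^ 2) * cross c z w = n z * b w - b z * n w := fun z w => by
    simp only [cross_def, hn, hb]; ring
  have hsgn : ∀ z ∈ K, ∀ w ∈ K, b z / n z ≤ b w / n w → 0 ≤ cross c z w := by
    intro z hz w hw h
    rw [div_le_div_iff₀ (hn0 z hz) (hn0 w hw)] at h
    have := key z w
    by_contra hneg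
    nlinarith [mul_pos hαβ (neg_pos.2 (not_le.1 hneg))]
  refine ⟨p, hp, q, hq, fun z hz => ⟨hsgn z hz q hq (hqm hz), hsgn p hp z hz (hpm hz)⟩, ?_⟩
  intro z hz h1 h2
  have e : cross c p q * n z = cross c p z * n q + cross c z q * n p := by
    simp only [cross_def, hn]; ring
  have h3 := hn0 z hz
  have h4 := hn0 q hq
  have h5 := hn0 p hp
  have : 0 < cross c p q * n z := by rw [e]; positivity
  exact pos_of_mul_pos_left this h3.le

lemma exists_smul_add_mem {K : Set ℂ} {z v : ℂ} (hz : z ∈ interior K) :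
    ∃ ε : ℝ, 0 < ε ∧ z + ε • v ∈ K ∧ z - ε • v ∈ K := by
  have hc : Filter.Tendsto (fun ε : ℝ => z + ε • v) (nhdsWithin 0 (Ioi 0)) (nhds z) := by
    have : Continuous fun ε : ℝ => z + ε • v := by fun_prop
    have := this.tendsto 0
    simp only [zero_smul, add_zero] at this
    exact this.mono_left nhdsWithin_le_nhds
  have hc' : Filter.Tendsto (fun ε : ℝ => z - ε • v) (nhdsWithin 0 (Ioi 0)) (nhds z) := by
    have : Continuous fun ε : ℝ => z - ε • v := by fun_prop
    have := this.tendsto 0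
    simp only [zero_smul, sub_zero] at this
    exact this.mono_left nhdsWithin_le_nhds
  have hK := mem_interior_iff_mem_nhds.1 hz
  obtain ⟨ε, ⟨h1, h2⟩, h3⟩ := ((hc.eventually hK).and (hc'.eventually hK)).and
    (self_mem_nhdsWithin (a := (0 : ℝ)) (s := Ioi 0)) |>.exists
  exact ⟨ε, h3, h1, h2⟩

lemma extreme_notMem_interior {K : Set ℂ} {x : ℂ} (hx : x ∈ extremePoints ℝ K) :
    x ∉ interior K := by
  intro hi
  obtain ⟨ε, hε, h1, h2⟩ := exists_smul_add_mem (v := 1) hi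
  have : x ∈ openSegment ℝ (x + ε • 1) (x - ε • 1) :=
    ⟨1 / 2, 1 / 2, by norm_num, by norm_num, by norm_num, by module⟩
  have := (mem_extremePoints.1 hx).2 _ h1 _ h2 this
  have h := this.1
  have h' := congrArg Complex.re h
  simp at h'
  linarith

/-- If `x` were inside the disk, a point `c` slightly beyond `x`, seen from an interior point `z₀`,
would still be in the disk. By `IsMin.cap` the point `x` lies on or behind the chord of contact,
hence strictly inside a segment contained in `K`. -/
lemma IsMin.norm_extreme {lam : ℝ} (hlam : 0 < lam) {K : Set ℂ} (hK : IsMin lam K)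
    (hint : (interior K).Nonempty) {x : ℂ} (hx : x ∈ extremePoints ℝ K) : ‖x‖ = 1 := by
  have hxK : x ∈ K := hx.1
  have hx1 : ‖x‖ ≤ 1 := by simpa [unitDisk] using hK.subset hxK
  by_contra hne
  have hlt : ‖x‖ < 1 := lt_of_le_of_ne hx1 hne
  obtain ⟨z₀, hz₀⟩ := hint
  have hz₀K := interior_subset hz₀
  have hxz : z₀ ≠ x := by rintro rfl; exact extreme_notMem_interior hx hz₀
  have hb := hK.body
  have hxint : x ∈ interior unitDisk := by
    rw [unitDisk, interior_closedBall _ one_ne_zero]; simpa using hlt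
  obtain ⟨τ, hτ, hcD, -⟩ := exists_smul_add_mem (v := x - z₀) hxint
  set c := x + τ • (x - z₀) with hc
  have hxc : x = (1 / (1 + τ)) • c + (τ / (1 + τ)) • z₀ := by
    rw [hc]; match_scalars <;> field_simp
    ring
  have hcK : c ∉ K := fun hcK => by
    have hmem : x ∈ openSegment ℝ c z₀ :=
      ⟨1 / (1 + τ), τ / (1 + τ), by positivity, by positivity, by field_simp, hxc.symm⟩
    exact hxz ((mem_extremePoints.1 hx).2 _ hcK _ hz₀K hmem).2
  obtain ⟨p, hp, q, hq, hw, hpos⟩ := exists_tangents hb hcK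
  have hcp : c ≠ p := fun h => hcK (h ▸ hp)
  have hcq : c ≠ q := fun h => hcK (h ▸ hq)
  have nsq : ∀ w : ℂ, c ≠ w → 0 < (w.re - c.re) ^ 2 + (w.im - c.im) ^ 2 := fun w hw => by
    rcases lt_or_eq_of_le (by positivity : 0 ≤ (w.re - c.re) ^ 2 + (w.im - c.im) ^ 2) with h' | h'
    · exact h'
    · exact absurd (by apply Complex.ext <;>
        nlinarith [sq_nonneg (w.re - c.re), sq_nonneg (w.im - c.im)]) hw
  -- Strict because `z₀` is interior: a small move perpendicular to `p - c` stays in `K` and would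
  -- violate the tangency.
  have hpz : 0 < cross c p z₀ := by
    obtain ⟨ε, hε, -, h2⟩ := exists_smul_add_mem (v := Complex.I * (p - c)) hz₀
    have h3 := (hw _ h2).2
    have e : cross c p (z₀ - ε • (Complex.I * (p - c)))
        = cross c p z₀ - ε * ((p.re - c.re) ^ 2 + (p.im - c.im) ^ 2) := by
      simp [cross_def]; ring
    rw [e] at h3
    have := mul_pos hε (nsq p hcp)
    linarith
  have hzq : 0 < cross c z₀ q := by
    obtain ⟨ε, hε, h2, -⟩ := exists_smul_add_mem (v := Complex.I * (q - c)) hz₀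
    have h3 := (hw _ h2).1
    have e : cross c (z₀ + ε • (Complex.I * (q - c))) q
        = cross c z₀ q - ε * ((q.re - c.re) ^ 2 + (q.im - c.im) ^ 2) := by
      simp [cross_def]; ring
    rw [e] at h3
    have := mul_pos hε (nsq q hcq)
    linarith
  have hC := hpos z₀ hz₀K hzq hpz
  have hcap := hK.cap hlam hp hq hcD hcK hC hw
  have hτ1 : 0 < τ / (1 + τ) := by positivity
  have hsum : 1 / (1 + τ) + τ / (1 + τ) = 1 := by field_simp
  have hxq : 0 < cross c x q := by
    rw [hxc, cross_combo_mid _ _ _ _ hsum]; simp; positivity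
  have hpx : 0 < cross c p x := by
    rw [hxc, cross_combo_right _ _ _ _ hsum]; simp; positivity
  set g := cross x p q with hg
  have hg0 : g ≤ 0 := hcap x hxK
  set C := cross c p q with hCd
  have hCg : 0 < C - g := by linarith
  -- The point `y` is where the ray from `c` through `x` meets the chord: `(1 - κ) * C + κ * g = 0`.
  -- If `κ < 1`, then `x` is strictly between `y` and `z₀`; if `κ = 1`, it is strictly between `p`
  -- and `q`.
  set κ := C / (C - g) with hκ
  have hκ0 : 0 < κ := div_pos hC hCg
  have hκ1 : κ ≤ 1 := by rw [hκ, div_le_one hCg]; linarith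
  set y := (1 - κ) • c + κ • x with hy
  have hyC : cross y p q = 0 := by
    rw [hy, cross_combo_left _ _ _ _ (by ring), ← hg, ← hCd, hκ]; field_simp; ring
  have hyq : cross c y q = κ * cross c x q := by
    rw [hy, cross_combo_mid _ _ _ _ (by ring)]; simp
  have hpy : cross c p y = κ * cross c p x := by
    rw [hy, cross_combo_right _ _ _ _ (by ring)]; simp
  have hyK : y ∈ K := hb.convex.segment_subset hp hq
    (mem_segment_of_cross hC (by rw [hyq]; positivity) (by rw [hpy]; positivity) hyC)
  rcases hκ1.lt_or_eq with hκ1 | hκ1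
  · have hs : 0 < (1 - κ) + τ := by linarith
    have hxy : x ∈ openSegment ℝ y z₀ := by
      refine ⟨1 / ((1 - κ) * (1 + τ) + κ), (1 - κ) * τ / ((1 - κ) * (1 + τ) + κ), ?_, ?_, ?_, ?_⟩
      · have : 0 < 1 - κ := by linarith
        positivity
      · have : 0 < 1 - κ := by linarith
        positivity
      · have : 0 < 1 - κ := by linarith
        have : 0 < (1 - κ) * (1 + τ) + κ := by positivity
        field_simp; ring
      · have : 0 < 1 - κ := by linarith
        have : 0 < (1 - κ) * (1 + τ) + κ := by positivity
        rw [hy, hc]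
        match_scalars <;> field_simp
        ring
    exact hxz ((mem_extremePoints.1 hx).2 _ hyK _ hz₀K hxy).2
  · have hyx : y = x := by rw [hy, hκ1]; simp
    have hsum' := cross_add_cross_add_cross c p q x
    rw [← hyx, hyC] at hsum'
    rw [hyx] at hsum'
    have hmem : x ∈ openSegment ℝ p q := by
      refine ⟨cross c x q / C, cross c p x / C, by positivity, by positivity, ?_, ?_⟩
      · rw [← add_div, div_eq_one_iff_eq hC.ne']; linarith
      · have := congrArg (fun w => C⁻¹ • w) (cross_smul_eq c p q x)
        rw [← hyx, hyC, hyx, ← hCd] at this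
        simp only [smul_add, smul_smul, inv_mul_cancel₀ hC.ne', one_smul, zero_smul,
          zero_add] at this
        simpa only [div_eq_inv_mul] using this.symm
    have := (mem_extremePoints.1 hx).2 _ hp _ hq hmem
    exact ne_of_cross_pos hC (this.1.trans this.2.symm)

/-- A minimiser with interior points is the closed convex hull of its points on the circle. -/
lemma IsMin.subset_closure_hull {lam : ℝ} (hlam : 0 < lam) {K : Set ℂ} (hK : IsMin lam K)
    (hint : (interior K).Nonempty) :
    K ⊆ closure (convexHull ℝ (K ∩ Metric.sphere 0 1)) := by
  rw [← closure_convexHull_extremePoints hK.body.compact hK.body.convex]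
  apply closure_mono
  apply convexHull_mono
  intro x hx
  rw [closure_convexHull_extremePoints hK.body.compact hK.body.convex]
  exact ⟨hx.1, by simpa using hK.norm_extreme hlam hint hx⟩

/-! ### Minimisers without interior points -/

lemma isBody_segment (p q : ℂ) : IsBody (segment ℝ p q) := by
  rw [← convexHull_pair]; exact IsBody.hull (by simp) (by simp)

lemma cauchyEnergy_segment (lam : ℝ) (p q : ℂ) :
    cauchyEnergy lam (segment ℝ p q) = -2 * dist p q := by
  rw [cauchyEnergy, cauchyPer_segment, volume_real_segment]; ring

lemma interior_nonempty_of_cross_ne_zero {K : Set ℂ} (hK : IsBody K) {a b c : ℂ} (ha : a ∈ K)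
    (hb : b ∈ K) (hc : c ∈ K) (h : cross a b c ≠ 0) : (interior K).Nonempty := by
  wlog hpos : 0 < cross a b c generalizing b c
  · refine this hc hb ?_ ?_
    · rw [cross_swap]; simpa using h
    · rw [cross_swap]; linarith [lt_of_le_of_ne (not_lt.1 hpos) h]
  by_contra hne
  rw [not_nonempty_iff_eq_empty] at hne
  have h1 := hK.convex.addHaar_frontier volume
  rw [hK.compact.isClosed.frontier_eq, hne, sdiff_empty] at h1
  have h2 := volume_triangle hpos
  have h3 : volume (convexHull ℝ {a, b, c}) = 0 := by
    refine measure_mono_null (convexHull_min ?_ hK.convex) h1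
    rintro z (rfl | rfl | rfl) <;> assumption
  rw [measureReal_def, h3] at h2
  simp at h2
  linarith

lemma eq_segment_of_cross_eq_zero {K : Set ℂ} (hK : IsBody K)
    (h : ∀ a ∈ K, ∀ b ∈ K, ∀ c ∈ K, cross a b c = 0) :
    ∃ p ∈ K, ∃ q ∈ K, K = segment ℝ p q := by
  -- The endpoints realise the diameter of `K`; maximality later confines the parameter `t` of any
  -- other point to `[0, 1]`.
  obtain ⟨⟨p, q⟩, ⟨hp, hq⟩, hmax⟩ := (hK.compact.prod hK.compact).exists_isMaxOn
    (hK.nonempty.prod hK.nonempty) (continuous_dist (α := ℂ)).continuousOn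
  have hmax : ∀ z ∈ K, ∀ w ∈ K, ‖z - w‖ ≤ ‖p - q‖ := fun z hz w hw => by
    have := hmax (show (z, w) ∈ K ×ˢ K from ⟨hz, hw⟩)
    simpa only [mem_ofPred_eq, dist_eq_norm] using this
  refine ⟨p, hp, q, hq, Subset.antisymm ?_ (hK.convex.segment_subset hp hq)⟩
  intro z hz
  rcases eq_or_ne p q with rfl | hpq
  · have := hmax z hz p hp
    simp only [sub_self, norm_zero] at this
    have : z = p := sub_eq_zero.1 (norm_le_zero_iff.1 this)
    rw [this]; exact left_mem_segment ℝ p p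
  have hd : 0 < ‖p - q‖ := norm_pos_iff.2 (sub_ne_zero.2 hpq)
  have hpos : 0 < (q.re - p.re) ^ 2 + (q.im - p.im) ^ 2 := by
    have : ‖p - q‖ ^ 2 = (q.re - p.re) ^ 2 + (q.im - p.im) ^ 2 := by
      rw [← Complex.normSq_eq_norm_sq, Complex.normSq_apply]; simp; ring
    rw [← this]; positivity
  have h0 := h p hp q hq z hz
  rw [cross_def] at h0
  obtain ⟨t, ht⟩ : ∃ t : ℝ, z = p + t • (q - p) := by
    refine ⟨((z.re - p.re) * (q.re - p.re) + (z.im - p.im) * (q.im - p.im)) /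
      ((q.re - p.re) ^ 2 + (q.im - p.im) ^ 2), ?_⟩
    apply Complex.ext
    · simp only [Complex.add_re, Complex.smul_re, smul_eq_mul, Complex.sub_re]
      field_simp
      linear_combination -(q.im - p.im) * h0
    · simp only [Complex.add_im, Complex.smul_im, smul_eq_mul, Complex.sub_im]
      field_simp
      linear_combination (q.re - p.re) * h0
  have h1 := hmax z hz p hp
  have h2 := hmax z hz q hq
  rw [ht, show p + t • (q - p) - p = (-t) • (p - q) by module, norm_smul, Real.norm_eq_abs,
    abs_neg] at h1
  rw [ht, show p + t • (q - p) - q = (1 - t) • (p - q) by module, norm_smul,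
    Real.norm_eq_abs] at h2
  have h1 := (abs_le.1 (le_of_mul_le_mul_right (by linarith) hd : |t| ≤ 1))
  have h2 := (abs_le.1 (le_of_mul_le_mul_right (by linarith) hd : |1 - t| ≤ 1))
  exact ⟨1 - t, t, by linarith, by linarith, by ring, by rw [ht]; module⟩

/-- A segment has no area, so only its length counts and it must be at least 2; by the parallelogram
law two points of the disk at distance 2 are antipodal. -/
lemma IsMin.isDiameter {lam : ℝ} {K : Set ℂ} (hK : IsMin lam K)
    (h : ∀ a ∈ K, ∀ b ∈ K, ∀ c ∈ K, cross a b c = 0) : IsDiameter K := by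
  obtain ⟨p, hp, q, hq, hseg⟩ := eq_segment_of_cross_eq_zero hK.body h
  have hle := hK.le (segment ℝ (-1) 1) (isBody_segment _ _)
    (convex_unitDisk.segment_subset (by simp [unitDisk]) (by simp [unitDisk]))
  rw [hseg, cauchyEnergy_segment, cauchyEnergy_segment] at hle
  have h2 : dist (-1 : ℂ) 1 = 2 := by rw [dist_eq_norm]; norm_num
  rw [h2, dist_eq_norm] at hle
  have hp1 : ‖p‖ ≤ 1 := by simpa [unitDisk] using hK.subset hp
  have hq1 : ‖q‖ ≤ 1 := by simpa [unitDisk] using hK.subset hq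
  have hpar := parallelogram_law_with_norm ℝ p q
  have h0 : ‖p + q‖ * ‖p + q‖ ≤ 0 := by nlinarith [norm_nonneg p, norm_nonneg q]
  have hpq : p + q = 0 := by
    rw [← norm_eq_zero]; nlinarith [norm_nonneg (p + q)]
  have hpq' : p = -q := eq_neg_of_add_eq_zero_left hpq
  refine ⟨q, ?_, by rw [hseg, hpq']⟩
  have := norm_sub_le p q
  rw [hpq', norm_neg] at this
  have h5 : ‖p - q‖ = ‖-q - q‖ := by rw [hpq']
  linarith

/-! ### Ears with vertices on the unit circle -/

/-- The point of the unit circle with polar angle `x`. -/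
def circlePt (x : ℝ) : ℂ := Complex.exp (x * Complex.I)

lemma circlePt_re (x : ℝ) : (circlePt x).re = cos x := Complex.exp_ofReal_mul_I_re x
lemma circlePt_im (x : ℝ) : (circlePt x).im = sin x := Complex.exp_ofReal_mul_I_im x

@[simp] lemma norm_circlePt (x : ℝ) : ‖circlePt x‖ = 1 := Complex.norm_exp_ofReal_mul_I x

lemma circlePt_mem (x : ℝ) : circlePt x ∈ unitDisk := by simp [unitDisk]

lemma circlePt_add_two_pi (x : ℝ) : circlePt (x + 2 * π) = circlePt x := by
  apply Complex.ext <;> simp [circlePt_re, circlePt_im]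

lemma circlePt_periodic : Function.Periodic circlePt (2 * π) := circlePt_add_two_pi

@[fun_prop]
lemma continuous_circlePt : Continuous circlePt := by unfold circlePt; fun_prop

lemma exists_circlePt {z : ℂ} (hz : ‖z‖ = 1) (a : ℝ) :
    ∃ x ∈ Ico a (a + 2 * π), circlePt x = z := by
  obtain ⟨x, hx, e⟩ := circlePt_periodic.exists_mem_Ico two_pi_pos z.arg a
  refine ⟨x, hx, ?_⟩
  rw [← e, circlePt]
  have := Complex.norm_mul_exp_arg_mul_I z
  rwa [hz, Complex.ofReal_one, one_mul] at this

/-- The product form lets the orientation be read off from the order of the angles. -/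
lemma cross_circlePt (x y z : ℝ) : cross (circlePt x) (circlePt y) (circlePt z)
    = 4 * sin ((y - x) / 2) * sin ((z - y) / 2) * sin ((z - x) / 2) := by
  have h1 : cross (circlePt x) (circlePt y) (circlePt z)
      = sin (y - x) + sin (z - y) - sin (z - x) := by
    simp only [cross_def, circlePt_re, circlePt_im, sin_sub]; ring
  set a := (y - x) / 2 with ha
  set b := (z - y) / 2 with hb
  rw [h1, show y - x = 2 * a by rw [ha]; ring, show z - y = 2 * b by rw [hb]; ring,
    show z - x = 2 * (a + b) by rw [ha, hb]; ring, show 2 * (a + b) / 2 = a + b by ring,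
    sin_two_mul, sin_two_mul, sin_two_mul, sin_add, cos_add]
  have h2 := sin_sq_add_cos_sq a
  have h3 := sin_sq_add_cos_sq b
  linear_combination (-2 * sin b * cos b) * h2 - (2 * sin a * cos a) * h3

lemma dist_circlePt {x y : ℝ} (h : x ≤ y) (h' : y ≤ x + 2 * π) :
    dist (circlePt x) (circlePt y) = 2 * sin ((y - x) / 2) := by
  have h0 : 0 ≤ sin ((y - x) / 2) :=
    sin_nonneg_of_nonneg_of_le_pi (by linarith) (by linarith)
  rw [Complex.dist_eq_re_im, circlePt_re, circlePt_im, circlePt_re, circlePt_im]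
  rw [show (cos x - cos y) ^ 2 + (sin x - sin y) ^ 2 = (2 * sin ((y - x) / 2)) ^ 2 by
    rw [mul_pow, sin_sq_eq_half_sub, show 2 * ((y - x) / 2) = y - x by ring, cos_sub]
    linear_combination sin_sq_add_cos_sq x + sin_sq_add_cos_sq y]
  exact Real.sqrt_sq (by positivity)

/-- The contribution to the energy of a side of an inscribed polygon which subtends the
central angle `t`. -/
def sideEnergy (lam t : ℝ) : ℝ := lam / 2 * sin t - 2 * sin (t / 2)

lemma sin_add_sin_sub_sin_add (x y : ℝ) :
    sin x + sin y - sin (x + y) = 4 * sin (x / 2) * sin (y / 2) * sin ((x + y) / 2) := by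
  obtain ⟨a, rfl⟩ : ∃ a, x = 2 * a := ⟨x / 2, by ring⟩
  obtain ⟨b, rfl⟩ : ∃ b, y = 2 * b := ⟨y / 2, by ring⟩
  rw [show 2 * a + 2 * b = 2 * (a + b) by ring]
  simp only [mul_div_cancel_left₀ _ (two_ne_zero' ℝ)]
  rw [sin_two_mul, sin_two_mul, sin_two_mul, sin_add, cos_add]
  linear_combination (-2 * sin b * cos b) * sin_sq_add_cos_sq a
    - (2 * sin a * cos a) * sin_sq_add_cos_sq b

/-- The energy gained by splitting a side. -/
lemma sideEnergy_split (lam x y : ℝ) :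
    sideEnergy lam x + sideEnergy lam y - sideEnergy lam (x + y)
      = 8 * sin (x / 4) * sin (y / 4) * sin ((x + y) / 4)
        * (2 * lam * (cos (x / 4) * cos (y / 4) * cos ((x + y) / 4)) - 1) := by
  have h1 := sin_add_sin_sub_sin_add x y
  have h2 := sin_add_sin_sub_sin_add (x / 2) (y / 2)
  have e : ∀ t : ℝ, sin (t / 2) = 2 * sin (t / 4) * cos (t / 4) := fun t => by
    rw [← sin_two_mul]; congr 1; ring
  rw [show x / 2 + y / 2 = (x + y) / 2 by ring, show x / 2 / 2 = x / 4 by ring,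
    show y / 2 / 2 = y / 4 by ring, show (x + y) / 2 / 2 = (x + y) / 4 by ring] at h2
  have h3 : sideEnergy lam x + sideEnergy lam y - sideEnergy lam (x + y)
      = lam / 2 * (sin x + sin y - sin (x + y))
        - 2 * (sin (x / 2) + sin (y / 2) - sin ((x + y) / 2)) := by
    simp only [sideEnergy]; ring
  rw [h3, h1, h2, e, e, e]; ring

/-- The set `S` lies on the arc complementary to the gap `(u, v)` around `τ`. Writing `u + 2 * π`
for `u` keeps all angle differences in `[0, 2 * π]`, where the sines of their halves are
nonnegative; the conditions are closed and convex, so they pass to the closed hull. -/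
lemma circle_ear_conditions {S : Set ℂ} {u τ v : ℝ} (h1 : u < τ) (h2 : τ < v)
    (h3 : v < u + 2 * π) (hS : ∀ s ∈ S, ∃ w ∈ Icc v (u + 2 * π), s = circlePt w) :
    0 < cross (circlePt τ) (circlePt v) (circlePt u) ∧
    ∀ z ∈ closure (convexHull ℝ S), 0 ≤ cross (circlePt τ) z (circlePt u) ∧
      0 ≤ cross (circlePt τ) (circlePt v) z ∧ cross z (circlePt v) (circlePt u) ≤ 0 := by
  constructor
  · rw [← circlePt_add_two_pi u, cross_circlePt]
    have a1 := sin_pos_of_pos_of_lt_pi (x := (v - τ) / 2) (by linarith) (by linarith)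
    have a2 := sin_pos_of_pos_of_lt_pi (x := (u + 2 * π - v) / 2) (by linarith) (by linarith)
    have a3 := sin_pos_of_pos_of_lt_pi (x := (u + 2 * π - τ) / 2) (by linarith) (by linarith)
    positivity
  · intro z hz
    have hcv : Convex ℝ {z | 0 ≤ cross (circlePt τ) z (circlePt u) ∧
        0 ≤ cross (circlePt τ) (circlePt v) z ∧ cross z (circlePt v) (circlePt u) ≤ 0} := by
      rintro x ⟨h1, h2, h3⟩ y ⟨h4, h5, h6⟩ a b ha hb hab
      refine ⟨?_, ?_, ?_⟩
      · rw [cross_combo_mid _ _ _ _ hab]; positivity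
      · rw [cross_combo_right _ _ _ _ hab]; positivity
      · rw [cross_combo_left _ _ _ _ hab]
        nlinarith [mul_nonneg ha (neg_nonneg.2 h3), mul_nonneg hb (neg_nonneg.2 h6)]
    have hcl : IsClosed {z | 0 ≤ cross (circlePt τ) z (circlePt u) ∧
        0 ≤ cross (circlePt τ) (circlePt v) z ∧ cross z (circlePt v) (circlePt u) ≤ 0} :=
      (isClosed_le continuous_const (continuous_cross_mid _ _)).inter
        ((isClosed_le continuous_const (continuous_cross_right _ _)).inter
          (isClosed_le (continuous_cross_left _ _) continuous_const))
    refine closure_minimal (convexHull_min ?_ hcv) hcl hz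
    intro s hs
    obtain ⟨w, ⟨hw1, hw2⟩, rfl⟩ := hS s hs
    have sn : ∀ x : ℝ, 0 ≤ x → x ≤ 2 * π → 0 ≤ sin (x / 2) := fun x hx hx' =>
      sin_nonneg_of_nonneg_of_le_pi (by linarith) (by linarith)
    refine ⟨?_, ?_, ?_⟩
    · rw [← circlePt_add_two_pi u, cross_circlePt]
      have a1 := sn (w - τ) (by linarith) (by linarith)
      have a2 := sn (u + 2 * π - w) (by linarith) (by linarith)
      have a3 := sn (u + 2 * π - τ) (by linarith) (by linarith)
      positivity
    · rw [cross_circlePt]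
      have a1 := sn (v - τ) (by linarith) (by linarith)
      have a2 := sn (w - v) (by linarith) (by linarith)
      have a3 := sn (w - τ) (by linarith) (by linarith)
      positivity
    · rw [← circlePt_add_two_pi u, cross_circlePt, ← neg_sub w v, neg_div, sin_neg]
      have a1 := sn (w - v) (by linarith) (by linarith)
      have a2 := sn (u + 2 * π - v) (by linarith) (by linarith)
      have a3 := sn (u + 2 * π - w) (by linarith) (by linarith)
      have := mul_nonneg (mul_nonneg a1 a2) a3
      linarith

/-- Here `K` need not be a polygon: only the gap in its circle points matters, so the same formula
serves the disk argument and the deletion of vertices. -/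
lemma cauchyEnergy_circle_ear {lam : ℝ} {K S : Set ℂ} (hK : IsBody K)
    (hKS : K ⊆ closure (convexHull ℝ S)) {u τ v : ℝ} (h1 : u < τ) (h2 : τ < v)
    (h3 : v < u + 2 * π) (hS : ∀ s ∈ S, ∃ w ∈ Icc v (u + 2 * π), s = circlePt w)
    (hu : circlePt u ∈ K) (hv : circlePt v ∈ K) :
    cauchyEnergy lam (convexHull ℝ (insert (circlePt τ) K)) = cauchyEnergy lam K
      + (sideEnergy lam (τ - u) + sideEnergy lam (v - τ) - sideEnergy lam (v - u)) := by
  obtain ⟨hC, hw⟩ := circle_ear_conditions h1 h2 h3 hS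
  rw [cauchyEnergy_insert_ear hK hv hu hC fun z hz => hw z (hKS hz)]
  rw [dist_circlePt h2.le (by linarith), dist_comm, dist_circlePt h1.le (by linarith),
    dist_comm, dist_circlePt (by linarith) h3.le, ← circlePt_add_two_pi u, cross_circlePt]
  have e1 : sin ((u + 2 * π - v) / 2) = sin ((v - u) / 2) := by
    rw [← sin_pi_sub]; congr 1; ring
  have e2 : sin ((u + 2 * π - τ) / 2) = sin ((τ - u) / 2) := by
    rw [← sin_pi_sub]; congr 1; ring
  have h := sin_add_sin_sub_sin_add (τ - u) (v - τ)
  rw [show τ - u + (v - τ) = v - u by ring] at h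
  rw [e1, e2]
  simp only [sideEnergy]
  linear_combination (-lam / 2) * h

/-! ### Small `lam`: the disk -/

/-- If a point of the circle were missing, inserting it would lower the energy: the product of
cosines in `sideEnergy_split` is below 1 and `2 * lam ≤ 1`. -/
lemma IsMin.eq_unitDisk {lam : ℝ} (hlam : 0 < lam) (hlam' : lam ≤ 1 / 2) {K : Set ℂ}
    (hK : IsMin lam K) (hint : (interior K).Nonempty) : K = unitDisk := by
  have hb := hK.body
  have hsub := hK.subset_closure_hull hlam hint
  suffices hs : Metric.sphere (0 : ℂ) 1 ⊆ K by
    apply Subset.antisymm hK.subset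
    rw [unitDisk, ← convexHull_sphere_eq_closedBall (0 : ℂ) zero_le_one]
    exact convexHull_min hs hb.convex
  intro c hc
  by_contra hcK
  obtain ⟨γ, -, rfl⟩ := exists_circlePt (z := c) (by simpa using hc) 0
  set Y : Set ℝ := {y | y ∈ Icc γ (γ + 2 * π) ∧ circlePt y ∈ K} with hY
  have hYc : IsCompact Y :=
    isCompact_Icc.inter_right (hb.compact.isClosed.preimage continuous_circlePt)
  have hAY : ∀ z ∈ K ∩ Metric.sphere 0 1, ∃ y ∈ Y, z = circlePt y := by
    rintro z ⟨hz, hz1⟩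
    obtain ⟨y, hy, rfl⟩ := exists_circlePt (z := z) (by simpa using hz1) γ
    exact ⟨y, ⟨⟨hy.1, hy.2.le⟩, hz⟩, rfl⟩
  have hAn : (K ∩ Metric.sphere 0 1).Nonempty := by
    rw [nonempty_iff_ne_empty]
    intro h
    rw [h, convexHull_empty, closure_empty] at hsub
    exact hb.nonempty.not_subset_empty hsub
  have hYn : Y.Nonempty := by
    obtain ⟨z, hz⟩ := hAn
    obtain ⟨y, hy, -⟩ := hAY z hz
    exact ⟨y, hy⟩
  -- The first and last angles of `K` on the circle, counted from the missing point `γ`; thus `(u -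
  -- 2 * π, v)` is the gap around `γ`.
  obtain ⟨v, hv, hvm⟩ := hYc.exists_isMinOn hYn continuousOn_id
  obtain ⟨u, hu, hum⟩ := hYc.exists_isMaxOn hYn continuousOn_id
  have hvm : ∀ y ∈ Y, v ≤ y := fun y hy => hvm hy
  have hum : ∀ y ∈ Y, y ≤ u := fun y hy => hum hy
  have hγv : γ < v := lt_of_le_of_ne hv.1.1 (by rintro rfl; exact hcK hv.2)
  have huγ : u < γ + 2 * π := lt_of_le_of_ne hu.1.2 (by
    rintro rfl; apply hcK; rw [← circlePt_add_two_pi]; exact hu.2)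
  have hvu : v < u := by
    rcases (hvm u hu).lt_or_eq with h | h
    · exact h
    · exfalso
      have hA : K ∩ Metric.sphere 0 1 ⊆ {circlePt v} := fun z hz => by
        obtain ⟨y, hy, rfl⟩ := hAY z hz
        have : y = v := le_antisymm (h ▸ hum y hy) (hvm y hy)
        rw [this]; rfl
      have := hsub.trans (closure_mono (convexHull_mono hA))
      rw [convexHull_singleton, closure_singleton] at this
      have := hint.mono (interior_mono this)
      simp at this
  have hu' : circlePt (u - 2 * π) = circlePt u := by
    rw [← circlePt_add_two_pi]; congr 1; ring
  have hear := cauchyEnergy_circle_ear (lam := lam) hb hsub (u := u - 2 * π) (τ := γ) (v := v)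
    (by linarith) hγv (by linarith) (fun s hs => by
      obtain ⟨y, hy, rfl⟩ := hAY s hs
      exact ⟨y, ⟨hvm y hy, by linarith [hum y hy]⟩, rfl⟩) (by rw [hu']; exact hu.2) hv.2
  have hle := hK.le _ (hb.insert_hull (circlePt γ))
    (convexHull_min (insert_subset (circlePt_mem γ) hK.subset) convex_unitDisk)
  set x := γ - (u - 2 * π) with hx
  set y := v - γ with hy
  have hxy : v - (u - 2 * π) = x + y := by rw [hx, hy]; ring
  rw [hear, hxy, sideEnergy_split] at hle
  have hx0 : 0 < x := by rw [hx]; linarith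
  have hy0 : 0 < y := by rw [hy]; linarith
  have hxy2 : x + y < 2 * π := by rw [← hxy]; linarith
  have s1 := sin_pos_of_pos_of_lt_pi (x := x / 4) (by linarith) (by linarith)
  have s2 := sin_pos_of_pos_of_lt_pi (x := y / 4) (by linarith) (by linarith)
  have s3 := sin_pos_of_pos_of_lt_pi (x := (x + y) / 4) (by linarith) (by linarith)
  have c1 : cos (x / 4) < 1 := by
    rw [← cos_zero]; exact cos_lt_cos_of_nonneg_of_le_pi le_rfl (by linarith) (by linarith)
  have c1' : 0 < cos (x / 4) := cos_pos_of_mem_Ioo ⟨by linarith, by linarith⟩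
  have c2' : 0 < cos (y / 4) := cos_pos_of_mem_Ioo ⟨by linarith, by linarith⟩
  have c3' : 0 < cos ((x + y) / 4) := cos_pos_of_mem_Ioo ⟨by linarith, by linarith⟩
  have c2 := cos_le_one (y / 4)
  have c3 := cos_le_one ((x + y) / 4)
  have hc : cos (x / 4) * cos (y / 4) * cos ((x + y) / 4) < 1 := by
    calc _ ≤ cos (x / 4) * 1 * 1 := by gcongr
      _ < 1 := by linarith
  have hc0 : 0 < cos (x / 4) * cos (y / 4) * cos ((x + y) / 4) := by positivity
  have : 2 * lam * (cos (x / 4) * cos (y / 4) * cos ((x + y) / 4)) - 1 < 0 := by nlinarith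
  have : 8 * sin (x / 4) * sin (y / 4) * sin ((x + y) / 4)
      * (2 * lam * (cos (x / 4) * cos (y / 4) * cos ((x + y) / 4)) - 1) < 0 :=
    mul_neg_of_pos_of_neg (by positivity) this
  linarith

/-! ### Large `lam`: finitely many vertices -/

/-- The convex hull of the points of the circle with angles in `X`. -/
def hullOf (X : Finset ℝ) : Set ℂ := convexHull ℝ (circlePt '' X)

lemma isBody_hullOf {X : Finset ℝ} (hX : X.Nonempty) : IsBody (hullOf X) :=
  IsBody.hull (X.finite_toSet.image _) (hX.to_set.image _)

lemma hullOf_subset (X : Finset ℝ) : hullOf X ⊆ unitDisk := by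
  refine convexHull_min ?_ convex_unitDisk
  rintro _ ⟨x, -, rfl⟩
  exact circlePt_mem x

lemma circlePt_mem_hullOf {X : Finset ℝ} {x : ℝ} (hx : x ∈ X) : circlePt x ∈ hullOf X :=
  subset_convexHull ℝ _ ⟨x, hx, rfl⟩

lemma convexHull_insert_convexHull (c : ℂ) (S : Set ℂ) :
    convexHull ℝ (insert c (convexHull ℝ S)) = convexHull ℝ (insert c S) := by
  apply Subset.antisymm
  · refine convexHull_min (insert_subset (subset_convexHull ℝ _ (mem_insert _ _)) ?_)
      (convex_convexHull ℝ _)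
    exact convexHull_mono (subset_insert _ _)
  · exact convexHull_mono (insert_subset_insert (subset_convexHull ℝ _))

lemma cauchyEnergy_erase {lam a : ℝ} {X : Finset ℝ} (hX : ∀ x ∈ X, x ∈ Ico a (a + 2 * π))
    {u τ v : ℝ} (hu : u ∈ X) (hτ : τ ∈ X) (hv : v ∈ X) (h1 : u < τ) (h2 : τ < v)
    (hgap : ∀ x ∈ X, u < x → x < v → x = τ) :
    cauchyEnergy lam (hullOf X) = cauchyEnergy lam (hullOf (X.erase τ))
      + (sideEnergy lam (τ - u) + sideEnergy lam (v - τ) - sideEnergy lam (v - u)) := by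
  have hu' : u ∈ X.erase τ := Finset.mem_erase.2 ⟨h1.ne, hu⟩
  have hv' : v ∈ X.erase τ := Finset.mem_erase.2 ⟨h2.ne', hv⟩
  have e : hullOf X = convexHull ℝ (insert (circlePt τ) (hullOf (X.erase τ))) := by
    rw [hullOf, hullOf, convexHull_insert_convexHull, ← image_insert_eq, ← Finset.coe_insert,
      Finset.insert_erase hτ]
  rw [e]
  have au := hX u hu
  have av := hX v hv
  refine cauchyEnergy_circle_ear (isBody_hullOf ⟨u, hu'⟩) subset_closure h1 h2
    (by linarith [au.1, av.2]) ?_ (circlePt_mem_hullOf hu') (circlePt_mem_hullOf hv')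
  rintro _ ⟨x, hx, rfl⟩
  obtain ⟨hxτ, hx⟩ := Finset.mem_erase.1 hx
  have ax := hX x hx
  rcases le_or_gt v x with h | h
  · exact ⟨x, ⟨h, by linarith [au.1, ax.2]⟩, rfl⟩
  · have hxu : x ≤ u := by
      by_contra hlt
      exact hxτ (hgap x hx (not_le.1 hlt) h)
    exact ⟨x + 2 * π, ⟨by linarith [av.2, ax.1], by linarith⟩, (circlePt_add_two_pi x).symm⟩

/-- Vertices in `(b, c)` are deleted from the largest down. The neighbours of the deleted one are
then some `u ≥ b` and `c` itself, so each deletion merges arcs of total length at most `η` and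
lowers the energy. -/
lemma cauchyEnergy_filter_le {lam a η : ℝ}
    (hη : ∀ x y, 0 < x → 0 < y → x + y ≤ η →
      0 < sideEnergy lam x + sideEnergy lam y - sideEnergy lam (x + y))
    {b c : ℝ} (hcη : c - b ≤ η) (n : ℕ) :
    ∀ X : Finset ℝ, (∀ x ∈ X, x ∈ Ico a (a + 2 * π)) → b ∈ X → c ∈ X →
      (X.filter (· ∈ Ioo b c)).card = n →
      cauchyEnergy lam (hullOf (X.filter (· ∉ Ioo b c))) ≤ cauchyEnergy lam (hullOf X) := by
  induction n with
  | zero =>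
    intro X _ _ _ hcard
    rw [Finset.card_eq_zero, Finset.filter_eq_empty_iff] at hcard
    rw [Finset.filter_true_of_mem fun x hx => hcard hx]
  | succ n ih =>
    intro X hX hb hc hcard
    have hne : (X.filter (· ∈ Ioo b c)).Nonempty := by
      rw [← Finset.card_pos, hcard]; omega
    set τ := (X.filter (· ∈ Ioo b c)).max' hne with hτ
    obtain ⟨hτX, hτb, hτc⟩ : τ ∈ X ∧ b < τ ∧ τ < c := by
      have := Finset.max'_mem _ hne
      rw [← hτ, Finset.mem_filter] at this
      exact ⟨this.1, this.2.1, this.2.2⟩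
    have hne' : (X.filter (· < τ)).Nonempty := ⟨b, Finset.mem_filter.2 ⟨hb, hτb⟩⟩
    set u := (X.filter (· < τ)).max' hne' with hu
    obtain ⟨huX, huτ⟩ : u ∈ X ∧ u < τ := by
      have := Finset.max'_mem _ hne'
      rwa [← hu, Finset.mem_filter] at this
    have hbu : b ≤ u := Finset.le_max' _ _ (Finset.mem_filter.2 ⟨hb, hτb⟩)
    have hgap : ∀ x ∈ X, u < x → x < c → x = τ := by
      intro x hx hux hxc
      rcases lt_trichotomy x τ with h | h | h
      · exact absurd (Finset.le_max' _ x (Finset.mem_filter.2 ⟨hx, h⟩)) (not_le.2 hux)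
      · exact h
      · exact absurd (Finset.le_max' (X.filter (· ∈ Ioo b c)) x
          (Finset.mem_filter.2 ⟨hx, by linarith, hxc⟩)) (not_le.2 h)
    have herase := cauchyEnergy_erase (lam := lam) hX huX hτX hc huτ hτc hgap
    have hpos := hη (τ - u) (c - τ) (by linarith) (by linarith) (by linarith)
    rw [show τ - u + (c - τ) = c - u by ring] at hpos
    have hfe : (X.erase τ).filter (· ∉ Ioo b c) = X.filter (· ∉ Ioo b c) := by
      ext x
      simp only [Finset.mem_filter, Finset.mem_erase]
      constructor
      · rintro ⟨⟨-, h⟩, h'⟩; exact ⟨h, h'⟩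
      · rintro ⟨h, h'⟩
        refine ⟨⟨?_, h⟩, h'⟩
        rintro rfl
        exact h' ⟨hτb, hτc⟩
    have := ih (X.erase τ) (fun x hx => hX x (Finset.mem_of_mem_erase hx))
      (Finset.mem_erase.2 ⟨hτb.ne, hb⟩) (Finset.mem_erase.2 ⟨hτc.ne', hc⟩) (by
        rw [Finset.filter_erase, Finset.card_erase_of_mem
          (Finset.mem_filter.2 ⟨hτX, hτb, hτc⟩), hcard]; rfl)
    rw [hfe] at this
    linarith

/-- As the arc shrinks, the product of cosines, which is at least the cube of `cos ((x + y) / 4)`,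
tends to 1, and `2 * lam > 1`. -/
lemma exists_split_gain {lam : ℝ} (hlam : 1 / 2 < lam) :
    ∃ η, 0 < η ∧ ∀ x y, 0 < x → 0 < y → x + y ≤ η →
      0 < sideEnergy lam x + sideEnergy lam y - sideEnergy lam (x + y) := by
  have hcont : Filter.Tendsto (fun t : ℝ => 2 * lam * (cos (t / 4) * cos (t / 4) * cos (t / 4)))
      (nhds 0) (nhds (2 * lam)) := by
    have : Continuous fun t : ℝ => 2 * lam * (cos (t / 4) * cos (t / 4) * cos (t / 4)) := by
      fun_prop
    have := this.tendsto 0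
    simpa using this
  have hev := (hcont.eventually (lt_mem_nhds (show 1 < 2 * lam by linarith)))
  obtain ⟨ε, hε, hb⟩ := Metric.eventually_nhds_iff.1 hev
  refine ⟨min (ε / 2) π, lt_min (by linarith) pi_pos, fun x y hx hy hxy => ?_⟩
  have hxy1 := hxy.trans (min_le_left _ _)
  have hxy2 := hxy.trans (min_le_right _ _)
  have h := @hb (x + y) (by rw [dist_zero_right, Real.norm_of_nonneg (by linarith)]; linarith)
  rw [sideEnergy_split]
  have s1 := sin_pos_of_pos_of_lt_pi (x := x / 4) (by linarith) (by linarith)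
  have s2 := sin_pos_of_pos_of_lt_pi (x := y / 4) (by linarith) (by linarith)
  have s3 := sin_pos_of_pos_of_lt_pi (x := (x + y) / 4) (by linarith) (by linarith)
  have c3 : 0 < cos ((x + y) / 4) := cos_pos_of_mem_Ioo ⟨by linarith, by linarith⟩
  have c1 : cos ((x + y) / 4) ≤ cos (x / 4) :=
    cos_le_cos_of_nonneg_of_le_pi (by linarith) (by linarith) (by linarith)
  have c2 : cos ((x + y) / 4) ≤ cos (y / 4) :=
    cos_le_cos_of_nonneg_of_le_pi (by linarith) (by linarith) (by linarith)
  have c1' := c3.trans_le c1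
  have : cos ((x + y) / 4) * cos ((x + y) / 4) * cos ((x + y) / 4)
      ≤ cos (x / 4) * cos (y / 4) * cos ((x + y) / 4) := by gcongr
  have h2 : 0 < 2 * lam * (cos (x / 4) * cos (y / 4) * cos ((x + y) / 4)) - 1 := by nlinarith
  positivity

/-- Pigeonhole: one of the finitely many cells of length `η` contains infinitely many points of `S`.
-/
lemma exists_three_close {S : Set ℝ} (hS : S.Infinite) (hS' : S ⊆ Ico 0 (2 * π)) {η : ℝ}
    (hη : 0 < η) : ∃ a ∈ S, ∃ b ∈ S, ∃ c ∈ S, a < b ∧ b < c ∧ c - a ≤ η := by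
  have hfin : ((fun x => ⌊x / η⌋) '' S).Finite := by
    refine (finite_Icc (0 : ℤ) ⌊2 * π / η⌋).subset ?_
    rintro _ ⟨x, hx, rfl⟩
    have := hS' hx
    exact ⟨Int.floor_nonneg.2 (div_nonneg this.1 hη.le),
      Int.floor_le_floor (div_le_div_of_nonneg_right this.2.le hη.le)⟩
  obtain ⟨k, -, hk⟩ : ∃ k ∈ (fun x => ⌊x / η⌋) '' S, (S ∩ (fun x => ⌊x / η⌋) ⁻¹' {k}).Infinite := by
    by_contra! h
    apply hS
    refine (hfin.biUnion fun k hk => h k hk).subset ?_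
    intro x hx
    exact mem_biUnion (mem_image_of_mem _ hx) ⟨hx, rfl⟩
  obtain ⟨t, hts, htc⟩ := hk.exists_subset_card_eq 3
  have hmono := (t.orderEmbOfFin htc).strictMono
  have hmem : ∀ i, t.orderEmbOfFin htc i ∈ S ∩ (fun x => ⌊x / η⌋) ⁻¹' {k} := fun i =>
    hts (t.orderEmbOfFin_mem htc i)
  refine ⟨_, (hmem 0).1, _, (hmem 1).1, _, (hmem 2).1, hmono (by decide), hmono (by decide), ?_⟩
  have h0 : ⌊t.orderEmbOfFin htc 0 / η⌋ = k := (hmem 0).2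
  have h2 : ⌊t.orderEmbOfFin htc 2 / η⌋ = k := (hmem 2).2
  have h0' := Int.floor_le (t.orderEmbOfFin htc 0 / η)
  have h2' := Int.lt_floor_add_one (t.orderEmbOfFin htc 2 / η)
  rw [h0] at h0'
  rw [h2] at h2'
  rw [le_div_iff₀ hη] at h0'
  rw [div_lt_iff₀ hη] at h2'
  linarith

/-- With infinitely many vertices, three of them are close. A fine inscribed polygon through these
has almost the energy of `K`, and deleting vertices between the outer two lowers it by a fixed
amount `g`, below the minimum. -/
lemma IsMin.finite_vertices {lam : ℝ} (hlam : 1 / 2 < lam) {K : Set ℂ}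
    (hK : IsMin lam K) (hint : (interior K).Nonempty) :
    (K ∩ Metric.sphere 0 1).Finite := by
  have hlam0 : 0 < lam := by linarith
  have hb := hK.body
  have hsub := hK.subset_closure_hull hlam0 hint
  by_contra hinf
  obtain ⟨η, hη, hgain⟩ := exists_split_gain hlam
  set S : Set ℝ := {x | x ∈ Ico 0 (2 * π) ∧ circlePt x ∈ K} with hS
  have hSinf : S.Infinite := by
    intro hfin
    apply hinf
    refine (hfin.image circlePt).subset ?_
    rintro z ⟨hz, hz1⟩
    obtain ⟨x, hx, rfl⟩ := exists_circlePt (z := z) (by simpa using hz1) 0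
    rw [zero_add] at hx
    exact ⟨x, ⟨hx, hz⟩, rfl⟩
  obtain ⟨a, ha, b, hb', c, hc, hab, hbc, hac⟩ := exists_three_close hSinf (fun x hx => hx.1) hη
  set g := sideEnergy lam (b - a) + sideEnergy lam (c - b) - sideEnergy lam (c - a) with hg
  have hg0 : 0 < g := by
    have := hgain (b - a) (c - b) (by linarith) (by linarith) (by linarith)
    rwa [show b - a + (c - b) = c - a by ring] at this
  -- The approximation error in the perimeter is then at most `2 * π * δ = g / 2`; the area of the
  -- inner polygon only helps.
  set δ := g / (4 * π) with hδ
  have hδ0 : 0 < δ := by have := pi_pos; positivity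
  have hAc : IsCompact (K ∩ Metric.sphere 0 1) := hb.compact.inter_right Metric.isClosed_sphere
  obtain ⟨F, hFA, hFfin, hFcov⟩ := Metric.finite_approx_of_totallyBounded hAc.totallyBounded δ hδ0
  -- A total angle function for `choose`; its value 0 off the circle plays no role.
  have hang : ∀ z : ℂ, ∃ x : ℝ, ‖z‖ = 1 → x ∈ Ico a (a + 2 * π) ∧ circlePt x = z := fun z => by
    by_cases h : ‖z‖ = 1
    · obtain ⟨x, hx, e⟩ := exists_circlePt h a
      exact ⟨x, fun _ => ⟨hx, e⟩⟩
    · exact ⟨0, fun h' => absurd h' h⟩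
  choose ang hang using hang
  have hFn : ∀ z ∈ F, ‖z‖ = 1 := fun z hz => by simpa using (hFA hz).2
  set X : Finset ℝ := hFfin.toFinset.image ang ∪ {a, b, c} with hXd
  have haX : a ∈ X := by simp [hXd]
  have hbX : b ∈ X := by simp [hXd]
  have hcX : c ∈ X := by simp [hXd]
  have hX : ∀ x ∈ X, x ∈ Ico a (a + 2 * π) ∧ circlePt x ∈ K := by
    intro x hx
    simp only [hXd, Finset.mem_union, Finset.mem_image, Finite.mem_toFinset, Finset.mem_insert,
      Finset.mem_singleton] at hx
    rcases hx with ⟨z, hz, rfl⟩ | rfl | rfl | rfl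
    · obtain ⟨h1, h2⟩ := hang z (hFn z hz)
      exact ⟨h1, by rw [h2]; exact (hFA hz).1⟩
    · exact ⟨⟨le_rfl, by linarith [pi_pos]⟩, ha.2⟩
    · exact ⟨⟨hab.le, by linarith [ha.1.1, hb'.1.2]⟩, hb'.2⟩
    · exact ⟨⟨by linarith, by linarith [ha.1.1, hc.1.2]⟩, hc.2⟩
  have hXb := isBody_hullOf ⟨a, haX⟩
  have hXK : hullOf X ⊆ K := by
    refine convexHull_min ?_ hb.convex
    rintro _ ⟨x, hx, rfl⟩
    exact (hX x hx).2
  have hnear : ∀ z ∈ K, ∃ w ∈ hullOf X, ‖z - w‖ ≤ δ := by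
    have hth : K ⊆ Metric.cthickening δ (hullOf X) := by
      refine hsub.trans (closure_minimal (convexHull_min ?_ (hXb.convex.cthickening δ))
        Metric.isClosed_cthickening)
      intro z hz
      obtain ⟨w, hw, hzw⟩ := mem_iUnion₂.1 (hFcov hz)
      have hwX : w ∈ hullOf X := by
        rw [← (hang w (hFn w hw)).2]
        apply circlePt_mem_hullOf
        simp only [hXd, Finset.mem_union, Finset.mem_image, Finite.mem_toFinset]
        exact Or.inl ⟨w, hw, rfl⟩
      exact Metric.mem_cthickening_of_dist_le z w δ _ hwX (le_of_lt (Metric.mem_ball.1 hzw))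
    rw [hXb.compact.cthickening_eq_biUnion_closedBall hδ0.le] at hth
    intro z hz
    obtain ⟨w, hw, hzw⟩ := mem_iUnion₂.1 (hth hz)
    exact ⟨w, hw, by rw [← dist_eq_norm]; exact Metric.mem_closedBall.1 hzw⟩
  have hper := cauchyPer_le_of_near hb.nonempty hb.compact hXb.compact hnear
  have hvol := volume_real_mono hb.compact hXK
  have hle : cauchyEnergy lam (hullOf X) ≤ cauchyEnergy lam K + 2 * π * δ := by
    simp only [cauchyEnergy]
    nlinarith
  -- Clearing both open arcs first makes `a` and `c` the neighbours of `b`, so that removing `b`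
  -- gains exactly `g`.
  set X₁ := X.filter (· ∉ Ioo a b) with hX₁
  set X₂ := X₁.filter (· ∉ Ioo b c) with hX₂
  have hX₁X : ∀ x ∈ X₁, x ∈ X := fun x hx => (Finset.mem_filter.1 hx).1
  have hX₂X : ∀ x ∈ X₂, x ∈ X₁ := fun x hx => (Finset.mem_filter.1 hx).1
  have ha₁ : a ∈ X₁ := Finset.mem_filter.2 ⟨haX, fun h => lt_irrefl _ h.1⟩
  have hb₁ : b ∈ X₁ := Finset.mem_filter.2 ⟨hbX, fun h => lt_irrefl _ h.2⟩
  have hc₁ : c ∈ X₁ := Finset.mem_filter.2 ⟨hcX, fun h => lt_asymm h.2 hbc⟩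
  have ha₂ : a ∈ X₂ := Finset.mem_filter.2 ⟨ha₁, fun h => lt_asymm h.1 hab⟩
  have hb₂ : b ∈ X₂ := Finset.mem_filter.2 ⟨hb₁, fun h => lt_irrefl _ h.1⟩
  have hc₂ : c ∈ X₂ := Finset.mem_filter.2 ⟨hc₁, fun h => lt_irrefl _ h.2⟩
  have hle₁ := cauchyEnergy_filter_le hgain (by linarith) _ X (fun x hx => (hX x hx).1)
    haX hbX rfl
  have hle₂ := cauchyEnergy_filter_le hgain (by linarith) _ X₁
    (fun x hx => (hX x (hX₁X x hx)).1) hb₁ hc₁ rfl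
  have he := cauchyEnergy_erase (lam := lam) (fun x hx => (hX x (hX₁X x (hX₂X x hx))).1)
    ha₂ hb₂ hc₂ hab hbc (by
      intro x hx hax hxc
      obtain ⟨h1, h2⟩ := Finset.mem_filter.1 hx
      obtain ⟨-, h3⟩ := Finset.mem_filter.1 h1
      rcases lt_trichotomy x b with h | h | h
      · exact absurd ⟨hax, h⟩ h3
      · exact h
      · exact absurd ⟨h, hxc⟩ h2)
  have hmin := hK.le (hullOf (X₂.erase b))
    (isBody_hullOf ⟨a, Finset.mem_erase.2 ⟨hab.ne, ha₂⟩⟩) (hullOf_subset _)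
  have hδg : 2 * π * δ = g / 2 := by
    rw [hδ]; field_simp; norm_num
  linarith

/-! ### Inscribed polygons -/

section Inscribed

variable {m : ℕ} {θ : Fin m → ℝ}

/-- The polar angle of the vertices of the inscribed polygon with central angles `θ`. -/
def vertexAngle (θ : Fin m → ℝ) (α : ℝ) (i : Fin m) : ℝ :=
  α + ∑ j ∈ Finset.univ.filter (fun j => j < i), θ j

lemma isInscribedPolygon_iff {K : Set ℂ} : IsInscribedPolygon K m θ ↔
    3 ≤ m ∧ (∀ i, 0 < θ i) ∧ ∑ i, θ i = 2 * π ∧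
      ∃ α : ℝ, K = convexHull ℝ (range fun i => circlePt (vertexAngle θ α i)) := Iff.rfl

lemma vertexAngle_lt (hθ : ∀ i, 0 < θ i) (α : ℝ) {i j : Fin m} (h : i < j) :
    vertexAngle θ α i + θ i ≤ vertexAngle θ α j := by
  have hnot : i ∉ Finset.univ.filter (fun k => k < i) := by simp
  have : ∑ k ∈ insert i (Finset.univ.filter (fun k => k < i)), θ k
      ≤ ∑ k ∈ Finset.univ.filter (fun k => k < j), θ k := by
    apply Finset.sum_le_sum_of_subset_of_nonneg
    · intro k hk
      rcases Finset.mem_insert.1 hk with rfl | hk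
      · simpa using h
      · simp only [Finset.mem_filter, Finset.mem_univ, true_and] at hk ⊢
        exact hk.trans h
    · intro k _ _; exact (hθ k).le
  rw [Finset.sum_insert hnot] at this
  simp only [vertexAngle]; linarith

lemma vertexAngle_le_add (hθ : ∀ i, 0 < θ i) (hsum : ∑ i, θ i = 2 * π) (α : ℝ) (i : Fin m) :
    vertexAngle θ α i + θ i ≤ α + 2 * π := by
  have hnot : i ∉ Finset.univ.filter (fun k => k < i) := by simp
  have : ∑ k ∈ insert i (Finset.univ.filter (fun k => k < i)), θ k ≤ ∑ k, θ k :=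
    Finset.sum_le_sum_of_subset_of_nonneg (Finset.subset_univ _) fun k _ _ => (hθ k).le
  rw [Finset.sum_insert hnot, hsum] at this
  simp only [vertexAngle]; linarith

lemma le_vertexAngle (hθ : ∀ i, 0 < θ i) (α : ℝ) (i : Fin m) : α ≤ vertexAngle θ α i := by
  have : 0 ≤ ∑ j ∈ Finset.univ.filter (fun j => j < i), θ j :=
    Finset.sum_nonneg fun k _ => (hθ k).le
  simp only [vertexAngle]; linarith

lemma angle_lt_two_pi (hm : 3 ≤ m) (hθ : ∀ i, 0 < θ i) (hsum : ∑ i, θ i = 2 * π) (i : Fin m) :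
    θ i < 2 * π := by
  rw [← hsum]
  obtain ⟨j, hj⟩ : ∃ j : Fin m, j ≠ i := by
    by_contra! h
    have h0 := h ⟨0, by omega⟩
    have h1 := h ⟨1, by omega⟩
    rw [← h1, Fin.ext_iff] at h0
    simp at h0
  exact Finset.single_lt_sum hj (Finset.mem_univ i) (Finset.mem_univ j) (hθ j)
    fun k _ _ => (hθ k).le

lemma isConvexPolygon_vertices {n : ℕ} {θ : Fin (n + 1) → ℝ} (hθ : ∀ i, 0 < θ i)
    (hsum : ∑ i, θ i = 2 * π) (α : ℝ) :
    IsConvexPolygon fun i => circlePt (vertexAngle θ α i) := by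
  intro i j k hij hjk
  rw [cross_circlePt]
  have h1 := vertexAngle_lt hθ α hij
  have h2 := vertexAngle_lt hθ α hjk
  have h3 := vertexAngle_le_add hθ hsum α k
  have h4 := le_vertexAngle hθ α i
  have := hθ i
  have := hθ j
  have := hθ k
  have a1 := sin_pos_of_pos_of_lt_pi (x := (vertexAngle θ α j - vertexAngle θ α i) / 2)
    (by linarith) (by linarith)
  have a2 := sin_pos_of_pos_of_lt_pi (x := (vertexAngle θ α k - vertexAngle θ α j) / 2)
    (by linarith) (by linarith)
  have a3 := sin_pos_of_pos_of_lt_pi (x := (vertexAngle θ α k - vertexAngle θ α i) / 2)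
    (by linarith) (by linarith)
  positivity

/-- At the last index the cyclic successor is 0, and the angles differ by a full turn. -/
lemma circlePt_vertexAngle_succ {n : ℕ} {θ : Fin (n + 1) → ℝ}
    (hsum : ∑ i, θ i = 2 * π) (α : ℝ) (i : Fin (n + 1)) :
    circlePt (vertexAngle θ α (i + 1)) = circlePt (vertexAngle θ α i + θ i) := by
  have hnot : i ∉ Finset.univ.filter (fun k => k < i) := by simp
  have hadd : vertexAngle θ α i + θ i
      = α + ∑ k ∈ insert i (Finset.univ.filter (fun k => k < i)), θ k := by
    rw [Finset.sum_insert hnot, vertexAngle]; ring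
  rw [hadd]
  induction i using Fin.lastCases with
  | last =>
    have : insert (Fin.last n) (Finset.univ.filter (fun k => k < Fin.last n)) = Finset.univ := by
      ext k; simp [(Fin.le_last k).eq_or_lt]
    rw [this, hsum, circlePt_add_two_pi, Fin.last_add_one]
    simp [vertexAngle]
  | cast i =>
    have : insert i.castSucc (Finset.univ.filter (fun k => k < i.castSucc))
        = Finset.univ.filter (fun k => k < i.succ) := by
      ext k
      simp only [Finset.mem_insert, Finset.mem_filter, Finset.mem_univ, true_and, Fin.ext_iff,
        Fin.lt_def, Fin.val_castSucc, Fin.val_succ]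
      omega
    rw [this, Fin.coeSucc_eq_succ, vertexAngle]

theorem inscribed_formulas {K : Set ℂ} (hK : IsInscribedPolygon K m θ) :
    IsBody K ∧ K ⊆ unitDisk ∧ cauchyPer K = ∑ i, 2 * sin (θ i / 2) ∧
      volume.real K = 1 / 2 * ∑ i, sin (θ i) ∧
      ∃ (n : ℕ) (p : Fin (n + 1) → ℂ), (∀ i, p i ∈ K) ∧ IsConvexPolygon p ∧
        polygonLength p = cauchyPer K := by
  obtain ⟨hm, hθ, hsum, α, rfl⟩ := isInscribedPolygon_iff.1 hK
  obtain ⟨n, rfl⟩ : ∃ n, m = n + 1 := ⟨m - 1, by omega⟩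
  have hcp := isConvexPolygon_vertices hθ hsum α
  obtain ⟨h1, h2⟩ := convexPolygon_formulas _ hcp
  have hlt := angle_lt_two_pi hm hθ hsum
  refine ⟨IsBody.hull (finite_range _) (range_nonempty _), ?_, ?_, ?_, n, _,
    fun i => subset_convexHull ℝ _ ⟨i, rfl⟩, hcp, h1.symm⟩
  · refine convexHull_min ?_ convex_unitDisk
    rintro _ ⟨i, rfl⟩
    exact circlePt_mem _
  · rw [h1, polygonLength]
    refine Finset.sum_congr rfl fun i _ => ?_
    rw [circlePt_vertexAngle_succ hsum, dist_circlePt (by linarith [hθ i])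
      (by linarith [hlt i]), add_sub_cancel_left]
  · rw [h2]
    congr 1
    refine Finset.sum_congr rfl fun i _ => ?_
    rw [circlePt_vertexAngle_succ hsum]
    simp only [Complex.mul_im, Complex.conj_re, Complex.conj_im, circlePt_re, circlePt_im]
    have := sin_sub (vertexAngle θ α i + θ i) (vertexAngle θ α i)
    rw [add_sub_cancel_left] at this
    rw [this]; ring

lemma inscribed_cauchyEnergy {K : Set ℂ} (hK : IsInscribedPolygon K m θ) (lam : ℝ) :
    cauchyEnergy lam K = ∑ i, sideEnergy lam (θ i) := by
  obtain ⟨-, -, h1, h2, -⟩ := inscribed_formulas hK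
  rw [cauchyEnergy, h1, h2, Finset.mul_sum, Finset.mul_sum, ← Finset.sum_sub_distrib]
  refine Finset.sum_congr rfl fun i _ => ?_
  rw [sideEnergy]; ring

lemma exists_isInscribedPolygon (hm : 3 ≤ m) (hθ : ∀ i, 0 < θ i) (hsum : ∑ i, θ i = 2 * π) :
    ∃ K, IsInscribedPolygon K m θ :=
  ⟨_, isInscribedPolygon_iff.2 ⟨hm, hθ, hsum, 0, rfl⟩⟩

end Inscribed

lemma sum_filter_lt {m : ℕ} (g : ℕ → ℝ) (i : Fin m) :
    ∑ j ∈ Finset.univ.filter (fun j : Fin m => j < i), g j = ∑ k ∈ Finset.range i, g k := by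
  refine Finset.sum_bij (fun j _ => (j : ℕ)) ?_ ?_ ?_ ?_
  · intro j hj
    exact Finset.mem_range.2 (Fin.lt_def.1 (Finset.mem_filter.1 hj).2)
  · intro j _ k _ h; exact Fin.ext h
  · intro k hk
    have hk := Finset.mem_range.1 hk
    exact ⟨⟨k, hk.trans i.2⟩,
      Finset.mem_filter.2 ⟨Finset.mem_univ _, Fin.lt_def.2 hk⟩, rfl⟩
  · intro j _; rfl

/-- The convex hull of a finite subset of the circle with interior points is an inscribed
polygon. -/
lemma exists_angles_of_finite {A : Set ℂ} (hA : A.Finite) (hA1 : ∀ z ∈ A, ‖z‖ = 1)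
    (hint : (interior (convexHull ℝ A)).Nonempty) :
    ∃ (m : ℕ) (θ : Fin m → ℝ), IsInscribedPolygon (convexHull ℝ A) m θ := by
  have hang : ∀ z : ℂ, ∃ x : ℝ, ‖z‖ = 1 → x ∈ Ico 0 (0 + 2 * π) ∧ circlePt x = z := fun z => by
    by_cases h : ‖z‖ = 1
    · obtain ⟨x, hx, e⟩ := exists_circlePt h 0
      exact ⟨x, fun _ => ⟨hx, e⟩⟩
    · exact ⟨0, fun h' => absurd h' h⟩
  choose ang hang using hang
  set X := hA.toFinset.image ang with hX
  have hX0 : ∀ x ∈ X, 0 ≤ x ∧ x < 2 * π := by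
    intro x hx
    obtain ⟨z, hz, rfl⟩ := Finset.mem_image.1 hx
    have := (hang z (hA1 z (hA.mem_toFinset.1 hz))).1
    rwa [zero_add] at this
  have hAX : A = circlePt '' X := by
    ext z
    constructor
    · intro hz
      exact ⟨ang z, Finset.mem_coe.2 (Finset.mem_image_of_mem _ (hA.mem_toFinset.2 hz)),
        (hang z (hA1 z hz)).2⟩
    · rintro ⟨x, hx, rfl⟩
      obtain ⟨z, hz, rfl⟩ := Finset.mem_image.1 (Finset.mem_coe.1 hx)
      rw [(hang z (hA1 z (hA.mem_toFinset.1 hz))).2]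
      exact hA.mem_toFinset.1 hz
  obtain ⟨m, hm⟩ : ∃ m, X.card = m := ⟨_, rfl⟩
  set x := X.orderEmbOfFin hm with hx
  have hrange : range x = X := X.range_orderEmbOfFin hm
  have hAr : A = range fun i => circlePt (x i) := by
    rw [hAX, ← hrange, ← range_comp]; rfl
  have hseg : ∀ p q : ℂ, ¬ (convexHull ℝ A ⊆ segment ℝ p q) := by
    intro p q h
    have h1 : 0 < volume (interior (convexHull ℝ A)) := isOpen_interior.measure_pos _ hint
    have h2 : volume (segment ℝ p q) = 0 := by
      have := volume_real_segment p q
      rw [measureReal_def, ENNReal.toReal_eq_zero_iff] at this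
      exact this.resolve_right (isBody_segment p q).volume_ne_top
    exact h1.ne' (measure_mono_null (interior_subset.trans h) h2)
  have hm3 : 3 ≤ m := by
    by_contra hlt
    obtain rfl | rfl | rfl : m = 0 ∨ m = 1 ∨ m = 2 := by omega
    · have : A = ∅ := by rw [hAr]; exact range_eq_empty _
      rw [this, convexHull_empty, interior_empty] at hint
      exact not_nonempty_empty hint
    · apply hseg (circlePt (x 0)) (circlePt (x 0))
      rw [segment_same, ← convexHull_singleton (𝕜 := ℝ)]
      apply convexHull_mono
      rw [hAr]
      rintro _ ⟨i, rfl⟩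
      rw [Subsingleton.elim i 0]; rfl
    · apply hseg (circlePt (x 0)) (circlePt (x 1))
      rw [← convexHull_pair]
      apply convexHull_mono
      rw [hAr]
      rintro _ ⟨i, rfl⟩
      fin_cases i
      · left; rfl
      · right; rfl
  obtain ⟨n, rfl⟩ : ∃ n, m = n + 1 := ⟨m - 1, by omega⟩
  -- The sorted angles, continued by the first one a full turn later, so that the central angles are
  -- consecutive differences and telescope to `2 * π`.
  set y : ℕ → ℝ := fun k => if h : k < n + 1 then x ⟨k, h⟩ else x 0 + 2 * π with hy
  have hyx : ∀ i : Fin (n + 1), y i = x i := fun i => by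
    simp only [hy, dif_pos i.2]
  have hylast : y (n + 1) = x 0 + 2 * π := by simp [hy]
  have hy0 : y 0 = x 0 := hyx 0
  refine ⟨n + 1, fun i => y (i + 1) - y i, isInscribedPolygon_iff.2 ⟨hm3, ?_, ?_, x 0, ?_⟩⟩
  · intro i
    rw [hyx]
    by_cases h : (i : ℕ) + 1 < n + 1
    · have : y (i + 1) = x ⟨i + 1, h⟩ := by simp only [hy, dif_pos h]
      rw [this, sub_pos]
      exact x.strictMono (by rw [Fin.lt_def]; simp)
    · have hi : (i : ℕ) + 1 = n + 1 := by omega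
      rw [hi, hylast]
      have h1 := hX0 _ (X.orderEmbOfFin_mem hm i)
      have h2 := hX0 _ (X.orderEmbOfFin_mem hm 0)
      rw [← hx] at h1 h2
      linarith
  · rw [Fin.sum_univ_eq_sum_range (fun k => y (k + 1) - y k), Finset.sum_range_sub, hylast, hy0]
    ring
  · rw [hAr]
    congr 2
    ext1 i
    congr 1
    rw [vertexAngle, sum_filter_lt (fun k => y (k + 1) - y k), Finset.sum_range_sub, hyx, hy0]
    ring

/-! ### Optimality conditions for polygons -/

lemma sum_update_two {m : ℕ} (θ : Fin m → ℝ) {i j : Fin m} (hij : i ≠ j) (s t : ℝ) (g : ℝ → ℝ) :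
    ∑ k, g (Function.update (Function.update θ i s) j t k)
      = ∑ k, g (θ k) - g (θ i) - g (θ j) + g s + g t := by
  have h : ∑ k, (g (Function.update (Function.update θ i s) j t k) - g (θ k))
      = (g s - g (θ i)) + (g t - g (θ j)) := by
    rw [Fintype.sum_eq_add i j hij]
    · simp [hij]
    · rintro k ⟨hki, hkj⟩
      simp [hki, hkj]
  rw [Finset.sum_sub_distrib] at h
  linarith

/-- The energy depends only on the central angles, so any two of them, adjacent or not, may be
redistributed with fixed sum. -/
lemma IsMin.pair_le {lam : ℝ} {K : Set ℂ} (hK : IsMin lam K) {m : ℕ} {θ : Fin m → ℝ}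
    (hθK : IsInscribedPolygon K m θ) {i j : Fin m} (hij : i ≠ j) {s : ℝ} (hs : 0 < s)
    (hs' : s < θ i + θ j) :
    sideEnergy lam (θ i) + sideEnergy lam (θ j)
      ≤ sideEnergy lam s + sideEnergy lam (θ i + θ j - s) := by
  obtain ⟨hm, hθ, hsum, -⟩ := id hθK
  obtain ⟨L, hL⟩ := exists_isInscribedPolygon (θ := Function.update (Function.update θ i s) j
    (θ i + θ j - s)) hm (by
      intro k
      rcases eq_or_ne k j with rfl | hkj
      · simp; linarith
      · rcases eq_or_ne k i with rfl | hki
        · simpa [hkj] using hs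
        · simpa [hkj, hki] using hθ k) (by
      rw [sum_update_two θ hij _ _ (fun x => x), hsum]; ring)
  obtain ⟨h1, h2, -⟩ := inscribed_formulas hL
  have := hK.le L h1 h2
  rw [inscribed_cauchyEnergy hθK, inscribed_cauchyEnergy hL,
    sum_update_two θ hij _ _ (sideEnergy lam)] at this
  linarith

lemma hasDerivAt_sideEnergy (lam t : ℝ) :
    HasDerivAt (sideEnergy lam) (lam / 2 * cos t - cos (t / 2)) t := by
  have h1 := (hasDerivAt_sin t).const_mul (lam / 2)
  have h2 := (((hasDerivAt_id t).div_const 2).sin).const_mul 2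
  refine (h1.sub h2).congr_deriv ?_
  simp only [id]; ring

/-- By the double angle formula the derivative at `s = a` factors as `(cos (a/2) - cos (b/2)) * (lam
* (cos (a/2) + cos (b/2)) - 1)`. -/
lemma first_order {lam a b : ℝ} (ha : 0 < a) (hb : 0 < b) (ha' : a < 2 * π) (hb' : b < 2 * π)
    (h : ∀ s, 0 < s → s < a + b →
      sideEnergy lam a + sideEnergy lam b ≤ sideEnergy lam s + sideEnergy lam (a + b - s)) :
    a = b ∨ lam * (cos (a / 2) + cos (b / 2)) = 1 := by
  have hmin : IsLocalMin (fun s => sideEnergy lam s + sideEnergy lam (a + b - s)) a := by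
    have : Ioo 0 (a + b) ∈ nhds a := Ioo_mem_nhds ha (by linarith)
    filter_upwards [this] with s hs
    have := h s hs.1 hs.2
    rwa [show a + b - a = b by ring]
  have hd2 : HasDerivAt (fun s => a + b - s) (-1) a := by
    simpa using (hasDerivAt_id a).const_sub (a + b)
  have hd : HasDerivAt (fun s => sideEnergy lam s + sideEnergy lam (a + b - s))
      ((lam / 2 * cos a - cos (a / 2)) + (lam / 2 * cos b - cos (b / 2)) * (-1)) a := by
    refine (hasDerivAt_sideEnergy lam a).add (HasDerivAt.comp a (h₂ := sideEnergy lam) ?_ hd2)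
    rw [show a + b - a = b by ring]
    exact hasDerivAt_sideEnergy lam b
  have h0 := hmin.hasDerivAt_eq_zero hd
  have e : ∀ x : ℝ, cos x = 2 * cos (x / 2) ^ 2 - 1 := fun x => by
    rw [← cos_two_mul]; congr 1; ring
  rw [e a, e b] at h0
  have h1 : (cos (a / 2) - cos (b / 2)) * (lam * (cos (a / 2) + cos (b / 2)) - 1) = 0 := by
    linear_combination h0
  rcases mul_eq_zero.1 h1 with h2 | h2
  · left
    have := injOn_cos ⟨by linarith, by linarith⟩ ⟨by linarith, by linarith⟩ (sub_eq_zero.1 h2)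
    linarith
  · right; linarith

/-- Two equal angles are perturbed to `a + x` and `a - x`. The energy difference has the exact
factor `sin (a/2) * sin (x/4) ^ 2`; divide by it and let `x` tend to 0. -/
lemma second_order {lam a : ℝ} (ha : 0 < a) (ha' : a < 2 * π)
    (h : ∀ s, 0 < s → s < a + a →
      sideEnergy lam a + sideEnergy lam a ≤ sideEnergy lam s + sideEnergy lam (a + a - s)) :
    2 * lam * cos (a / 2) ≤ 1 := by
  have hsa : 0 < sin (a / 2) := sin_pos_of_pos_of_lt_pi (by linarith) (by linarith)
  have key : ∀ x, 0 < x → x < a → x < π → 2 * lam * cos (a / 2) * cos (x / 4) ^ 2 ≤ 1 := by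
    intro x hx hxa hxπ
    have h1 := h (a + x) (by linarith) (by linarith)
    rw [show a + a - (a + x) = a - x by ring] at h1
    simp only [sideEnergy] at h1
    rw [show (a + x) / 2 = a / 2 + x / 2 by ring, show (a - x) / 2 = a / 2 - x / 2 by ring,
      sin_add, sin_sub, sin_add, sin_sub] at h1
    have e1 : sin a = 2 * sin (a / 2) * cos (a / 2) := by rw [← sin_two_mul]; congr 1; ring
    have e2 : cos (x / 2) = 1 - 2 * sin (x / 4) ^ 2 := by
      rw [← cos_two_mul_eq_one_sub]
      congr 1; ring
    have e3 : cos x = 1 - 8 * sin (x / 4) ^ 2 * cos (x / 4) ^ 2 := by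
      have : cos x = 1 - 2 * sin (x / 2) ^ 2 := by
        rw [← cos_two_mul_eq_one_sub]; congr 1; ring
      rw [this, show x / 2 = 2 * (x / 4) by ring, sin_two_mul]; ring
    rw [e1, e2, e3] at h1
    have hs4 : 0 < sin (x / 4) := sin_pos_of_pos_of_lt_pi (by linarith) (by linarith)
    have hpos : 0 < sin (a / 2) * sin (x / 4) ^ 2 := by positivity
    have h2 : sin (a / 2) * sin (x / 4) ^ 2 * (2 * lam * cos (a / 2) * cos (x / 4) ^ 2)
        ≤ sin (a / 2) * sin (x / 4) ^ 2 * 1 := by linarith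
    exact le_of_mul_le_mul_left h2 hpos
  have hlim : Filter.Tendsto (fun x : ℝ => 2 * lam * cos (a / 2) * cos (x / 4) ^ 2)
      (nhdsWithin 0 (Ioi 0)) (nhds (2 * lam * cos (a / 2))) := by
    have : Continuous fun x : ℝ => 2 * lam * cos (a / 2) * cos (x / 4) ^ 2 := by fun_prop
    have := this.tendsto 0
    simp only [zero_div, cos_zero, one_pow, mul_one] at this
    exact this.mono_left nhdsWithin_le_nhds
  refine le_of_tendsto hlim ?_
  filter_upwards [Ioo_mem_nhdsGT (show (0 : ℝ) < min a π from lt_min ha pi_pos)] with x hx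
  exact key x hx.1 (hx.2.trans_le (min_le_left _ _)) (hx.2.trans_le (min_le_right _ _))

/-- The sides of an optimal polygon are equal, up to one which is smaller. -/
lemma IsMin.exists_type {lam : ℝ} (hlam : 0 < lam) {K : Set ℂ} (hK : IsMin lam K) {m : ℕ}
    {θ : Fin m → ℝ} (hθK : IsInscribedPolygon K m θ) :
    ∃ t, Admissible m t ∧ IsPolygonOfType K m t ∧ (t = 2 * π / m ∨
      lam = (cos (t / 2) + cos ((2 * π - t) / (2 * ((m : ℝ) - 1))))⁻¹) := by
  obtain ⟨hm, hθ, hsum, -⟩ := id hθK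
  have hlt := angle_lt_two_pi hm hθ hsum
  have : Nonempty (Fin m) := ⟨⟨0, by omega⟩⟩
  have hm' : (3 : ℝ) ≤ m := by exact_mod_cast hm
  have hm1 : (0 : ℝ) < (m : ℝ) - 1 := by linarith
  obtain ⟨i₀, hi₀⟩ := Finite.exists_min θ
  have hsplit : ∀ b, (∀ i, i ≠ i₀ → θ i = b) → θ i₀ + ((m : ℝ) - 1) * b = 2 * π := by
    intro b hb
    rw [← hsum, ← Finset.add_sum_erase _ _ (Finset.mem_univ i₀),
      Finset.sum_congr rfl (fun i hi => hb i (Finset.ne_of_mem_erase hi)), Finset.sum_const,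
      Finset.card_erase_of_mem (Finset.mem_univ _), Finset.card_univ, Fintype.card_fin,
      nsmul_eq_mul, Nat.cast_sub (by omega), Nat.cast_one]
  obtain ⟨b, hb, hab, hcase⟩ : ∃ b, (∀ i, i ≠ i₀ → θ i = b) ∧ θ i₀ ≤ b ∧
      (θ i₀ = b ∨ lam * (cos (θ i₀ / 2) + cos (b / 2)) = 1) := by
    by_cases hall : ∀ i, θ i = θ i₀
    · exact ⟨θ i₀, fun i _ => hall i, le_rfl, Or.inl rfl⟩
    · push Not at hall
      obtain ⟨j, hj⟩ := hall
      have hji : j ≠ i₀ := by rintro rfl; exact hj rfl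
      have hfo := fun k (hk : k ≠ i₀) => first_order (hθ i₀) (hθ k) (hlt i₀) (hlt k)
        (fun s hs hs' => hK.pair_le hθK hk.symm hs hs')
      have hjc := (hfo j hji).resolve_left (fun h => hj h.symm)
      refine ⟨θ j, fun k hk => ?_, hi₀ j, Or.inr hjc⟩
      rcases hfo k hk with h | h
      -- A second copy of the smallest angle is impossible: `second_order` gives `2 * lam * cos (θ
      -- i₀ / 2) ≤ 1`, whereas `hjc` with the strictly larger `θ j` gives the opposite strict
      -- inequality.
      · exfalso
        have hso := second_order (hθ i₀) (hlt i₀) (fun s hs hs' => by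
          have := hK.pair_le (s := s) hθK hk.symm hs (by rw [← h]; exact hs')
          rwa [← h] at this)
        have hcos : cos (θ j / 2) < cos (θ i₀ / 2) := by
          have := lt_of_le_of_ne (hi₀ j) (Ne.symm hj)
          exact cos_lt_cos_of_nonneg_of_le_pi (by linarith [hθ i₀]) (by linarith [hlt j])
            (by linarith)
        nlinarith
      · have : cos (θ k / 2) = cos (θ j / 2) := by
          have : lam * (cos (θ k / 2) - cos (θ j / 2)) = 0 := by linarith
          rcases mul_eq_zero.1 this with h' | h'
          · exact absurd h' hlam.ne'
          · linarith
        have := injOn_cos ⟨by linarith [hθ k], by linarith [hlt k]⟩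
          ⟨by linarith [hθ j], by linarith [hlt j]⟩ this
        linarith
  have hs := hsplit b hb
  have hbe : b = (2 * π - θ i₀) / (m - 1) := by
    rw [eq_div_iff hm1.ne']; linarith
  refine ⟨θ i₀, ⟨hm, hθ i₀, ?_⟩, ⟨θ, hθK, i₀, rfl, fun i hi => by rw [hb i hi, hbe]⟩, ?_⟩
  · rw [le_div_iff₀ (by linarith)]; nlinarith
  · rcases hcase with h | h
    · left
      rw [eq_div_iff (by linarith)]
      rw [← h] at hs
      linarith
    · right
      rw [show (2 * π - θ i₀) / (2 * ((m : ℝ) - 1)) = b / 2 by rw [hbe]; field_simp]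
      exact eq_inv_of_mul_eq_one_left h

/-- Classification of the minimisers. -/
theorem IsMin.classification {lam : ℝ} (hlam : 0 < lam) {K : Set ℂ} (hK : IsMin lam K) :
    K = unitDisk ∨ IsDiameter K ∨ ∃ m t, Admissible m t ∧ IsPolygonOfType K m t ∧
      (t = 2 * π / m ∨ lam = (cos (t / 2) + cos ((2 * π - t) / (2 * ((m : ℝ) - 1))))⁻¹) := by
  by_cases hcol : ∀ a ∈ K, ∀ b ∈ K, ∀ c ∈ K, cross a b c = 0
  · exact Or.inr (Or.inl (hK.isDiameter hcol))
  · push Not at hcol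
    obtain ⟨a, ha, b, hb, c, hc, hne⟩ := hcol
    have hint := interior_nonempty_of_cross_ne_zero hK.body ha hb hc hne
    rcases le_or_gt lam (1 / 2) with h | h
    · exact Or.inl (hK.eq_unitDisk hlam h hint)
    · right; right
      have hfin := hK.finite_vertices h hint
      have hKA : K = convexHull ℝ (K ∩ Metric.sphere 0 1) := by
        apply Subset.antisymm
        · have := hK.subset_closure_hull hlam hint
          rwa [(hfin.isClosed_convexHull ℝ).closure_eq] at this
        · exact convexHull_min inter_subset_left hK.body.convex
      obtain ⟨m, θ, hθ⟩ := exists_angles_of_finite hfin (fun z hz => by simpa using hz.2)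
        (by rw [← hKA]; exact hint)
      rw [← hKA] at hθ
      obtain ⟨t, ht⟩ := hK.exists_type hlam hθ
      exact ⟨m, t, ht⟩

/-! ### Existence of minimisers -/

/-- The area is lower semicontinuous on convex bodies. -/
lemma exists_volume_lower_bound {K : Set ℂ} (hK : IsBody K) {ε : ℝ} (hε : 0 < ε) :
    ∃ r, 0 < r ∧ ∀ L, IsBody L → (∀ z ∈ K, ∃ w ∈ L, dist z w < r) →
      volume.real K - ε ≤ volume.real L := by
  -- Points at depth at least `1 / (n + 1)`. They exhaust the interior, which has full area by
  -- convexity, so it is enough that `L` contains one such set.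
  set S : ℕ → Set ℂ := fun n => {x | Metric.closedBall x (1 / ((n : ℝ) + 1)) ⊆ K} with hS
  have hmono : Monotone S := fun n k hnk x hx =>
    (Metric.closedBall_subset_closedBall (Nat.one_div_le_one_div hnk)).trans hx
  have hU : interior K ⊆ ⋃ n, S n := by
    intro x hx
    obtain ⟨ρ, hρ, hb⟩ := Metric.mem_nhds_iff.1 (mem_interior_iff_mem_nhds.1 hx)
    obtain ⟨n, hn⟩ := exists_nat_one_div_lt hρ
    exact mem_iUnion.2 ⟨n, (Metric.closedBall_subset_ball hn).trans hb⟩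
  have hSK : ∀ n, S n ⊆ K := fun n x hx =>
    hx (Metric.mem_closedBall_self (by positivity))
  have hvol : volume (⋃ n, S n) = volume K := by
    apply le_antisymm (measure_mono (iUnion_subset hSK))
    have h1 : K ⊆ interior K ∪ frontier K := by
      rw [hK.compact.isClosed.frontier_eq, union_sdiff_cancel interior_subset]
    refine (measure_mono h1).trans ((measure_union_le _ _).trans ?_)
    rw [hK.convex.addHaar_frontier volume, add_zero]
    exact measure_mono hU
  have ht := tendsto_measure_iUnion_atTop (μ := volume) hmono
  rw [hvol] at ht
  have ht' := (ENNReal.tendsto_toReal hK.volume_ne_top).comp ht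
  obtain ⟨n, hn⟩ := (ht'.eventually (lt_mem_nhds
    (show volume.real K - ε < (volume K).toReal by rw [measureReal_def]; linarith))).exists
  refine ⟨1 / ((n : ℝ) + 1), by positivity, fun L hL hLK => hn.le.trans ?_⟩
  refine volume_real_mono hL.compact fun x hx => ?_
  by_contra hxL
  obtain ⟨φ, a, h1, h2⟩ := exists_comp_separation hL.convex hL.compact.isClosed hL.nonempty hxL
  set r := 1 / ((n : ℝ) + 1) with hr
  have hr0 : 0 < r := by positivity
  -- Pushing `x` by `r` in the separating direction stays in `K` but ends farther than `r` from all
  -- of `L`.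
  obtain ⟨w, hw, hd⟩ := hLK (x + r • circlePt φ) (hx (by
    rw [Metric.mem_closedBall, dist_eq_norm, add_sub_cancel_left, norm_smul, norm_circlePt,
      mul_one, Real.norm_of_nonneg hr0.le]))
  have h3 := comp_le_norm φ (x + r • circlePt φ - w)
  rw [dist_eq_norm] at hd
  have h4 : comp φ (circlePt φ) = 1 := by
    rw [comp, circlePt_re, circlePt_im, ← sq, ← sq, cos_sq_add_sin_sq]
  rw [comp_sub, comp_add, comp_smul, h4] at h3
  linarith [h1 w hw]

/-- Direct method: the convex compact subsets of the disk are compact for the Hausdorff distance,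
the area is lower semicontinuous there and has a positive coefficient, and the Cauchy perimeter is
continuous. -/
lemma exists_isMin {lam : ℝ} (hlam : 0 < lam) : ∃ K, IsMin lam K := by
  set 𝒦 : Set (TopologicalSpace.NonemptyCompacts ℂ) :=
    {L | (L : Set ℂ) ⊆ unitDisk} ∩ {L | Convex ℝ (L : Set ℂ)} with h𝒦
  have hnear : ∀ {K L : TopologicalSpace.NonemptyCompacts ℂ} {r : ℝ}, dist K L < r →
      ∀ z ∈ (K : Set ℂ), ∃ w ∈ (L : Set ℂ), dist z w < r := by
    intro K L r hd z hz
    exact Metric.exists_dist_lt_of_hausdorffDist_lt hz hd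
      (Metric.hausdorffEDist_ne_top_of_nonempty_of_bounded K.nonempty L.nonempty
        K.isCompact.isBounded L.isCompact.isBounded)
  have hclosed : IsClosed {L : TopologicalSpace.NonemptyCompacts ℂ | Convex ℝ (L : Set ℂ)} := by
    rw [← closure_subset_iff_isClosed]
    intro L hL x hx y hy a b ha hb hab
    rw [← L.isCompact.isClosed.closure_eq, Metric.mem_closure_iff]
    intro ε hε
    obtain ⟨L', hL', hd⟩ := Metric.mem_closure_iff.1 hL (ε / 2) (by linarith)
    obtain ⟨x', hx', hxx⟩ := hnear hd x hx
    obtain ⟨y', hy', hyy⟩ := hnear hd y hy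
    obtain ⟨w, hw, hdw⟩ := hnear (by rwa [dist_comm] at hd) _ (hL' hx' hy' ha hb hab)
    refine ⟨w, hw, ?_⟩
    have h1 : dist (a • x + b • y) (a • x' + b • y') ≤ ε / 2 := by
      calc _ ≤ dist (a • x) (a • x') + dist (b • y) (b • y') := dist_add_add_le _ _ _ _
        _ = a * dist x x' + b * dist y y' := by
          rw [dist_smul₀, dist_smul₀, Real.norm_of_nonneg ha, Real.norm_of_nonneg hb]
        _ ≤ a * (ε / 2) + b * (ε / 2) := by gcongr
        _ = ε / 2 := by rw [← add_mul, hab, one_mul]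
    linarith [dist_triangle (a • x + b • y) (a • x' + b • y') w]
  have hcomp : IsCompact 𝒦 :=
    (TopologicalSpace.NonemptyCompacts.isCompact_subsets_of_isCompact
      (isCompact_closedBall (0 : ℂ) 1)).inter_right hclosed
  have hbody : ∀ L ∈ 𝒦, IsBody (L : Set ℂ) := fun L hL => ⟨hL.2, L.isCompact, L.nonempty⟩
  have hne : 𝒦.Nonempty :=
    ⟨⟨⟨{0}, isCompact_singleton⟩, singleton_nonempty 0⟩, by
      intro z hz
      have : z = 0 := hz
      simp [this, unitDisk], convex_singleton 0⟩
  have hlsc : LowerSemicontinuousOn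
      (fun L : TopologicalSpace.NonemptyCompacts ℂ => cauchyEnergy lam L) 𝒦 := by
    intro K hK y hy
    set g := cauchyEnergy lam K - y with hg
    have hg0 : 0 < g := sub_pos.2 hy
    obtain ⟨r, hr, hvol⟩ := exists_volume_lower_bound (hbody K hK)
      (show 0 < g / (4 * lam) by positivity)
    set δ := min r (g / (8 * π)) with hδ
    have hδ0 : 0 < δ := lt_min hr (by have := pi_pos; positivity)
    have hev : ∀ᶠ L in nhdsWithin K 𝒦, dist L K < δ :=
      mem_nhdsWithin_of_mem_nhds (Metric.ball_mem_nhds K hδ0)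
    filter_upwards [hev, self_mem_nhdsWithin] with L hLK hL
    have h1 := hvol L (hbody L hL) (hnear (by
      rw [dist_comm]; exact hLK.trans_le (min_le_left _ _)))
    have h2 := cauchyPer_le_of_near L.nonempty L.isCompact K.isCompact (δ := δ) fun z hz => by
      obtain ⟨w, hw, hd⟩ := hnear hLK z hz
      exact ⟨w, hw, by rw [← dist_eq_norm]; exact hd.le⟩
    have h3 : 2 * π * δ ≤ g / 4 := by
      have h4 : δ ≤ g / (8 * π) := min_le_right _ _
      rw [le_div_iff₀ (by positivity)] at h4
      linarith
    have h5 : lam * (volume.real (K : Set ℂ) - g / (4 * lam)) ≤ lam * volume.real (L : Set ℂ) :=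
      mul_le_mul_of_nonneg_left h1 hlam.le
    have h6 : lam * (g / (4 * lam)) = g / 4 := by field_simp
    rw [mul_sub, h6] at h5
    simp only [cauchyEnergy] at hg ⊢
    linarith
  obtain ⟨K, hK, hmin⟩ := hlsc.exists_isMinOn hne hcomp
  refine ⟨K, hbody K hK, hK.1, fun L hL hLD => ?_⟩
  exact hmin (show (⟨⟨L, hL.compact⟩, hL.nonempty⟩ : TopologicalSpace.NonemptyCompacts ℂ) ∈ 𝒦
    from ⟨hLD, hL.convex⟩)

/-! ### The perimeter -/

section Perimeter

variable (K : ConvexBody ℂ)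

lemma isBody_coe : IsBody (K : Set ℂ) := ⟨K.convex, K.isCompact, K.nonempty⟩

lemma polygonLength_le_cauchyPer {n : ℕ} {p : Fin (n + 1) → ℂ} (hp : ∀ i, p i ∈ K)
    (hc : IsConvexPolygon p) : polygonLength p ≤ cauchyPer K := by
  rw [← (convexPolygon_formulas p hc).1]
  have hb := IsBody.hull (finite_range p) (range_nonempty p)
  refine cauchyPer_mono hb.nonempty hb.compact K.isCompact (convexHull_min ?_ K.convex)
  rintro _ ⟨i, rfl⟩
  exact hp i

lemma perimeter_le_cauchyPer : perimeter K ≤ cauchyPer K := by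
  obtain ⟨z, hz⟩ := K.nonempty
  refine csSup_le ⟨_, 0, fun _ => z, fun _ => hz, ?_, rfl⟩ ?_
  · intro i j k hij
    rw [Fin.lt_def] at hij
    omega
  · rintro l ⟨n, p, hp, hc, rfl⟩
    exact polygonLength_le_cauchyPer K hp hc

/-- The supremum is meaningful only because the Cauchy perimeter bounds the lengths from above. -/
lemma polygonLength_le_perimeter {n : ℕ} {p : Fin (n + 1) → ℂ} (hp : ∀ i, p i ∈ K)
    (hc : IsConvexPolygon p) : polygonLength p ≤ perimeter K := by
  refine le_csSup ⟨cauchyPer K, ?_⟩ ⟨n, p, hp, hc, rfl⟩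
  rintro l ⟨n, p, hp, hc, rfl⟩
  exact polygonLength_le_cauchyPer K hp hc

lemma cauchyEnergy_le_energy (lam : ℝ) : cauchyEnergy lam K ≤ energy lam K :=
  sub_le_sub_left (perimeter_le_cauchyPer K) _

lemma energy_eq_of_le {lam : ℝ} (h : cauchyPer K ≤ perimeter K) :
    energy lam K = cauchyEnergy lam K := by
  rw [energy, le_antisymm (perimeter_le_cauchyPer K) h]; rfl

end Perimeter

lemma tendsto_nat_mul_sin_div (c : ℝ) :
    Filter.Tendsto (fun n : ℕ => (n : ℝ) * sin (c / n)) Filter.atTop (nhds c) := by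
  have h1 : Filter.Tendsto (fun n : ℕ => c / (n : ℝ)) Filter.atTop (nhds 0) :=
    tendsto_const_div_atTop_nhds_zero_nat c
  have h2 := ((continuous_sinc.tendsto 0).comp h1).const_mul c
  rw [sinc_zero, mul_one] at h2
  refine h2.congr' ?_
  filter_upwards [Filter.eventually_gt_atTop 0] with n hn
  have hn' : (n : ℝ) ≠ 0 := by exact_mod_cast hn.ne'
  rcases eq_or_ne c 0 with rfl | hc
  · simp
  · rw [Function.comp, sinc_of_ne_zero (div_ne_zero hc hn')]
    field_simp

/-! ### Polygons of a given type -/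

lemma type_sum {m : ℕ} {θ : Fin m → ℝ} {i₀ : Fin m} {b : ℝ} (hb : ∀ i, i ≠ i₀ → θ i = b)
    (g : ℝ → ℝ) : ∑ i, g (θ i) = g (θ i₀) + ((m : ℝ) - 1) * g b := by
  have hm : 1 ≤ m := by have := i₀.2; omega
  rw [← Finset.add_sum_erase _ _ (Finset.mem_univ i₀),
    Finset.sum_congr rfl (fun i hi => by rw [hb i (Finset.ne_of_mem_erase hi)]), Finset.sum_const,
    Finset.card_erase_of_mem (Finset.mem_univ _), Finset.card_univ, Fintype.card_fin,
    nsmul_eq_mul, Nat.cast_sub hm, Nat.cast_one]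

/-- Twice the area of a polygon of type `(m, t)`. -/
def typeArea (m : ℕ) (t : ℝ) : ℝ := sin t + ((m : ℝ) - 1) * sin ((2 * π - t) / ((m : ℝ) - 1))

lemma type_volume {K : Set ℂ} {m : ℕ} {t : ℝ} (hK : IsPolygonOfType K m t) :
    typeArea m t = 2 * volume.real K := by
  obtain ⟨θ, hθ, i₀, rfl, hb⟩ := hK
  obtain ⟨-, -, -, h, -⟩ := inscribed_formulas hθ
  rw [h, type_sum hb sin, typeArea]; ring

lemma type_cauchyEnergy {K : Set ℂ} {m : ℕ} {t : ℝ} (hK : IsPolygonOfType K m t) (lam : ℝ) :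
    cauchyEnergy lam K = reducedEnergy lam m t := by
  obtain ⟨θ, hθ, i₀, rfl, hb⟩ := hK
  rw [inscribed_cauchyEnergy hθ, type_sum hb (sideEnergy lam), reducedEnergy, sideEnergy,
    sideEnergy, div_div, mul_comm ((m : ℝ) - 1) 2]
  ring

lemma exists_type {m : ℕ} {t : ℝ} (h : Admissible m t) : ∃ K, IsPolygonOfType K m t := by
  obtain ⟨hm, ht, ht'⟩ := h
  have hm' : (3 : ℝ) ≤ m := by exact_mod_cast hm
  have hm1 : (0 : ℝ) < (m : ℝ) - 1 := by linarith
  have hlt : t < 2 * π := by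
    refine ht'.trans_lt ?_
    rw [div_lt_iff₀ (by linarith)]
    nlinarith [pi_pos]
  set i₀ : Fin m := ⟨0, by omega⟩
  set θ : Fin m → ℝ := fun i => if i = i₀ then t else (2 * π - t) / (m - 1) with hθ
  have hb : ∀ i, i ≠ i₀ → θ i = (2 * π - t) / (m - 1) := fun i hi => by simp [hθ, hi]
  have h0 : θ i₀ = t := by simp [hθ]
  obtain ⟨K, hK⟩ := exists_isInscribedPolygon (θ := θ) hm (by
    intro i
    rcases eq_or_ne i i₀ with rfl | hi
    · rwa [h0]
    · rw [hb i hi]; exact div_pos (by linarith) hm1) (by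
    rw [type_sum hb fun x => x, h0, mul_div_cancel₀ _ hm1.ne']; ring)
  exact ⟨K, θ, hK, i₀, h0, hb⟩

lemma type_body {K : Set ℂ} {m : ℕ} {t : ℝ} (hK : IsPolygonOfType K m t) :
    IsBody K ∧ K ⊆ unitDisk := by
  obtain ⟨θ, hθ, -⟩ := hK
  obtain ⟨h1, h2, -⟩ := inscribed_formulas hθ
  exact ⟨h1, h2⟩

/-- The derivative is the difference of the cosines of the exceptional angle and of the common one,
and below `2 * π / m` the exceptional angle is the smaller. -/
lemma typeArea_strictMonoOn {m : ℕ} (hm : 3 ≤ m) :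
    StrictMonoOn (typeArea m) (Icc 0 (2 * π / m)) := by
  have hm' : (3 : ℝ) ≤ m := by exact_mod_cast hm
  have hm1 : (0 : ℝ) < (m : ℝ) - 1 := by linarith
  have hd : ∀ s, HasDerivAt (typeArea m) (cos s - cos ((2 * π - s) / ((m : ℝ) - 1))) s := by
    intro s
    have h1 : HasDerivAt (fun s => (2 * π - s) / ((m : ℝ) - 1)) (-1 / ((m : ℝ) - 1)) s :=
      ((hasDerivAt_id s).const_sub (2 * π)).div_const _
    refine ((hasDerivAt_sin s).add (h1.sin.const_mul ((m : ℝ) - 1))).congr_deriv ?_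
    field_simp
    ring
  refine strictMonoOn_of_deriv_pos (convex_Icc _ _)
    (fun s _ => (hd s).continuousAt.continuousWithinAt) fun s hs => ?_
  rw [interior_Icc] at hs
  rw [(hd s).deriv, sub_pos]
  have h2 := hs.2
  rw [lt_div_iff₀ (by linarith)] at h2
  refine cos_lt_cos_of_nonneg_of_le_pi hs.1.le ?_ ?_
  · rw [div_le_iff₀ hm1]; nlinarith [hs.1, pi_pos]
  · rw [lt_div_iff₀ hm1]; linarith

lemma typeArea_zero (m : ℕ) : typeArea m 0 = ((m : ℝ) - 1) * sin (2 * π / ((m : ℝ) - 1)) := by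
  simp [typeArea]

lemma typeArea_regular {m : ℕ} (hm : 3 ≤ m) :
    typeArea m (2 * π / m) = (m : ℝ) * sin (2 * π / m) := by
  have hm' : (3 : ℝ) ≤ m := by exact_mod_cast hm
  have hm1 : (m : ℝ) - 1 ≠ 0 := by linarith
  have hm0 : (m : ℝ) ≠ 0 := by linarith
  have : (2 * π - 2 * π / m) / ((m : ℝ) - 1) = 2 * π / m := by
    field_simp
  rw [typeArea, this]; ring

lemma typeArea_bounds {m : ℕ} {t : ℝ} (h : Admissible m t) :
    ((m : ℝ) - 1) * sin (2 * π / ((m : ℝ) - 1)) < typeArea m t ∧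
      typeArea m t ≤ (m : ℝ) * sin (2 * π / m) := by
  obtain ⟨hm, ht, ht'⟩ := h
  have hmono := typeArea_strictMonoOn hm
  rw [← typeArea_zero, ← typeArea_regular hm]
  exact ⟨hmono ⟨le_rfl, ht.le.trans ht'⟩ ⟨ht.le, ht'⟩ ht,
    hmono.monotoneOn ⟨ht.le, ht'⟩ ⟨ht.le.trans ht', le_rfl⟩ ht'⟩

lemma mul_sin_two_pi_div_mono {k m : ℕ} (hk : 2 ≤ k) (h : k ≤ m) :
    (k : ℝ) * sin (2 * π / k) ≤ (m : ℝ) * sin (2 * π / m) := by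
  induction m, h using Nat.le_induction with
  | base => exact le_rfl
  | succ m hkm ih =>
    refine ih.trans ?_
    have hm : 3 ≤ m + 1 := by omega
    have := typeArea_bounds (m := m + 1) (t := 2 * π / (m + 1 : ℕ))
      ⟨hm, by positivity, le_rfl⟩
    rw [Nat.cast_succ, add_sub_cancel_right] at this
    rw [Nat.cast_succ]
    exact this.1.le.trans this.2

lemma typeArea_pos {m : ℕ} {t : ℝ} (h : Admissible m t) : 0 < typeArea m t := by
  have h1 := (typeArea_bounds h).1
  have hm' : (3 : ℝ) ≤ m := by exact_mod_cast h.1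
  refine lt_of_le_of_lt (mul_nonneg (by linarith) (sin_nonneg_of_nonneg_of_le_pi ?_ ?_)) h1
  · exact div_nonneg (by positivity) (by linarith)
  · rw [div_le_iff₀ (by linarith)]; nlinarith [pi_pos]

lemma typeArea_lt_two_pi {m : ℕ} {t : ℝ} (h : Admissible m t) : typeArea m t < 2 * π := by
  refine (typeArea_bounds h).2.trans_lt ?_
  have hm' : (3 : ℝ) ≤ m := by exact_mod_cast h.1
  have h1 : sin (2 * π / m) < 2 * π / m := sin_lt (by positivity)
  rw [lt_div_iff₀ (by linarith)] at h1
  linarith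

/-- For fixed `m` the areas fill the range above the regular `(m - 1)`-gon up to the regular
`m`-gon. These ranges are disjoint for different `m`, and within one the area is strictly increasing
in `t`. -/
lemma typeArea_injective {m k : ℕ} {t s : ℝ} (h : Admissible m t) (h' : Admissible k s)
    (e : typeArea m t = typeArea k s) : m = k ∧ t = s := by
  have key : ∀ {m k : ℕ} {t s : ℝ}, Admissible m t → Admissible k s →
      typeArea m t = typeArea k s → ¬ m < k := by
    intro m k t s h h' e hlt
    have h1 := (typeArea_bounds h).2
    have h2 := (typeArea_bounds h').1
    have hk : 1 ≤ k := by omega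
    have h3 := mul_sin_two_pi_div_mono (k := m) (m := k - 1) (by have := h.1; omega) (by omega)
    rw [Nat.cast_sub hk, Nat.cast_one] at h3
    linarith
  have hmk : m = k := le_antisymm (not_lt.1 (key h' h e.symm)) (not_lt.1 (key h h' e))
  subst hmk
  exact ⟨rfl, (typeArea_strictMonoOn h.1).injOn ⟨h.2.1.le, h.2.2⟩ ⟨h'.2.1.le, h'.2.2⟩ e⟩

/-- A normal form of the polygons of type `(m, t)`. -/
lemma type_normal_form {K : Set ℂ} {m : ℕ} {t : ℝ} (hK : IsPolygonOfType K m t) :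
    ∃ β : ℝ, K = convexHull ℝ
      (range fun k : Fin m => circlePt (β + k * ((2 * π - t) / ((m : ℝ) - 1)))) := by
  obtain ⟨θ, hθ, i₀, rfl, hb⟩ := hK
  obtain ⟨hm, hpos, hsum, α, rfl⟩ := isInscribedPolygon_iff.1 hθ
  set r := (2 * π - θ i₀) / ((m : ℝ) - 1) with hr
  have hm' : (3 : ℝ) ≤ m := by exact_mod_cast hm
  have hr' : ((m : ℝ) - 1) * r = 2 * π - θ i₀ := mul_div_cancel₀ _ (by linarith)
  -- The vertices advance by `r`, except for one jump `θ i₀` after `i₀`. Relabelled from the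
  -- endpoint of that side, they form a progression of step `r`; indices up to `i₀` come last, after
  -- a full turn.
  have hv : ∀ i, vertexAngle θ α i = α + i * r + if i₀ < i then θ i₀ - r else 0 := by
    intro i
    have h1 : ∀ j, θ j = r + if j = i₀ then θ i₀ - r else 0 := fun j => by
      split_ifs with h
      · rw [h]; ring
      · rw [hb j h, add_zero]
    have h2 : ∑ _j ∈ Finset.univ.filter (· < i), r = i * r := by
      rw [sum_filter_lt (fun _ => r) i]
      simp
    rw [vertexAngle, Finset.sum_congr rfl fun j _ => h1 j, Finset.sum_add_distrib, h2,
      Finset.sum_ite_eq']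
    simp only [Finset.mem_filter, Finset.mem_univ, true_and]
    ring
  have hi₀ := i₀.2
  have hafter : ∀ i : Fin m, ∀ k : ℕ, (i : ℕ) = i₀ + 1 + k →
      circlePt (vertexAngle θ α i) = circlePt (α + i₀ * r + θ i₀ + k * r) := by
    intro i k h
    rw [hv, if_pos (Fin.lt_def.2 (by omega)), h]
    push_cast
    congr 1; ring
  have hbefore : ∀ i : Fin m, ∀ k : ℕ, (i : ℕ) ≤ i₀ → k + i₀ + 1 = m + i →
      circlePt (vertexAngle θ α i) = circlePt (α + i₀ * r + θ i₀ + k * r) := by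
    intro i k h hk
    have hk' : (k : ℝ) + (i₀ : ℕ) + 1 = m + (i : ℕ) := by exact_mod_cast hk
    rw [hv, if_neg (by rw [Fin.lt_def]; omega), ← circlePt_add_two_pi]
    congr 1
    linear_combination (-r) * hk' - hr'
  refine ⟨α + i₀ * r + θ i₀, ?_⟩
  congr 1
  ext z
  constructor
  · rintro ⟨i, rfl⟩
    rcases le_or_gt (i : ℕ) i₀ with h | h
    · exact ⟨⟨m + i - i₀ - 1, by omega⟩, (hbefore i (m + i - i₀ - 1) h (by omega)).symm⟩
    · exact ⟨⟨i - i₀ - 1, by omega⟩, (hafter i (i - i₀ - 1) (by omega)).symm⟩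
  · rintro ⟨k, rfl⟩
    rcases le_or_gt ((i₀ : ℕ) + 1 + k) (m - 1) with h | h
    · exact ⟨⟨i₀ + 1 + k, by omega⟩, hafter _ k rfl⟩
    · have := k.2
      refine ⟨⟨k + i₀ + 1 - m, by omega⟩, hbefore _ k ?_ ?_⟩
      · show k + i₀ + 1 - m ≤ i₀
        omega
      · show k + i₀ + 1 = m + (k + i₀ + 1 - m)
        omega

lemma circlePt_add (x y : ℝ) : circlePt (x + y) = circlePt x * circlePt y := by
  rw [circlePt, Complex.ofReal_add, add_mul, Complex.exp_add]; rfl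

lemma mul_image_convexHull (c : ℂ) (S : Set ℂ) :
    (fun z => c * z) '' convexHull ℝ S = convexHull ℝ ((fun z => c * z) '' S) :=
  (LinearMap.mulLeft ℝ c).image_convexHull S

lemma type_rotation {K L : Set ℂ} {m : ℕ} {t : ℝ} (hK : IsPolygonOfType K m t)
    (hL : IsPolygonOfType L m t) : ∃ c : ℂ, ‖c‖ = 1 ∧ L = (fun z => c * z) '' K := by
  obtain ⟨β, rfl⟩ := type_normal_form hK
  obtain ⟨γ, rfl⟩ := type_normal_form hL
  refine ⟨circlePt (γ - β), norm_circlePt _, ?_⟩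
  rw [mul_image_convexHull, ← range_comp]
  congr 2
  ext1 k
  rw [Function.comp, ← circlePt_add]
  congr 1; ring

lemma diameter_rotation {K L : Set ℂ} (hK : IsDiameter K) (hL : IsDiameter L) :
    ∃ c : ℂ, ‖c‖ = 1 ∧ L = (fun z => c * z) '' K := by
  obtain ⟨u, hu, rfl⟩ := hK
  obtain ⟨v, hv, rfl⟩ := hL
  have hu0 : u ≠ 0 := by rintro rfl; simp at hu
  refine ⟨v / u, by rw [norm_div, hu, hv, div_one], ?_⟩
  rw [← convexHull_pair, ← convexHull_pair, mul_image_convexHull, image_pair]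
  congr 2
  · field_simp
  · field_simp

/-! ### Comparison of the two notions of perimeter on the minimisers -/

lemma diameter_dist {u : ℂ} (hu : ‖u‖ = 1) : dist (-u) u = 2 := by
  rw [dist_eq_norm, show -u - u = (-2 : ℝ) • u by module, norm_smul, hu]; norm_num

lemma IsDiameter.cauchyEnergy {K : Set ℂ} (hK : IsDiameter K) (lam : ℝ) :
    cauchyEnergy lam K = -4 := by
  obtain ⟨u, hu, rfl⟩ := hK
  rw [cauchyEnergy_segment, diameter_dist hu]; norm_num

lemma volume_unitDisk : volume.real unitDisk = π := by
  rw [measureReal_def, unitDisk, Complex.volume_closedBall]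
  simp

lemma tendsto_regular_energy (lam : ℝ) :
    Filter.Tendsto (fun n : ℕ => reducedEnergy lam n (2 * π / n)) Filter.atTop
      (nhds (cauchyEnergy lam unitDisk)) := by
  rw [cauchyEnergy, volume_unitDisk, cauchyPer_unitDisk]
  have h := ((tendsto_nat_mul_sin_div (2 * π)).const_mul (lam / 2)).sub
    ((tendsto_nat_mul_sin_div π).const_mul 2)
  rw [show lam / 2 * (2 * π) - 2 * π = lam * π - 2 * π by ring] at h
  refine h.congr' ?_
  filter_upwards [Filter.eventually_ge_atTop 3] with n hn
  have hn' : (3 : ℝ) ≤ n := by exact_mod_cast hn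
  have h1 : (n : ℝ) - 1 ≠ 0 := by linarith
  have h0 : (n : ℝ) ≠ 0 := by linarith
  have e1 : (2 * π - 2 * π / n) / ((n : ℝ) - 1) = 2 * π / n := by
    field_simp
  have e2 : (2 * π - 2 * π / n) / (2 * ((n : ℝ) - 1)) = π / n := by
    field_simp
  have e3 : 2 * π / n / 2 = π / n := by field_simp
  rw [reducedEnergy, e1, e2, e3]; ring

lemma regular_admissible {n : ℕ} (hn : 3 ≤ n) : Admissible n (2 * π / n) :=
  ⟨hn, by have : (3 : ℝ) ≤ n := by exact_mod_cast hn
          positivity, le_rfl⟩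

lemma tendsto_flat_energy (lam : ℝ) :
    Filter.Tendsto (reducedEnergy lam 3) (nhdsWithin 0 (Ioi 0)) (nhds (-4)) := by
  have hc : Continuous (reducedEnergy lam 3) := by unfold reducedEnergy; fun_prop
  have h := hc.tendsto 0
  have e : reducedEnergy lam 3 0 = -4 := by
    rw [reducedEnergy]
    norm_num
    rw [show 2 * π / 4 = π / 2 by ring]
    norm_num
  rw [e] at h
  exact h.mono_left nhdsWithin_le_nhds

lemma two_pi_le_perimeter {K : ConvexBody ℂ} (hK : (K : Set ℂ) = unitDisk) :
    2 * π ≤ perimeter K := by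
  have ht := (tendsto_nat_mul_sin_div π).const_mul 2
  refine le_of_tendsto ht ?_
  filter_upwards [Filter.eventually_ge_atTop 3] with n hn
  have hn' : (3 : ℝ) ≤ n := by exact_mod_cast hn
  obtain ⟨L, hL⟩ := exists_isInscribedPolygon (m := n) (θ := fun _ => 2 * π / n) hn
    (fun _ => by positivity) (by
      rw [Finset.sum_const, Finset.card_univ, Fintype.card_fin, nsmul_eq_mul]; field_simp)
  obtain ⟨-, hLD, hper, -, k, p, hp, hpc, hlen⟩ := inscribed_formulas hL
  have hpK : ∀ i, p i ∈ K := fun i => by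
    have := hLD (hp i)
    rw [← hK] at this
    exact this
  have := polygonLength_le_perimeter K hpK hpc
  rw [hlen, hper, Finset.sum_const, Finset.card_univ, Fintype.card_fin, nsmul_eq_mul,
    show 2 * π / n / 2 = π / n by field_simp] at this
  linarith

/-- Equality of the perimeters is needed only for the shapes left by the classification: polygons
and diameters attain the Cauchy perimeter, and for the disk it is the limit over inscribed regular
polygons. -/
lemma IsMin.energy_eq {lam : ℝ} (hlam : 0 < lam) {K : ConvexBody ℂ}
    (hK : IsMin lam (K : Set ℂ)) : energy lam K = cauchyEnergy lam K := by
  apply energy_eq_of_le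
  rcases hK.classification hlam with h | ⟨u, hu, h⟩ | ⟨m, t, -, ⟨θ, hθ, -⟩, -⟩
  · rw [h, cauchyPer_unitDisk]; exact two_pi_le_perimeter h
  · have hseg : ∀ z ∈ segment ℝ (-u) u, z ∈ K := fun z hz => by
      have : z ∈ (K : Set ℂ) := h ▸ hz
      exact this
    have := polygonLength_le_perimeter K (p := ![-u, u]) (by
      intro i
      fin_cases i
      · exact hseg _ (left_mem_segment ℝ _ _)
      · exact hseg _ (right_mem_segment ℝ _ _)) (by
      intro i j k hij hjk
      rw [Fin.lt_def] at hij hjk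
      omega)
    rw [h, cauchyPer_segment]
    have hlen : polygonLength (n := 1) ![-u, u] = 2 * dist (-u) u := by
      simp [polygonLength, dist_comm u]
      ring
    exact hlen ▸ this
  · obtain ⟨-, -, -, -, k, p, hp, hpc, hlen⟩ := inscribed_formulas hθ
    rw [← hlen]
    exact polygonLength_le_perimeter K hp hpc

/-- The bundled version of a planar convex body. -/
def IsBody.toConvexBody {K : Set ℂ} (hK : IsBody K) : ConvexBody ℂ :=
  ⟨K, hK.convex, hK.compact, hK.nonempty⟩

lemma IsMin.isSolution {lam : ℝ} (hlam : 0 < lam) {K : ConvexBody ℂ}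
    (hK : IsMin lam (K : Set ℂ)) : IsSolution lam K :=
  ⟨hK.subset, fun L hL => by
    rw [hK.energy_eq hlam]
    exact (hK.le L (isBody_coe L) hL).trans (cauchyEnergy_le_energy L lam)⟩

lemma exists_isSolution {lam : ℝ} (hlam : 0 < lam) :
    ∃ K : ConvexBody ℂ, IsMin lam (K : Set ℂ) := by
  obtain ⟨K, hK⟩ := exists_isMin hlam
  exact ⟨hK.body.toConvexBody, hK⟩

lemma isSolution_iff_isMin {lam : ℝ} (hlam : 0 < lam) (K : ConvexBody ℂ) :
    IsSolution lam K ↔ IsMin lam (K : Set ℂ) := by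
  refine ⟨fun h => ⟨isBody_coe K, h.1, fun L hL hLD => ?_⟩, fun h => h.isSolution hlam⟩
  obtain ⟨B, hB⟩ := exists_isSolution hlam
  calc cauchyEnergy lam K ≤ energy lam K := cauchyEnergy_le_energy K lam
    _ ≤ energy lam B := h.2 B hB.subset
    _ = cauchyEnergy lam B := hB.energy_eq hlam
    _ ≤ cauchyEnergy lam L := hB.le L hL hLD

/-- The polygonal minimisers are determined by the reduced energy. -/
lemma isMin_type_iff {lam : ℝ} (hlam : 0 < lam) {K : Set ℂ} {m : ℕ} {t : ℝ}
    (hK : IsPolygonOfType K m t) : IsMin lam K ↔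
      ∀ (k : ℕ) (s : ℝ), Admissible k s → reducedEnergy lam m t ≤ reducedEnergy lam k s := by
  rw [← type_cauchyEnergy hK]
  constructor
  · intro h k s hks
    obtain ⟨L, hL⟩ := exists_type hks
    rw [← type_cauchyEnergy hL]
    exact h.le L (type_body hL).1 (type_body hL).2
  · intro h
    obtain ⟨B, hB⟩ := exists_isMin hlam
    have hle : cauchyEnergy lam K ≤ cauchyEnergy lam B := by
      -- The disk is the limit of regular polygons and a diameter that of flattening triangles, so
      -- the assumed inequality passes to their energies.
      rcases hB.classification hlam with rfl | hd | ⟨k, s, hks, hL, -⟩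
      · refine ge_of_tendsto (tendsto_regular_energy lam) ?_
        filter_upwards [Filter.eventually_ge_atTop 3] with n hn
        exact h n _ (regular_admissible hn)
      · rw [hd.cauchyEnergy]
        refine ge_of_tendsto (tendsto_flat_energy lam) ?_
        have h3 : (0 : ℝ) < 2 * π / (3 : ℕ) := by positivity
        filter_upwards [Ioo_mem_nhdsGT h3] with s hs
        exact h 3 s ⟨le_rfl, hs.1, hs.2.le⟩
      · rw [type_cauchyEnergy hL]; exact h k s hks
    exact ⟨(type_body hK).1, (type_body hK).2, fun L hL hLD => hle.trans (hB.le L hL hLD)⟩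

/-! ### Uniqueness -/

/-- Minimisers for the same `lam` with the same area are congruent by a rotation. -/
lemma IsMin.rotation_of_volume_eq {lam : ℝ} (hlam : 0 < lam) {K L : Set ℂ} (hK : IsMin lam K)
    (hL : IsMin lam L) (h : volume.real K = volume.real L) :
    ∃ c : ℂ, ‖c‖ = 1 ∧ L = (fun z => c * z) '' K := by
  have hdia : ∀ {S : Set ℂ}, IsDiameter S → volume.real S = 0 := by
    rintro S ⟨u, -, rfl⟩; exact volume_real_segment _ _
  -- The areas `π`, `0` and those strictly between separate the three families, so only the diagonal
  -- cases survive.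
  rcases hK.classification hlam with rfl | hKd | ⟨m, t, hmt, hKt, -⟩ <;>
    rcases hL.classification hlam with rfl | hLd | ⟨k, s, hks, hLt, -⟩
  · exact ⟨1, by simp, by simp⟩
  · rw [volume_unitDisk, hdia hLd] at h
    exact absurd h pi_ne_zero
  · have := typeArea_lt_two_pi hks
    rw [type_volume hLt, ← h, volume_unitDisk] at this
    exact absurd this (lt_irrefl _)
  · rw [volume_unitDisk, hdia hKd] at h
    exact absurd h.symm pi_ne_zero
  · exact diameter_rotation hKd hLd
  · have := typeArea_pos hks
    rw [type_volume hLt, ← h, hdia hKd, mul_zero] at this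
    exact absurd this (lt_irrefl _)
  · have := typeArea_lt_two_pi hmt
    rw [type_volume hKt, h, volume_unitDisk] at this
    exact absurd this (lt_irrefl _)
  · have := typeArea_pos hmt
    rw [type_volume hKt, h, hdia hLd, mul_zero] at this
    exact absurd this (lt_irrefl _)
  · obtain ⟨rfl, rfl⟩ := typeArea_injective hmt hks
      (by rw [type_volume hKt, type_volume hLt, h])
    exact type_rotation hKt hLt

/-- The area of the minimisers decreases with `lam`. -/
lemma IsMin.volume_le {lam mu : ℝ} (h : lam < mu) {K L : Set ℂ} (hK : IsMin lam K)
    (hL : IsMin mu L) : volume.real L ≤ volume.real K := by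
  have h1 := hK.le L hL.body hL.subset
  have h2 := hL.le K hK.body hK.subset
  simp only [cauchyEnergy] at h1 h2
  have : (mu - lam) * volume.real L ≤ (mu - lam) * volume.real K := by linarith
  exact le_of_mul_le_mul_left this (by linarith)

/-- By `IsMin.volume_le` the open intervals between two areas attained at the same `lam` are
disjoint for different `lam`; a rational chosen in each gives an injection into `ℚ`. -/
lemma countable_of_two_areas :
    {lam : ℝ | ∃ K L, IsMin lam K ∧ IsMin lam L ∧ volume.real K < volume.real L}.Countable := by
  choose! K L hK hL hlt using fun (lam : ℝ)
    (h : ∃ K L, IsMin lam K ∧ IsMin lam L ∧ volume.real K < volume.real L) => h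
  choose! q hq1 hq2 using fun (lam : ℝ)
    (h : ∃ K L, IsMin lam K ∧ IsMin lam L ∧ volume.real K < volume.real L) =>
    exists_rat_btwn (hlt lam h)
  have key : ∀ lam ∈ {lam : ℝ | ∃ K L, IsMin lam K ∧ IsMin lam L ∧ volume.real K < volume.real L},
      ∀ mu ∈ {lam : ℝ | ∃ K L, IsMin lam K ∧ IsMin lam L ∧ volume.real K < volume.real L},
      lam < mu → q lam ≠ q mu := by
    intro lam h mu h' hlm e
    have h1 := hq1 lam h
    have h2 := hq2 mu h'
    rw [e] at h1
    linarith [(hK lam h).volume_le hlm (hL mu h')]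
  refine MapsTo.countable_of_injOn (f := q) (mapsTo_univ _ _) ?_ countable_univ
  intro lam h mu h' e
  rcases lt_trichotomy lam mu with hl | hl | hl
  · exact absurd e (key lam h mu h' hl)
  · exact hl
  · exact absurd e.symm (key mu h' lam h hl)

end ReverseIsoperimetric
end

/-! ### Assembly of the theorem. -/

theorem mainTheorem4 :
    (∀ lam : ℝ, 0 < lam →
      -- existence
      (∃ K : ConvexBody ℂ, IsSolution lam K) ∧
      -- every solution is the disk, a diameter, or a polygon all but one of whose sides are equal
      (∀ K : ConvexBody ℂ, IsSolution lam K →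
        (K : Set ℂ) = unitDisk ∨
        IsDiameter (K : Set ℂ) ∨
        ∃ (m : ℕ) (t : ℝ), Admissible m t ∧ IsPolygonOfType (K : Set ℂ) m t ∧
          ((m : ℝ) - 1) * sin (2 * π / ((m : ℝ) - 1)) < 2 * area K ∧
          2 * area K ≤ (m : ℝ) * sin (2 * π / (m : ℝ)) ∧
          sin t + ((m : ℝ) - 1) * sin ((2 * π - t) / ((m : ℝ) - 1)) = 2 * area K ∧
          (t = 2 * π / (m : ℝ) ∨
            lam = (cos (t / 2) + cos ((2 * π - t) / (2 * ((m : ℝ) - 1))))⁻¹)) ∧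
      -- the polygonal solutions are determined by an explicit problem in terms of `lam`
      (∀ (K : ConvexBody ℂ) (m : ℕ) (t : ℝ), Admissible m t → IsPolygonOfType (K : Set ℂ) m t →
        (IsSolution lam K ↔
          ∀ (k : ℕ) (s : ℝ), Admissible k s → reducedEnergy lam m t ≤ reducedEnergy lam k s))) ∧
    -- for all but countably many `lam` the solution is unique up to rotation
    (∃ E : Set ℝ, E.Countable ∧ ∀ lam : ℝ, 0 < lam → lam ∉ E →
      ∀ K L : ConvexBody ℂ, IsSolution lam K → IsSolution lam L →
        ∃ c : ℂ, ‖c‖ = 1 ∧ (L : Set ℂ) = (fun z : ℂ => c * z) '' (K : Set ℂ)) := by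
  refine ⟨fun lam hlam => ⟨?_, ?_, ?_⟩, ?_⟩
  · obtain ⟨K, hK⟩ := exists_isSolution hlam
    exact ⟨K, hK.isSolution hlam⟩
  · intro K hK
    have hK := (isSolution_iff_isMin hlam K).1 hK
    rcases hK.classification hlam with h | h | ⟨m, t, hmt, hKt, h⟩
    · exact Or.inl h
    · exact Or.inr (Or.inl h)
    · have hb := typeArea_bounds hmt
      have hv : typeArea m t = 2 * area K := type_volume hKt
      exact Or.inr (Or.inr ⟨m, t, hmt, hKt, hv ▸ hb.1, hv ▸ hb.2, hv, h⟩)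
  · intro K m t _ hKt
    rw [isSolution_iff_isMin hlam K]
    exact isMin_type_iff hlam hKt
  · refine ⟨_, countable_of_two_areas, fun lam hlam hE K L hK hL => ?_⟩
    have hK := (isSolution_iff_isMin hlam K).1 hK
    have hL := (isSolution_iff_isMin hlam L).1 hL
    refine hK.rotation_of_volume_eq hlam hL ?_
    rcases lt_trichotomy (MeasureTheory.Measure.real MeasureTheory.volume (K : Set ℂ))
      (MeasureTheory.Measure.real MeasureTheory.volume (L : Set ℂ)) with h | h | h
    · exact absurd ⟨K, L, hK, hL, h⟩ hE
    · exact h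
    · exact absurd ⟨L, K, hL, hK, h⟩ hE
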